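/- Let $n\in\{2,3\}$ and let $\Omega\subset\mathbb R^n$ be a bounded domain (nonempty, open, connected) whose boundary is piecewise $C^1$, in the following sense: near every point of $\partial\Omega$ there is a homeomorphism between open subsets of $\mathbb R^n$, piecewise $C^1$ together with its inverse (that is, continuous and at each point equal to one of finitely many $C^1$ maps), which maps $\Omega$ to the part of its range that lies on one side of a coordinate hyperplane. Let $H^1(\Omega)$ be the usual Sobolev space with $\|u\|_{H^1(\Omega)}^2=\|u\|_{L^2(\Omega)}^2+\|\nabla u\|_{L^2(\Omega)}^2$. The trace $u|_{\partial\Omega}$ of $u\in H^1(\Omega)$ is the limit in $L^2(\partial\Omega)$ of $\varphi_k|_{\partial\Omega}$ for smooth $\varphi_k$ on $\mathbb R^n$ with $\varphi_k\to u$ in $H^1(\Omega)$. Let $H^{1/2}(\partial\Omega)$ be the space of traces of functions in $H^1(\Omega)$, with norm $\|g\|_{H^{1/2}(\partial\Omega)}=\inf\{\|w\|_{H^1(\Omega)} : w\in H^1(\Omega),\ w|_{\partial\Omega}=g\}$. Let $\alpha>0$. There is a constant $C$, depending only on $\alpha$ and $\Omega$, such that the following holds for all $a\in C^0(\mathbb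 R)$ with $\alpha\le a(t)\le 1/\alpha$ for all $t\in\mathbb R$, all $c\in L^\infty(\Omega)$ with $0\le c(x)\le 1/\alpha$ for a.e. $x\in\Omega$, and all $g\in H^{1/2}(\partial\Omega)$. The problem $$-\operatorname{div}(a(u)\nabla u)+cu=0\ \text{ in }\Omega,\qquad u=g\ \text{ on }\partial\Omega,$$ has a unique weak solution, that is, there is exactly one $u\in H^1(\Omega)$ with $u|_{\partial\Omega}=g$ and $$\int_\Omega a(u)\,\nabla u\cdot\nabla\varphi+c\,u\,\varphi\,dx=0\quad\text{for all }\varphi\in C_c^\infty(\Omega),$$ and this solution satisfies $\|u\|_{H^1(\Omega)}\le C\,\|g\|_{H^{1/2}(\partial\Omega)}$. -/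

import Mathlib

open MeasureTheory Set Filter Topology
open scoped ENNReal ContDiff

namespace QuasilinearElliptic

/-- A map is piecewise `C¹` on the open set `U` if it is continuous on `U` and at every point of `U`
it takes the value of one of finitely many maps that are `C¹` on `U`. -/
def PiecewiseC1On {n : ℕ}
    (f : EuclideanSpace ℝ (Fin n) → EuclideanSpace ℝ (Fin n))
    (U : Set (EuclideanSpace ℝ (Fin n))) : Prop :=
  ContinuousOn f U ∧
    ∃ (m : ℕ) (F : Fin m → EuclideanSpace ℝ (Fin n) → EuclideanSpace ℝ (Fin n)),
      (∀ j, ContDiffOn ℝ 1 (F j) U) ∧ ∀ x ∈ U, ∃ j, f x = F j x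

/-- `∂Ω` is piecewise `C¹`: near every boundary point there is a change of coordinates, piecewise
`C¹` together with its inverse, that maps `Ω` to one side of a coordinate hyperplane (and hence `∂Ω`
to this hyperplane). -/
def HasPiecewiseC1Boundary {n : ℕ} (Ω : Set (EuclideanSpace ℝ (Fin n))) : Prop :=
  ∀ x ∈ frontier Ω,
    ∃ (e : OpenPartialHomeomorph (EuclideanSpace ℝ (Fin n)) (EuclideanSpace ℝ (Fin n)))
      (i : Fin n),
      x ∈ e.source ∧ PiecewiseC1On e e.source ∧ PiecewiseC1On e.symm e.target ∧
        ∀ y ∈ e.source, (y ∈ Ω ↔ 0 < e y i)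

/-- Test functions: smooth, with compact support contained in `Ω`. -/
def IsTestFunction {n : ℕ} (Ω : Set (EuclideanSpace ℝ (Fin n)))
    (φ : EuclideanSpace ℝ (Fin n) → ℝ) : Prop :=
  ContDiff ℝ ∞ φ ∧ HasCompactSupport φ ∧ tsupport φ ⊆ Ω

theorem IsTestFunction.memLp {n : ℕ} {Ω : Set (EuclideanSpace ℝ (Fin n))}
    {φ : EuclideanSpace ℝ (Fin n) → ℝ} (h : IsTestFunction Ω φ) :
    MemLp φ 2 (volume.restrict Ω) :=
  (h.1.continuous.memLp_of_hasCompactSupport h.2.1).restrict Ω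

theorem IsTestFunction.memLp_gradient {n : ℕ} {Ω : Set (EuclideanSpace ℝ (Fin n))}
    {φ : EuclideanSpace ℝ (Fin n) → ℝ} (h : IsTestFunction Ω φ) :
    MemLp (gradient φ) 2 (volume.restrict Ω) := by
  have hc : Continuous (gradient φ) :=
    (InnerProductSpace.toDual ℝ (EuclideanSpace ℝ (Fin n))).symm.continuous.comp
      (h.1.continuous_fderiv (by simp))
  have hs : HasCompactSupport (gradient φ) :=
    (h.2.1.fderiv (𝕜 := ℝ)).comp_left (map_zero _)
  exact (hc.memLp_of_hasCompactSupport hs).restrict Ω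

/-- `G` is the weak gradient of `u` in `Ω`, for square integrable `u` and `G`. -/
def IsWeakGradient {n : ℕ} {Ω : Set (EuclideanSpace ℝ (Fin n))}
    (u : Lp ℝ 2 (volume.restrict Ω))
    (G : Lp (EuclideanSpace ℝ (Fin n)) 2 (volume.restrict Ω)) : Prop :=
  ∀ φ : EuclideanSpace ℝ (Fin n) → ℝ, IsTestFunction Ω φ →
    ∫ x in Ω, u x • gradient φ x = -∫ x in Ω, φ x • G x

/-- The Sobolev space `H¹(Ω)`, as the space of pairs `(u, ∇u)` of a square integrable function and
its square integrable weak gradient. The norm inherited from the Hilbert sum is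
`(‖u‖² + ‖∇u‖²)^(1/2)`, with the norms of `L²(Ω)`. -/
noncomputable def H1 {n : ℕ} (Ω : Set (EuclideanSpace ℝ (Fin n))) :
    Submodule ℝ (WithLp 2 (Lp ℝ 2 (volume.restrict Ω) ×
      Lp (EuclideanSpace ℝ (Fin n)) 2 (volume.restrict Ω))) where
  carrier := {p | IsWeakGradient p.fst p.snd}
  zero_mem' := by
    intro φ _
    rw [WithLp.zero_fst, WithLp.zero_snd]
    have h1 : ∀ᵐ x ∂(volume.restrict Ω),
        (0 : Lp ℝ 2 (volume.restrict Ω)) x • gradient φ x = 0 := by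
      filter_upwards [Lp.coeFn_zero ℝ 2 (volume.restrict Ω)] with x hx
      rw [hx, Pi.zero_apply, zero_smul]
    have h2 : ∀ᵐ x ∂(volume.restrict Ω),
        φ x • (0 : Lp (EuclideanSpace ℝ (Fin n)) 2 (volume.restrict Ω)) x = 0 := by
      filter_upwards [Lp.coeFn_zero (EuclideanSpace ℝ (Fin n)) 2 (volume.restrict Ω)] with x hx
      rw [hx, Pi.zero_apply, smul_zero]
    rw [integral_eq_zero_of_ae h1, integral_eq_zero_of_ae h2, neg_zero]
  add_mem' := by
    intro p q hp hq φ hφ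
    have h1 : ∀ᵐ x ∂(volume.restrict Ω), (p + q).fst x • gradient φ x
        = p.fst x • gradient φ x + q.fst x • gradient φ x := by
      rw [WithLp.add_fst]
      filter_upwards [Lp.coeFn_add p.fst q.fst] with x hx
      rw [hx, Pi.add_apply, add_smul]
    have h2 : ∀ᵐ x ∂(volume.restrict Ω), φ x • (p + q).snd x
        = φ x • p.snd x + φ x • q.snd x := by
      rw [WithLp.add_snd]
      filter_upwards [Lp.coeFn_add p.snd q.snd] with x hx
      rw [hx, Pi.add_apply, smul_add]
    have i1 : ∀ r : WithLp 2 (Lp ℝ 2 (volume.restrict Ω) ×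
        Lp (EuclideanSpace ℝ (Fin n)) 2 (volume.restrict Ω)), Integrable (fun x => r.fst x • gradient φ x) (volume.restrict Ω) :=
      fun r => memLp_one_iff_integrable.1 (hφ.memLp_gradient.smul (Lp.memLp r.fst))
    have i2 : ∀ r : WithLp 2 (Lp ℝ 2 (volume.restrict Ω) ×
        Lp (EuclideanSpace ℝ (Fin n)) 2 (volume.restrict Ω)), Integrable (fun x => φ x • r.snd x) (volume.restrict Ω) :=
      fun r => memLp_one_iff_integrable.1 ((Lp.memLp r.snd).smul hφ.memLp)
    rw [integral_congr_ae h1, integral_congr_ae h2, integral_add (i1 p) (i1 q),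
      integral_add (i2 p) (i2 q),
      hp φ hφ, hq φ hφ, neg_add]
  smul_mem' := by
    intro r p hp φ hφ
    have h1 : ∀ᵐ x ∂(volume.restrict Ω), (r • p).fst x • gradient φ x
        = r • (p.fst x • gradient φ x) := by
      rw [WithLp.smul_fst]
      filter_upwards [Lp.coeFn_smul r p.fst] with x hx
      rw [hx, Pi.smul_apply, smul_assoc]
    have h2 : ∀ᵐ x ∂(volume.restrict Ω), φ x • (r • p).snd x = r • (φ x • p.snd x) := by
      rw [WithLp.smul_snd]
      filter_upwards [Lp.coeFn_smul r p.snd] with x hx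
      rw [hx, Pi.smul_apply, smul_comm]
    rw [integral_congr_ae h1, integral_congr_ae h2, integral_smul, integral_smul, hp φ hφ, smul_neg]

/-- The function underlying an element of `H¹(Ω)`. -/
noncomputable def H1.fn {n : ℕ} {Ω : Set (EuclideanSpace ℝ (Fin n))} (u : H1 Ω) :
    EuclideanSpace ℝ (Fin n) → ℝ :=
  u.1.fst

/-- The weak gradient of an element of `H¹(Ω)`. -/
noncomputable def H1.grad {n : ℕ} {Ω : Set (EuclideanSpace ℝ (Fin n))} (u : H1 Ω) :
    EuclideanSpace ℝ (Fin n) → EuclideanSpace ℝ (Fin n) :=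
  u.1.snd

/-- The surface measure on `∂Ω`: the `(n-1)`-dimensional Hausdorff measure. -/
noncomputable def surfaceMeasure {n : ℕ} (Ω : Set (EuclideanSpace ℝ (Fin n))) :
    Measure (EuclideanSpace ℝ (Fin n)) :=
  (μHE[n - 1] : Measure (EuclideanSpace ℝ (Fin n))).restrict (frontier Ω)

/-- `g ∈ L²(∂Ω)` is the trace of `u ∈ H¹(Ω)`: there are functions `φₖ`, smooth up to the boundary,
with `φₖ → u` in `H¹(Ω)` and `φₖ|∂Ω → g` in `L²(∂Ω)`. -/
def IsTrace {n : ℕ} {Ω : Set (EuclideanSpace ℝ (Fin n))} (u : H1 Ω)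
    (g : Lp ℝ 2 (surfaceMeasure Ω)) : Prop :=
  ∃ φ : ℕ → EuclideanSpace ℝ (Fin n) → ℝ, (∀ k, ContDiff ℝ ∞ (φ k)) ∧
    Tendsto (fun k => eLpNorm (fun x => φ k x - H1.fn u x) 2 (volume.restrict Ω)) atTop (𝓝 0) ∧
    Tendsto (fun k => eLpNorm (fun x => gradient (φ k) x - H1.grad u x) 2 (volume.restrict Ω))
      atTop (𝓝 0) ∧
    Tendsto (fun k => eLpNorm (fun x => φ k x - g x) 2 (surfaceMeasure Ω)) atTop (𝓝 0)

/-- `H^{1/2}(∂Ω)`, the space of traces of functions in `H¹(Ω)`. -/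
def HHalf {n : ℕ} (Ω : Set (EuclideanSpace ℝ (Fin n))) : Set (Lp ℝ 2 (surfaceMeasure Ω)) :=
  {g | ∃ u : H1 Ω, IsTrace u g}

/-- The norm of `H^{1/2}(∂Ω)`: the infimum of `‖u‖_{H¹(Ω)}` over all `u ∈ H¹(Ω)` with trace `g`. -/
noncomputable def hHalfNorm {n : ℕ} {Ω : Set (EuclideanSpace ℝ (Fin n))}
    (g : Lp ℝ 2 (surfaceMeasure Ω)) : ℝ :=
  ⨅ u : {u : H1 Ω // IsTrace u g}, ‖u.1‖

/-- `u ∈ H¹(Ω)` is a weak solution of `-div(a(u)∇u) + cu = 0` in `Ω`, `u = g` on `∂Ω`. -/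
def IsWeakSolution {n : ℕ} {Ω : Set (EuclideanSpace ℝ (Fin n))} (a : ℝ → ℝ)
    (c : EuclideanSpace ℝ (Fin n) → ℝ) (g : Lp ℝ 2 (surfaceMeasure Ω)) (u : H1 Ω) : Prop :=
  (∀ φ : EuclideanSpace ℝ (Fin n) → ℝ, IsTestFunction Ω φ →
    ∫ x in Ω, (a (H1.fn u x) * inner ℝ (H1.grad u x) (gradient φ x) + c x * H1.fn u x * φ x) = 0) ∧
  IsTrace u g

end QuasilinearElliptic

namespace QuasilinearElliptic

open scoped NNReal Convolution
open ContinuousLinearMap (lsmul)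

/-! The Kirchhoff transform removes the quasilinearity. With `A(t) = ∫₀ᵗ a` and `v = A(u)` one has
`∇v = a(u)∇u`, so the equation becomes `-Δv + c b(v) = 0`, where `b = A⁻¹` is increasing and
Lipschitz.

Existence: on `v₀ + H¹₀(Ω)`, with `v₀ = A(w)` and `w` any extension of `g`, the semilinear operator
is Lipschitz, and strongly monotone by the Poincaré inequality. A Banach fixed point argument
(`exists_forall_inner_eq_zero`) solves it, and `u = b(v)` is the solution. That `u` has trace `g` is
seen on approximants: perturbing `A ∘ ψ` by a test function and applying `b` changes `ψ` only on the
support of that test function.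

Uniqueness: for two solutions `u`, `w` the difference of the equations is tested with `A(u) - A(w)`.
The leading term is `‖∇(A(u) - A(w))‖²`, and the term with `c` is nonnegative because `A` is
increasing.

Bound: the coefficient `a(u)` is frozen, which makes the equation linear, and it is tested with `u -
w` for an arbitrary extension `w` of `g`. Only `α ≤ a ≤ 1/α`, the bound on `c` and the Poincaré
constant enter.

The last two steps need that functions with equal traces differ by an element of `H¹₀(Ω)`, here the
closure of the test functions (`mem_H10_of_tendsto_jet`). This is where the boundary regularity is
used. In bi-Lipschitz charts, integration along lines transversal to the boundary bounds the `L²`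
norm on a strip of width `ε` by `ε` times the boundary values plus `ε²` times the gradient
(`exists_strip_estimate`). The factor `ε²` compensates the slope `3/ε` of a cutoff function, so
functions whose boundary values tend to zero can be cut off near the boundary at vanishing cost. -/

/-! ### Lipschitz maps and change of variables -/

/-- A piecewise `C¹` map is locally Lipschitz. -/
theorem PiecewiseC1On.exists_lipschitzOnWith {n : ℕ}
    {f : EuclideanSpace ℝ (Fin n) → EuclideanSpace ℝ (Fin n)}
    {U : Set (EuclideanSpace ℝ (Fin n))} (hf : PiecewiseC1On f U) (hU : IsOpen U)
    {x : EuclideanSpace ℝ (Fin n)} (hx : x ∈ U) :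
    ∃ K : ℝ≥0, ∃ r > 0, Metric.ball x r ⊆ U ∧ LipschitzOnWith K f (Metric.ball x r) := by
  obtain ⟨hfc, m, F, hF, hfF⟩ := hf
  have hloc : ∀ j, ∃ K : ℝ≥0, ∃ t ∈ 𝓝 x, LipschitzOnWith K (F j) t := fun j =>
    ((hF j).contDiffAt (hU.mem_nhds hx)).exists_lipschitzOnWith
  choose K t ht hK using hloc
  obtain ⟨r, hr, hball⟩ := Metric.mem_nhds_iff.1
    (Filter.inter_mem (hU.mem_nhds hx) (Filter.iInter_mem.2 ht))
  have hKle : ∀ j, K j ≤ ∑ i, K i := fun j =>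
    Finset.single_le_sum (f := K) (fun _ _ => zero_le) (Finset.mem_univ j)
  refine ⟨∑ j, K j, r, hr, fun y hy => (hball hy).1, ?_⟩
  have hFL : ∀ j, ∀ y ∈ Metric.ball x r, ∀ z ∈ Metric.ball x r,
      ‖F j y - F j z‖ ≤ (∑ i, K i : ℝ≥0) * ‖y - z‖ := by
    intro j y hy z hz
    refine ((hK j).norm_sub_le (mem_iInter.1 (hball hy).2 j)
      (mem_iInter.1 (hball hz).2 j)).trans ?_
    gcongr
    exact hKle j
  set L := ∑ j, K j
  refine LipschitzOnWith.of_dist_le_mul fun z hz y hy => ?_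
  rw [dist_eq_norm, dist_eq_norm]
  let γ : ℝ → EuclideanSpace ℝ (Fin n) := fun s => y + s • (z - y)
  have hγc : Continuous γ := by fun_prop
  have hγ : ∀ s ∈ Icc (0 : ℝ) 1, γ s ∈ Metric.ball x r := fun s hs =>
    (convex_ball x r).add_smul_sub_mem hy hz hs
  have hγd : ∀ s s', γ s - γ s' = (s - s') • (z - y) := fun s s' => by
    simp only [γ]; module
  have hfγ : ContinuousOn (fun s => f (γ s)) (Icc 0 1) :=
    hfc.comp hγc.continuousOn fun s hs => (hball (hγ s hs)).1
  have key := image_le_of_liminf_slope_right_le_deriv_boundary (a := 0) (b := 1)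
    (f := fun s => ‖f (γ s) - f y‖) (B := fun s => L * ‖z - y‖ * s)
    (B' := fun _ => L * ‖z - y‖) (hfγ.sub continuousOn_const).norm
    (by simp [γ]) (by fun_prop)
    (fun s _ => ((hasDerivAt_id s).const_mul _).hasDerivWithinAt.congr_deriv (by simp))
    (by
      intro s hs ρ hρ
      apply Filter.Eventually.frequently
      have h1 : ∀ᶠ u in 𝓝[>] s, u ∈ Ioc s 1 := Ioc_mem_nhdsGT hs.2
      have hsub : Ioc s 1 ⊆ Icc 0 1 := fun u hu => ⟨hs.1.trans hu.1.le, hu.2⟩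
      -- By continuity a piece that differs from `f` at `γ s` also differs from it just after `s`.
      -- So every piece active just after `s` agrees with `f` at `γ s`, and its Lipschitz constant
      -- bounds the right slope.
      have h2 : ∀ᶠ u in 𝓝[>] s, ∀ j, F j (γ s) ≠ f (γ s) → f (γ u) ≠ F j (γ u) := by
        rw [Filter.eventually_all]
        intro j
        by_cases hj : F j (γ s) = f (γ s)
        · simp [hj]
        have hFγ : ContinuousOn (fun s => F j (γ s)) (Icc 0 1) :=
          (hF j).continuousOn.comp hγc.continuousOn fun s hs => (hball (hγ s hs)).1
        have hs' : s ∈ Icc (0 : ℝ) 1 := ⟨hs.1, hs.2.le⟩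
        have ht : Tendsto (fun u => F j (γ u) - f (γ u)) (𝓝[>] s) (𝓝 (F j (γ s) - f (γ s))) := by
          have := ((hFγ.sub hfγ) s hs').mono hsub
          exact this.tendsto.mono_left (le_of_eq (nhdsWithin_Ioc_eq_nhdsGT hs.2).symm)
        filter_upwards [ht.eventually_ne (sub_ne_zero.2 hj)] with u hu _ h
        exact hu (sub_eq_zero.2 h.symm)
      filter_upwards [h1, h2] with u hu hu2
      obtain ⟨j, hj⟩ := hfF (γ u) (hball (hγ u (hsub hu))).1
      have hjs : F j (γ s) = f (γ s) := by
        by_contra h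
        exact hu2 j h hj
      have hpos : 0 < u - s := sub_pos.2 hu.1
      rw [slope_def_field, div_lt_iff₀ hpos]
      calc ‖f (γ u) - f y‖ - ‖f (γ s) - f y‖ ≤ ‖f (γ u) - f (γ s)‖ := by
            simpa using norm_sub_norm_le (f (γ u) - f y) (f (γ s) - f y)
        _ ≤ L * ‖γ u - γ s‖ := by
            rw [hj, ← hjs]
            exact hFL j _ (hγ u (hsub hu)) _ (hγ s ⟨hs.1, hs.2.le⟩)
        _ = L * ‖z - y‖ * (u - s) := by
            rw [hγd, norm_smul, Real.norm_of_nonneg hpos.le]; ring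
        _ < ρ * (u - s) := by gcongr)
  simpa [γ] using key (right_mem_Icc.2 zero_le_one)

/-- Change of variables inequality for a map with a Lipschitz left inverse. -/
theorem setLIntegral_comp_le_of_lipschitzOnWith_leftInverse {X Y : Type*}
    [MetricSpace X] [MeasurableSpace X] [BorelSpace X] [SecondCountableTopology X]
    [MetricSpace Y] [MeasurableSpace Y] [BorelSpace Y] [SecondCountableTopology Y]
    {d : ℕ} {ψ : X → Y} {κ : Y → X} {D : Set X} {T : Set Y} {K : ℝ≥0}
    (hD : MeasurableSet D) (hψ : ContinuousOn ψ D) (hT : MapsTo ψ D T)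
    (hκ : LipschitzOnWith K κ (ψ '' D)) (hleft : ∀ x ∈ D, κ (ψ x) = x)
    {F : Y → ℝ≥0∞} (hF : AEMeasurable F ((μHE[d] : Measure Y).restrict T)) :
    ∫⁻ x in D, F (ψ x) ∂(μHE[d] : Measure X)
      ≤ (K : ℝ≥0∞) ^ d * ∫⁻ y in T, F y ∂(μHE[d] : Measure Y) := by
  have hψm : AEMeasurable ψ ((μHE[d] : Measure X).restrict D) := hψ.aemeasurable hD
  have hμ : ∀ s : Set Y, LipschitzOnWith K κ s →
      (μHE[d] : Measure X) (κ '' s) ≤ (K : ℝ≥0∞) ^ d * (μHE[d] : Measure Y) s := by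
    intro s hs
    have := hs.hausdorffMeasure_image_le (d := d) (Nat.cast_nonneg d)
    rw [Measure.euclideanHausdorffMeasure_def, Measure.euclideanHausdorffMeasure_def,
      Measure.smul_apply, Measure.smul_apply, ENNReal.smul_def, ENNReal.smul_def, smul_eq_mul,
      smul_eq_mul, mul_left_comm]
    gcongr
    simpa using this
  -- The left inverse `κ` carries `S ∩ ψ(D)` onto the part of `D` that `ψ` sends to `S`, and a
  -- `K`-Lipschitz map enlarges `d`-dimensional Hausdorff measure by at most `K ^ d`.
  have hle : ((μHE[d] : Measure X).restrict D).map ψ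
      ≤ ((K : ℝ≥0∞) ^ d) • (μHE[d] : Measure Y).restrict T := by
    refine Measure.le_iff.2 fun S hS => ?_
    rw [Measure.map_apply_of_aemeasurable hψm hS, Measure.restrict_apply' hD,
      Measure.smul_apply, Measure.restrict_apply hS, smul_eq_mul]
    calc (μHE[d] : Measure X) (ψ ⁻¹' S ∩ D)
        ≤ (μHE[d] : Measure X) (κ '' (S ∩ ψ '' D)) := by
          refine measure_mono fun x hx => ⟨ψ x, ⟨hx.1, mem_image_of_mem ψ hx.2⟩, hleft x hx.2⟩
      _ ≤ (K : ℝ≥0∞) ^ d * (μHE[d] : Measure Y) (S ∩ ψ '' D) :=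
          hμ _ (hκ.mono inter_subset_right)
      _ ≤ _ := by
          gcongr
          exact hT.image_subset
  have hFm : AEMeasurable F (((K : ℝ≥0∞) ^ d) • (μHE[d] : Measure Y).restrict T) :=
    hF.smul_measure _
  rw [← lintegral_map' (hFm.mono_measure hle) hψm]
  exact (lintegral_mono' hle le_rfl).trans_eq (lintegral_smul_measure _ _)

/-! ### `C¹` functions along Lipschitz curves -/

/-- A `C¹` function along a Lipschitz curve is controlled by its initial value and its gradient. -/
theorem norm_comp_le_add_integral {E : Type*} [NormedAddCommGroup E] [NormedSpace ℝ E]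
    {f : E → ℝ} (hf : ContDiff ℝ 1 f) {γ : ℝ → E} {L : ℝ≥0} (hγ : LipschitzWith L γ)
    {t : ℝ} (ht : 0 ≤ t) :
    ‖f (γ t)‖ ≤ ‖f (γ 0)‖ + ∫ σ in (0 : ℝ)..t, L * ‖fderiv ℝ f (γ σ)‖ := by
  have hg : Continuous fun σ => (L : ℝ) * ‖fderiv ℝ f (γ σ)‖ :=
    continuous_const.mul (((hf.continuous_fderiv one_ne_zero).comp hγ.continuous).norm)
  -- The curve need not be differentiable, so the right slopes of `‖f ∘ γ‖` are compared with the
  -- integrand instead of applying the fundamental theorem of calculus.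
  refine image_le_of_liminf_slope_right_le_deriv_boundary (a := 0) (b := t)
    (f := fun s => ‖f (γ s)‖)
    (B := fun s => ‖f (γ 0)‖ + ∫ σ in (0 : ℝ)..s, L * ‖fderiv ℝ f (γ σ)‖)
    (B' := fun s => L * ‖fderiv ℝ f (γ s)‖)
    ((hf.continuous.comp hγ.continuous).norm.continuousOn) (by simp) ?_ ?_ ?_
    (right_mem_Icc.2 ht)
  · exact (continuous_const.add
      (intervalIntegral.continuous_primitive (fun a b => hg.intervalIntegrable a b) 0)).continuousOn
  · intro s _
    exact ((hg.integral_hasStrictDerivAt 0 s).hasDerivAt.const_add _).hasDerivWithinAt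
  · intro s _ r hr
    apply Filter.Eventually.frequently
    obtain ⟨c, hc, hcr⟩ : ∃ c : ℝ≥0, ‖fderiv ℝ f (γ s)‖₊ < c ∧ L * c < r := by
      have : Tendsto (fun c : ℝ => (L : ℝ) * c) (𝓝[>] ‖fderiv ℝ f (γ s)‖)
          (𝓝 (L * ‖fderiv ℝ f (γ s)‖)) :=
        ((continuous_const.mul continuous_id).tendsto _).mono_left nhdsWithin_le_nhds
      obtain ⟨c, hc1, hc2⟩ := ((this.eventually_lt_const hr).and self_mem_nhdsWithin).exists
      exact ⟨⟨c, (norm_nonneg _).trans (le_of_lt hc2)⟩, hc2, hc1⟩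
    obtain ⟨U, hU, hLip⟩ :=
      (hf.contDiffAt (x := γ s)).exists_lipschitzOnWith_of_nnnorm_lt c hc
    have h1 : ∀ᶠ u in 𝓝[>] s, γ u ∈ U :=
      (hγ.continuous.continuousAt.eventually hU).filter_mono nhdsWithin_le_nhds
    filter_upwards [h1, self_mem_nhdsWithin] with u hu hsu
    have hpos : 0 < u - s := sub_pos.2 hsu
    rw [slope_def_field, div_lt_iff₀ hpos]
    calc ‖f (γ u)‖ - ‖f (γ s)‖ ≤ ‖f (γ u) - f (γ s)‖ := norm_sub_norm_le _ _
      _ ≤ c * ‖γ u - γ s‖ := hLip.norm_sub_le hu (mem_of_mem_nhds hU)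
      _ ≤ c * (L * ‖u - s‖) := by gcongr; exact hγ.norm_sub_le _ _
      _ = (L * c) * (u - s) := by rw [Real.norm_of_nonneg hpos.le]; ring
      _ < r * (u - s) := by gcongr

/-- Cauchy–Schwarz, obtained by expanding the nonnegative variance of `g` about its mean `I / t`. -/
theorem sq_intervalIntegral_le {g : ℝ → ℝ} (hg : Continuous g) {t : ℝ} (ht : 0 ≤ t) :
    (∫ σ in (0 : ℝ)..t, g σ) ^ 2 ≤ t * ∫ σ in (0 : ℝ)..t, g σ ^ 2 := by
  rcases ht.eq_or_lt with rfl | ht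
  · simp
  set I := ∫ σ in (0 : ℝ)..t, g σ
  have h0 : 0 ≤ ∫ σ in (0 : ℝ)..t, (g σ - I / t) ^ 2 :=
    intervalIntegral.integral_nonneg ht.le fun _ _ => sq_nonneg _
  have h1 : ∫ σ in (0 : ℝ)..t, (g σ - I / t) ^ 2
      = (∫ σ in (0 : ℝ)..t, g σ ^ 2) - 2 * (I / t) * I + t * (I / t) ^ 2 := by
    have : ∀ σ, (g σ - I / t) ^ 2 = g σ ^ 2 - 2 * (I / t) * g σ + (I / t) ^ 2 := fun σ => by ring
    simp_rw [this]
    rw [intervalIntegral.integral_add, intervalIntegral.integral_sub,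
      intervalIntegral.integral_const_mul, intervalIntegral.integral_const]
    · simp [I]
    all_goals exact Continuous.intervalIntegrable (by fun_prop) _ _
  rw [h1] at h0
  have h2 := mul_nonneg ht.le h0
  have h3 : t * ((∫ σ in (0 : ℝ)..t, g σ ^ 2) - 2 * (I / t) * I + t * (I / t) ^ 2)
      = t * (∫ σ in (0 : ℝ)..t, g σ ^ 2) - I ^ 2 := by field_simp; ring
  linarith

/-- The linear bound is squared and Cauchy–Schwarz applied. Enlarging the integral from `[0, t]` to
`(0, s)` makes the right side independent of `t`, so integrating in `t` only costs a factor `s`. -/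
theorem enorm_comp_sq_le_add_lintegral {E : Type*} [NormedAddCommGroup E] [NormedSpace ℝ E]
    {f : E → ℝ} (hf : ContDiff ℝ 1 f) {γ : ℝ → E} {L : ℝ≥0} {s : ℝ} (hs : 0 ≤ s)
    (hγ : LipschitzOnWith L γ (Icc 0 s)) {t : ℝ} (ht : t ∈ Icc 0 s) :
    ‖f (γ t)‖ₑ ^ 2 ≤ 2 * ‖f (γ 0)‖ₑ ^ 2
      + 2 * (L : ℝ≥0∞) ^ 2 * ENNReal.ofReal s * ∫⁻ σ in Ioo 0 s, ‖fderiv ℝ f (γ σ)‖ₑ ^ 2 := by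
  -- Keeping the curve constant beyond both ends extends it to a Lipschitz curve on `ℝ` with the
  -- same constant.
  set η : ℝ → E := fun σ => γ (projIcc 0 s hs σ) with hη
  have hηL : LipschitzWith L η := by
    have := hγ.to_restrict.comp (LipschitzWith.projIcc hs)
    rwa [mul_one] at this
  have hηγ : ∀ σ ∈ Icc 0 s, η σ = γ σ := fun σ hσ => by
    simp only [hη, projIcc_of_mem hs hσ]
  have hc : Continuous fun σ => ‖fderiv ℝ f (η σ)‖ :=
    ((hf.continuous_fderiv one_ne_zero).comp hηL.continuous).norm
  have h1 := norm_comp_le_add_integral hf hηL ht.1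
  rw [hηγ t ht, hηγ 0 ⟨le_rfl, hs⟩, intervalIntegral.integral_const_mul] at h1
  have h2 := sq_intervalIntegral_le hc ht.1
  set I := ∫ σ in (0 : ℝ)..t, ‖fderiv ℝ f (η σ)‖
  have h3 : ‖f (γ t)‖ ^ 2 ≤ 2 * ‖f (γ 0)‖ ^ 2
      + 2 * L ^ 2 * s * ∫ σ in (0 : ℝ)..t, ‖fderiv ℝ f (η σ)‖ ^ 2 := by
    have h4 : ‖f (γ t)‖ ^ 2 ≤ (‖f (γ 0)‖ + L * I) ^ 2 := by gcongr
    have h5 : (‖f (γ 0)‖ + L * I) ^ 2 ≤ 2 * ‖f (γ 0)‖ ^ 2 + 2 * L ^ 2 * I ^ 2 := by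
      nlinarith [sq_nonneg (‖f (γ 0)‖ - L * I)]
    have h6 : I ^ 2 ≤ s * ∫ σ in (0 : ℝ)..t, ‖fderiv ℝ f (η σ)‖ ^ 2 := by
      refine h2.trans (mul_le_mul_of_nonneg_right ht.2 ?_)
      exact intervalIntegral.integral_nonneg ht.1 fun _ _ => sq_nonneg _
    calc _ ≤ _ := h4.trans h5
      _ ≤ 2 * ‖f (γ 0)‖ ^ 2 + 2 * L ^ 2 * (s * ∫ σ in (0 : ℝ)..t, ‖fderiv ℝ f (η σ)‖ ^ 2) := by
          gcongr
      _ = _ := by ring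
  have h7 : ENNReal.ofReal (∫ σ in (0 : ℝ)..t, ‖fderiv ℝ f (η σ)‖ ^ 2)
      ≤ ∫⁻ σ in Ioo 0 s, ‖fderiv ℝ f (γ σ)‖ₑ ^ 2 := by
    rw [intervalIntegral.integral_of_le ht.1, integral_Ioc_eq_integral_Ioo,
      ofReal_integral_eq_lintegral_ofReal]
    · calc ∫⁻ σ in Ioo 0 t, ENNReal.ofReal (‖fderiv ℝ f (η σ)‖ ^ 2)
          = ∫⁻ σ in Ioo 0 t, ‖fderiv ℝ f (γ σ)‖ₑ ^ 2 := by
            refine setLIntegral_congr_fun measurableSet_Ioo fun σ hσ => ?_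
            rw [ENNReal.ofReal_pow (norm_nonneg _), ofReal_norm,
              hηγ σ ⟨hσ.1.le, hσ.2.le.trans ht.2⟩]
        _ ≤ _ := lintegral_mono_set (Ioo_subset_Ioo_right ht.2)
    · exact ((hc.pow 2).integrableOn_Icc (a := 0) (b := t)).mono_set Ioo_subset_Icc_self
    · exact Eventually.of_forall fun _ => sq_nonneg _
  have h8 := ENNReal.ofReal_le_ofReal h3
  have hI0 : 0 ≤ ∫ σ in (0 : ℝ)..t, ‖fderiv ℝ f (η σ)‖ ^ 2 :=
    intervalIntegral.integral_nonneg ht.1 fun _ _ => sq_nonneg _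
  rw [ENNReal.ofReal_add (by positivity) (by positivity), ENNReal.ofReal_mul (by positivity),
    ENNReal.ofReal_mul (by positivity), ENNReal.ofReal_mul (by positivity),
    ENNReal.ofReal_mul (by positivity), ENNReal.ofReal_pow (norm_nonneg _),
    ENNReal.ofReal_pow (norm_nonneg _), ENNReal.ofReal_pow (NNReal.coe_nonneg _),
    ofReal_norm, ofReal_norm, ENNReal.ofReal_coe_nnreal, ENNReal.ofReal_ofNat] at h8
  exact h8.trans (by gcongr)

/-! ### Splitting off one coordinate -/

/-- The point of `ℝᵐ⁺¹` with `i`-th coordinate `p.1` and remaining coordinates `p.2`. -/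
def insertCoord {m : ℕ} (i : Fin (m + 1)) (p : ℝ × EuclideanSpace ℝ (Fin m)) :
    EuclideanSpace ℝ (Fin (m + 1)) :=
  WithLp.toLp 2 (i.insertNth p.1 p.2.ofLp)

/-- Forget the `i`-th coordinate. -/
def removeCoord {m : ℕ} (i : Fin (m + 1)) (z : EuclideanSpace ℝ (Fin (m + 1))) :
    EuclideanSpace ℝ (Fin m) :=
  WithLp.toLp 2 (i.removeNth z.ofLp)

section Coordinates

variable {m : ℕ} (i : Fin (m + 1))

@[simp] theorem insertCoord_apply_same (p : ℝ × EuclideanSpace ℝ (Fin m)) :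
    insertCoord i p i = p.1 := by
  simp [insertCoord]

@[simp] theorem removeCoord_insertCoord (p : ℝ × EuclideanSpace ℝ (Fin m)) :
    removeCoord i (insertCoord i p) = p.2 := by
  simp [insertCoord, removeCoord]

theorem insertCoord_removeCoord (z : EuclideanSpace ℝ (Fin (m + 1))) :
    insertCoord i (z i, removeCoord i z) = z := by
  simp [insertCoord, removeCoord]

theorem insertCoord_sub (p q : ℝ × EuclideanSpace ℝ (Fin m)) :
    insertCoord i p - insertCoord i q = insertCoord i (p - q) := by
  ext j
  refine Fin.succAboveCases i ?_ (fun j => ?_) j <;> simp [insertCoord]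

theorem removeCoord_sub (z w : EuclideanSpace ℝ (Fin (m + 1))) :
    removeCoord i z - removeCoord i w = removeCoord i (z - w) := by
  ext j
  simp [removeCoord, Fin.removeNth]

theorem norm_insertCoord_sq (p : ℝ × EuclideanSpace ℝ (Fin m)) :
    ‖insertCoord i p‖ ^ 2 = ‖p.1‖ ^ 2 + ‖p.2‖ ^ 2 := by
  rw [EuclideanSpace.norm_sq_eq, EuclideanSpace.norm_sq_eq, Fin.sum_univ_succAbove _ i]
  simp [insertCoord]

theorem norm_insertCoord_le (p : ℝ × EuclideanSpace ℝ (Fin m)) :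
    ‖insertCoord i p‖ ≤ ‖p.1‖ + ‖p.2‖ := by
  refine abs_le_of_sq_le_sq' ?_ (by positivity) |>.2
  rw [norm_insertCoord_sq]
  nlinarith [norm_nonneg p.1, norm_nonneg p.2, mul_nonneg (norm_nonneg p.1) (norm_nonneg p.2)]

theorem norm_removeCoord_le (z : EuclideanSpace ℝ (Fin (m + 1))) :
    ‖removeCoord i z‖ ≤ ‖z‖ := by
  refine abs_le_of_sq_le_sq' ?_ (by positivity) |>.2
  conv_rhs => rw [← insertCoord_removeCoord i z, norm_insertCoord_sq]
  nlinarith [sq_nonneg ‖z i‖]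

theorem norm_insertCoord_fst (t : ℝ) :
    ‖insertCoord i (t, (0 : EuclideanSpace ℝ (Fin m)))‖ = ‖t‖ := by
  have h := norm_insertCoord_sq i (t, (0 : EuclideanSpace ℝ (Fin m)))
  simp only [norm_zero, ne_eq, OfNat.ofNat_ne_zero, not_false_eq_true, zero_pow, add_zero] at h
  exact (pow_left_inj₀ (norm_nonneg _) (norm_nonneg _) two_ne_zero).1 h

theorem norm_insertCoord_snd (y : EuclideanSpace ℝ (Fin m)) :
    ‖insertCoord i (0, y)‖ = ‖y‖ := by
  have h := norm_insertCoord_sq i (0, y)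
  simp only [norm_zero, ne_eq, OfNat.ofNat_ne_zero, not_false_eq_true, zero_pow, zero_add] at h
  exact (pow_left_inj₀ (norm_nonneg _) (norm_nonneg _) two_ne_zero).1 h

theorem lipschitzWith_removeCoord : LipschitzWith 1 (removeCoord (m := m) i) := by
  refine LipschitzWith.of_dist_le_mul fun z w => ?_
  rw [dist_eq_norm, dist_eq_norm, removeCoord_sub, NNReal.coe_one, one_mul]
  exact norm_removeCoord_le i _

theorem continuous_insertCoord : Continuous (insertCoord (m := m) i) := by
  unfold insertCoord
  refine (PiLp.continuous_toLp 2 _).comp (continuous_pi fun j => ?_)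
  refine Fin.succAboveCases i ?_ (fun j => ?_) j
  · simpa using continuous_fst
  · simp only [Fin.insertNth_apply_succAbove]
    fun_prop

theorem measurePreserving_insertCoord :
    MeasurePreserving (insertCoord (m := m) i) (volume.prod volume) volume := by
  have h1 : MeasurePreserving (Prod.map id WithLp.ofLp :
      ℝ × EuclideanSpace ℝ (Fin m) → ℝ × (Fin m → ℝ)) (volume.prod volume)
      (volume.prod volume) :=
    (MeasurePreserving.id volume).prod (PiLp.volume_preserving_ofLp (Fin m))
  have h2 := (volume_preserving_piFinSuccAbove (fun _ : Fin (m + 1) => ℝ) i).symm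
  have h3 := PiLp.volume_preserving_toLp (Fin (m + 1))
  exact h3.comp (h2.comp h1)

theorem measurableEmbedding_insertCoord : MeasurableEmbedding (insertCoord (m := m) i) := by
  refine (continuous_insertCoord i).measurableEmbedding fun p q h => ?_
  have h1 := congrArg (fun z => z i) h
  have h2 := congrArg (removeCoord i) h
  simp only [insertCoord_apply_same, removeCoord_insertCoord] at h1 h2
  exact Prod.ext h1 h2

theorem setLIntegral_cylinder {B : Set (EuclideanSpace ℝ (Fin m))}
    {s : ℝ} {F : EuclideanSpace ℝ (Fin (m + 1)) → ℝ≥0∞}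
    (hF : AEMeasurable F (volume.restrict {z | z i ∈ Ioo 0 s ∧ removeCoord i z ∈ B})) :
    ∫⁻ z in {z | z i ∈ Ioo 0 s ∧ removeCoord i z ∈ B}, F z
      = ∫⁻ y in B, ∫⁻ t in Ioo 0 s, F (insertCoord i (t, y)) := by
  have hpre : insertCoord i ⁻¹' {z | z i ∈ Ioo 0 s ∧ removeCoord i z ∈ B}
      = Ioo (0 : ℝ) s ×ˢ B := by
    ext p
    simp [mem_prod]
  have hmp := (measurePreserving_insertCoord i).restrict_preimage_emb
    (measurableEmbedding_insertCoord i) {z | z i ∈ Ioo 0 s ∧ removeCoord i z ∈ B}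
  rw [hpre] at hmp
  rw [← hmp.lintegral_comp_emb (measurableEmbedding_insertCoord i), ← Measure.prod_restrict]
  rw [← Measure.prod_restrict] at hmp
  exact lintegral_prod_symm _ (hF.comp_quasiMeasurePreserving hmp.quasiMeasurePreserving)

end Coordinates

/-! ### The `L²` estimate on boundary strips -/

/-- Points of `Ω` at distance less than `ε` from the complement. -/
def boundaryStrip {n : ℕ} (Ω : Set (EuclideanSpace ℝ (Fin n))) (ε : ℝ) :
    Set (EuclideanSpace ℝ (Fin n)) :=
  Ω ∩ {y | Metric.infDist y Ωᶜ < ε}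

theorem measurableSet_boundaryStrip {n : ℕ} {Ω : Set (EuclideanSpace ℝ (Fin n))}
    (hΩ : IsOpen Ω) (ε : ℝ) : MeasurableSet (boundaryStrip Ω ε) :=
  hΩ.measurableSet.inter
    (isOpen_lt (Metric.continuous_infDist_pt _) continuous_const).measurableSet

/-- The estimate in a straightened cylinder, where `ψ` parametrizes `Ω` near a boundary point and `κ`
is its inverse. -/
theorem setLIntegral_cylinder_sq_le {m : ℕ} (i : Fin (m + 1))
    {ψ κ : EuclideanSpace ℝ (Fin (m + 1)) → EuclideanSpace ℝ (Fin (m + 1))}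
    {B : Set (EuclideanSpace ℝ (Fin m))} (hB : MeasurableSet B) {s : ℝ} (hs : 0 < s) {L : ℝ≥0}
    (hψ : LipschitzOnWith L ψ {z | z i ∈ Icc 0 s ∧ removeCoord i z ∈ B})
    (hκ : LipschitzOnWith L κ (ψ '' {z | z i ∈ Icc 0 s ∧ removeCoord i z ∈ B}))
    (hκψ : ∀ z, z i ∈ Icc 0 s ∧ removeCoord i z ∈ B → κ (ψ z) = z)
    {T S : Set (EuclideanSpace ℝ (Fin (m + 1)))}
    (hT : MapsTo ψ {z | z i ∈ Ioo 0 s ∧ removeCoord i z ∈ B} T)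
    (hS : MapsTo ψ {z | z i = 0 ∧ removeCoord i z ∈ B} S)
    {f : EuclideanSpace ℝ (Fin (m + 1)) → ℝ} (hf : ContDiff ℝ 1 f) :
    ∫⁻ z in {z | z i ∈ Ioo 0 s ∧ removeCoord i z ∈ B}, ‖f (ψ z)‖ₑ ^ 2
      ≤ ENNReal.ofReal s * (2 * ((L : ℝ≥0∞) ^ m *
          ∫⁻ y in S, ‖f y‖ₑ ^ 2 ∂(μHE[m] : Measure (EuclideanSpace ℝ (Fin (m + 1))))))
        + ENNReal.ofReal s * (2 * (L : ℝ≥0∞) ^ 2 * ENNReal.ofReal s * ((L : ℝ≥0∞) ^ (m + 1) *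
          ∫⁻ y in T, ‖fderiv ℝ f y‖ₑ ^ 2)) := by
  have hcl : {z : EuclideanSpace ℝ (Fin (m + 1)) | z i ∈ Ioo 0 s ∧ removeCoord i z ∈ B}
      ⊆ {z | z i ∈ Icc 0 s ∧ removeCoord i z ∈ B} := fun z hz => ⟨Ioo_subset_Icc_self hz.1, hz.2⟩
  have hcoord : Measurable fun z : EuclideanSpace ℝ (Fin (m + 1)) => z i :=
    (by fun_prop : Continuous fun z : EuclideanSpace ℝ (Fin (m + 1)) => z i).measurable
  have hCm : MeasurableSet {z : EuclideanSpace ℝ (Fin (m + 1)) |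
      z i ∈ Ioo 0 s ∧ removeCoord i z ∈ B} :=
    (hcoord measurableSet_Ioo).inter ((lipschitzWith_removeCoord i).continuous.measurable hB)
  have hfc : Continuous fun y => ‖f y‖ₑ ^ 2 := (ENNReal.continuous_pow 2).comp hf.continuous.enorm
  have hgc : Continuous fun y => ‖fderiv ℝ f y‖ₑ ^ 2 :=
    (ENNReal.continuous_pow 2).comp (hf.continuous_fderiv one_ne_zero).enorm
  have hψC : ContinuousOn ψ {z | z i ∈ Ioo 0 s ∧ removeCoord i z ∈ B} :=
    hψ.continuousOn.mono hcl
  have hgm : AEMeasurable (fun z => ‖fderiv ℝ f (ψ z)‖ₑ ^ 2)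
      (volume.restrict {z | z i ∈ Ioo 0 s ∧ removeCoord i z ∈ B}) :=
    (hgc.comp_continuousOn hψC).aemeasurable hCm
  have hline : ∀ y ∈ B, LipschitzOnWith L (fun t => ψ (insertCoord i (t, y))) (Icc 0 s) := by
    intro y hy
    refine LipschitzOnWith.of_dist_le_mul fun t ht u hu => ?_
    refine (hψ.dist_le_mul _ (by simpa using ⟨ht, hy⟩) _ (by simpa using ⟨hu, hy⟩)).trans ?_
    rw [dist_eq_norm (insertCoord i _), insertCoord_sub, Prod.mk_sub_mk, sub_self,
      norm_insertCoord_fst, dist_eq_norm]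
  have hbase : ContinuousOn (fun y => ψ (insertCoord i (0, y))) B :=
    hψ.continuousOn.comp ((continuous_insertCoord i).comp (by fun_prop)).continuousOn
      fun y hy => by simpa using ⟨hs.le, hy⟩
  have hbm : AEMeasurable (fun y => ‖f (ψ (insertCoord i (0, y)))‖ₑ ^ 2) (volume.restrict B) :=
    (hfc.comp_continuousOn hbase).aemeasurable hB
  -- The base of the cylinder parametrizes a piece of `S`. Its left inverse `removeCoord i ∘ κ` is
  -- Lipschitz, so the change of variables applies in dimension `m`, one less than that of the
  -- space.
  have hbdry : ∫⁻ y in B, ‖f (ψ (insertCoord i (0, y)))‖ₑ ^ 2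
      ≤ (L : ℝ≥0∞) ^ m *
        ∫⁻ y in S, ‖f y‖ₑ ^ 2 ∂(μHE[m] : Measure (EuclideanSpace ℝ (Fin (m + 1)))) := by
    rw [← EuclideanSpace.euclideanHausdorffMeasure_eq_volume m]
    refine setLIntegral_comp_le_of_lipschitzOnWith_leftInverse (d := m)
      (ψ := fun y => ψ (insertCoord i (0, y))) (κ := fun z => removeCoord i (κ z)) (T := S)
      (F := fun y => ‖f y‖ₑ ^ 2) hB hbase ?_ ?_ ?_ hfc.aemeasurable
    · intro y hy
      exact hS (by simpa using hy)
    · have h := (lipschitzWith_removeCoord i).comp_lipschitzOnWith hκ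
      rw [one_mul] at h
      refine h.mono ?_
      rintro _ ⟨y, hy, rfl⟩
      exact mem_image_of_mem ψ (by simpa using ⟨hs.le, hy⟩)
    · intro y hy
      rw [hκψ _ (by simpa using ⟨hs.le, hy⟩), removeCoord_insertCoord]
  have hvol : ∫⁻ z in {z | z i ∈ Ioo 0 s ∧ removeCoord i z ∈ B}, ‖fderiv ℝ f (ψ z)‖ₑ ^ 2
      ≤ (L : ℝ≥0∞) ^ (m + 1) * ∫⁻ y in T, ‖fderiv ℝ f y‖ₑ ^ 2 := by
    rw [← EuclideanSpace.euclideanHausdorffMeasure_eq_volume (m + 1)]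
    exact setLIntegral_comp_le_of_lipschitzOnWith_leftInverse (d := m + 1)
      (F := fun y => ‖fderiv ℝ f y‖ₑ ^ 2) hCm hψC hT (hκ.mono (image_mono hcl))
      (fun z hz => hκψ z (hcl hz)) hgc.aemeasurable
  rw [setLIntegral_cylinder i hgm] at hvol
  have hfm : AEMeasurable (fun z => ‖f (ψ z)‖ₑ ^ 2)
      (volume.restrict {z | z i ∈ Ioo 0 s ∧ removeCoord i z ∈ B}) :=
    (hfc.comp_continuousOn hψC).aemeasurable hCm
  rw [setLIntegral_cylinder i hfm]
  have hpt : ∀ y ∈ B, ∫⁻ t in Ioo 0 s, ‖f (ψ (insertCoord i (t, y)))‖ₑ ^ 2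
      ≤ ENNReal.ofReal s * (2 * ‖f (ψ (insertCoord i (0, y)))‖ₑ ^ 2)
        + ENNReal.ofReal s * (2 * (L : ℝ≥0∞) ^ 2 * ENNReal.ofReal s *
          ∫⁻ t in Ioo 0 s, ‖fderiv ℝ f (ψ (insertCoord i (t, y)))‖ₑ ^ 2) := by
    intro y hy
    calc _ ≤ ∫⁻ _ in Ioo 0 s, (2 * ‖f (ψ (insertCoord i (0, y)))‖ₑ ^ 2
          + 2 * (L : ℝ≥0∞) ^ 2 * ENNReal.ofReal s *
          ∫⁻ t in Ioo 0 s, ‖fderiv ℝ f (ψ (insertCoord i (t, y)))‖ₑ ^ 2) :=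
          setLIntegral_mono measurable_const fun t ht =>
            enorm_comp_sq_le_add_lintegral hf hs.le (hline y hy) (Ioo_subset_Icc_self ht)
      _ = _ := by
          rw [setLIntegral_const, Real.volume_Ioo, sub_zero, mul_comm, mul_add]
  calc _ ≤ ∫⁻ y in B, (ENNReal.ofReal s * (2 * ‖f (ψ (insertCoord i (0, y)))‖ₑ ^ 2)
        + ENNReal.ofReal s * (2 * (L : ℝ≥0∞) ^ 2 * ENNReal.ofReal s *
          ∫⁻ t in Ioo 0 s, ‖fderiv ℝ f (ψ (insertCoord i (t, y)))‖ₑ ^ 2)) :=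
        lintegral_mono_ae ((ae_restrict_iff' hB).2 (Eventually.of_forall hpt))
    _ = ENNReal.ofReal s * (2 * ∫⁻ y in B, ‖f (ψ (insertCoord i (0, y)))‖ₑ ^ 2)
        + ENNReal.ofReal s * (2 * (L : ℝ≥0∞) ^ 2 * ENNReal.ofReal s *
          ∫⁻ y in B, ∫⁻ t in Ioo 0 s, ‖fderiv ℝ f (ψ (insertCoord i (t, y)))‖ₑ ^ 2) := by
        rw [lintegral_add_left' ((hbm.const_mul _).const_mul _),
          lintegral_const_mul' _ _ ENNReal.ofReal_ne_top, lintegral_const_mul' _ _ (by simp),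
          lintegral_const_mul' _ _ ENNReal.ofReal_ne_top, lintegral_const_mul']
        exact ENNReal.mul_ne_top (by finiteness) ENNReal.ofReal_ne_top
    _ ≤ _ := by gcongr

/-- A bi-Lipschitz version of the boundary chart. -/
theorem HasPiecewiseC1Boundary.exists_biLipschitz_chart {n : ℕ}
    {Ω : Set (EuclideanSpace ℝ (Fin n))} (hb : HasPiecewiseC1Boundary Ω) (hΩ : IsOpen Ω)
    {x : EuclideanSpace ℝ (Fin n)} (hx : x ∈ frontier Ω) :
    ∃ (e : OpenPartialHomeomorph (EuclideanSpace ℝ (Fin n)) (EuclideanSpace ℝ (Fin n)))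
      (i : Fin n) (L : ℝ≥0) (r ρ : ℝ), 1 ≤ L ∧ 0 < r ∧ 0 < ρ ∧ e x i = 0 ∧
      Metric.ball x r ⊆ e.source ∧ Metric.ball (e x) ρ ⊆ e.target ∧
      MapsTo e.symm (Metric.ball (e x) ρ) (Metric.ball x r) ∧
      LipschitzOnWith L e (Metric.ball x r) ∧ LipschitzOnWith L e.symm (Metric.ball (e x) ρ) ∧
      ∀ y ∈ e.source, (y ∈ Ω ↔ 0 < e y i) := by
  obtain ⟨e, i, hxe, he, hes, hside⟩ := hb x hx
  obtain ⟨L₁, r, hr, hrs, hL₁⟩ := he.exists_lipschitzOnWith e.open_source hxe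
  obtain ⟨L₂, ρ, hρ, hρt, hL₂⟩ := hes.exists_lipschitzOnWith e.open_target (e.map_source hxe)
  have hmaps : ∀ᶠ z in 𝓝 (e x), e.symm z ∈ Metric.ball x r :=
    (e.tendsto_symm hxe).eventually (Metric.ball_mem_nhds x hr)
  obtain ⟨ρ', hρ', hball⟩ := Metric.mem_nhds_iff.1
    (Filter.inter_mem hmaps (Metric.ball_mem_nhds (e x) hρ))
  have hcoord : Continuous fun z : EuclideanSpace ℝ (Fin n) => z i := by fun_prop
  -- A frontier point lies on the hyperplane: it is not in the open set `Ω`, but it is a limit of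
  -- points of `Ω`.
  have hle : e x i ≤ 0 := by
    by_contra! h
    have : x ∈ Ω := (hside x hxe).2 h
    exact (hΩ.frontier_eq ▸ hx).2 this
  have hge : 0 ≤ e x i := by
    have hc : x ∈ closure Ω := frontier_subset_closure hx
    have : ∃ᶠ y in 𝓝 x, 0 < e y i := by
      refine (mem_closure_iff_frequently.1 hc).mp ?_
      filter_upwards [e.open_source.mem_nhds hxe] with y hy hyΩ
      exact (hside y hy).1 hyΩ
    by_contra! h
    have h2 : ∀ᶠ y in 𝓝 x, e y i < 0 :=
      ((hcoord.continuousAt.comp (e.continuousAt hxe)).tendsto).eventually_lt_const h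
    obtain ⟨y, h3, h4⟩ := (this.and_eventually h2).exists
    exact lt_asymm h3 h4
  refine ⟨e, i, max 1 (max L₁ L₂), r, ρ', le_max_left _ _, hr, hρ', le_antisymm hle hge, hrs,
    fun z hz => hρt (hball hz).2, fun z hz => (hball hz).1, ?_, ?_, hside⟩
  · exact hL₁.weaken ((le_max_left _ _).trans (le_max_right _ _))
  · exact (hL₂.weaken ((le_max_right _ _).trans (le_max_right _ _))).mono fun z hz => (hball hz).2

/-- The chart sends the strip of width `ε` into a cylinder of height `L * ε`, since a complement
point within `ε` has nonpositive `i`-th chart coordinate. The inverse chart sends this cylinder back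
into a strip of width at most a constant times `ε`. Between these two inclusions the cylinder
estimate applies. -/
theorem exists_local_strip_estimate {m : ℕ} {Ω : Set (EuclideanSpace ℝ (Fin (m + 1)))}
    (hΩ : IsOpen Ω) (hne : Ωᶜ.Nonempty) (hb : HasPiecewiseC1Boundary Ω)
    {x : EuclideanSpace ℝ (Fin (m + 1))} (hx : x ∈ frontier Ω) :
    ∃ r > 0, ∃ K : ℝ≥0, ∃ ε₀ > 0, ∀ ε > 0, ε < ε₀ →
      ∀ f : EuclideanSpace ℝ (Fin (m + 1)) → ℝ, ContDiff ℝ 1 f →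
        ∫⁻ y in boundaryStrip Ω ε ∩ Metric.ball x r, ‖f y‖ₑ ^ 2
          ≤ K * (ENNReal.ofReal ε * (∫⁻ y, ‖f y‖ₑ ^ 2 ∂surfaceMeasure Ω)
            + ENNReal.ofReal ε ^ 2 * ∫⁻ y in boundaryStrip Ω (K * ε), ‖fderiv ℝ f y‖ₑ ^ 2) := by
  obtain ⟨e, i, L, r, ρ, hL, hr, hρ, hx0, hrs, hρt, hmaps, hLe, hLs, hside⟩ :=
    hb.exists_biLipschitz_chart hΩ hx
  have hL' : (1 : ℝ) ≤ L := hL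
  have hL0 : (0 : ℝ) < L := by linarith
  -- With radius and width below `r / 2`, nearby complement points stay in the chart ball; with both
  -- below `ρ / (2 * L)`, the cylinder fits in the ball of radius `ρ`. The exponent `2 * m + 6`
  -- collects `m + 1` for each of two volume changes, one for each of two factors `s = L * ε`, and
  -- two for the squared slope of the lines.
  refine ⟨min (r / 2) (ρ / (2 * L)), by positivity, 2 * L ^ (2 * m + 6),
    min (r / 2) (ρ / (2 * L)), by positivity, ?_⟩
  intro ε hε hεlt f hf
  have hεr : ε < r / 2 := hεlt.trans_le (min_le_left _ _)
  have hs : 0 < L * ε := by positivity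
  have hsρ : L * ε < ρ / 2 := by
    have : ε < ρ / (2 * L) := hεlt.trans_le (min_le_right _ _)
    rw [lt_div_iff₀ (by positivity)] at this
    linarith
  set z₀ := e x with hz₀
  set B := Metric.ball (removeCoord i z₀) (ρ / 2) with hB
  set s : ℝ := L * ε with hsdef
  have hcyl : ∀ z : EuclideanSpace ℝ (Fin (m + 1)), z i ∈ Icc 0 s ∧ removeCoord i z ∈ B →
      z ∈ Metric.ball z₀ ρ := by
    rintro z ⟨hzi, hzB⟩
    rw [Metric.mem_ball, dist_eq_norm, ← insertCoord_removeCoord i (z - z₀), ← removeCoord_sub]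
    refine (norm_insertCoord_le i _).trans_lt ?_
    rw [hB, Metric.mem_ball, dist_eq_norm] at hzB
    have : ‖(z - z₀) i‖ ≤ s := by
      simp only [PiLp.sub_apply, hx0, sub_zero]
      rw [Real.norm_of_nonneg hzi.1]
      exact hzi.2
    simp only
    linarith
  have hsymm : ∀ z ∈ Metric.ball z₀ ρ, e.symm z ∈ e.source := fun z hz => hrs (hmaps hz)
  have hright : ∀ z ∈ Metric.ball z₀ ρ, e (e.symm z) = z := fun z hz => e.right_inv (hρt hz)
  have hbase : ∀ z ∈ Metric.ball z₀ ρ, insertCoord i (0, removeCoord i z) ∈ Metric.ball z₀ ρ := by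
    intro z hz
    rw [Metric.mem_ball, dist_eq_norm] at hz ⊢
    rw [← insertCoord_removeCoord i z₀, insertCoord_sub, hx0, Prod.mk_sub_mk, sub_zero,
      removeCoord_sub, norm_insertCoord_snd]
    exact (norm_removeCoord_le i _).trans_lt hz
  have hzero : ∀ z ∈ Metric.ball z₀ ρ, z i = 0 → e.symm z ∉ Ω := by
    intro z hz hzi h
    have := (hside _ (hsymm z hz)).1 h
    rw [hright z hz, hzi] at this
    exact lt_irrefl _ this
  have key := setLIntegral_cylinder_sq_le i (ψ := e.symm) (κ := e) (B := B) (L := L)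
    Metric.isOpen_ball.measurableSet hs (hLs.mono hcyl)
    (hLe.mono (by rintro _ ⟨z, hz, rfl⟩; exact hmaps (hcyl z hz)))
    (fun z hz => hright z (hcyl z hz))
    (T := boundaryStrip Ω ((2 * L ^ (2 * m + 6) : ℝ≥0) * ε)) (S := frontier Ω)
    (by
      rintro z ⟨hzi, hzB⟩
      have hz := hcyl z ⟨Ioo_subset_Icc_self hzi, hzB⟩
      refine ⟨(hside _ (hsymm z hz)).2 (by rw [hright z hz]; exact hzi.1), ?_⟩
      have h0 : insertCoord i (0, removeCoord i z) ∈ Metric.ball z₀ ρ := hbase z hz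
      have hnot := hzero _ h0 (by simp)
      refine (Metric.infDist_le_dist_of_mem hnot).trans_lt ?_
      refine (hLs.dist_le_mul z hz _ h0).trans_lt ?_
      have hd : dist z (insertCoord i (0, removeCoord i z)) = z i := by
        rw [dist_eq_norm]
        conv_lhs => rw [← insertCoord_removeCoord i z]
        rw [insertCoord_sub, removeCoord_insertCoord, Prod.mk_sub_mk, sub_self, sub_zero,
          norm_insertCoord_fst, Real.norm_of_nonneg hzi.1.le]
      rw [hd]
      have h2 : (L : ℝ) ^ 2 ≤ L ^ (2 * m + 6) := pow_le_pow_right₀ hL' (by omega)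
      have h3 : (0 : ℝ) < L ^ (2 * m + 6) := by positivity
      calc (L : ℝ) * z i < L * s := by gcongr; exact hzi.2
        _ = L ^ 2 * ε := by rw [hsdef]; ring
        _ ≤ (2 * L ^ (2 * m + 6)) * ε := by gcongr; linarith
        _ = _ := by push_cast; ring)
    (by
      rintro z ⟨hzi, hzB⟩
      have hz := hcyl z ⟨by rw [hzi]; exact ⟨le_rfl, hs.le⟩, hzB⟩
      rw [hΩ.frontier_eq]
      refine ⟨?_, hzero z hz hzi⟩
      -- Raising a base point slightly gives points whose images lie in `Ω`, so its own image lies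
      -- in the closure.
      have hcont : ContinuousAt (fun t => e.symm (insertCoord i (t, removeCoord i z))) 0 := by
        have h1 : insertCoord i (0, removeCoord i z) = z := by
          conv_rhs => rw [← insertCoord_removeCoord i z, hzi]
        refine ContinuousAt.comp (g := e.symm) ?_
          ((continuous_insertCoord i).comp (by fun_prop)).continuousAt
        rw [h1]
        exact e.continuousAt_symm (hρt hz)
      have h1 : insertCoord i (0, removeCoord i z) = z := by
        conv_rhs => rw [← insertCoord_removeCoord i z, hzi]
      have ht : Tendsto (fun t => e.symm (insertCoord i (t, removeCoord i z))) (𝓝[>] 0)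
          (𝓝 (e.symm z)) := by
        have := hcont.tendsto
        rw [h1] at this
        exact this.mono_left nhdsWithin_le_nhds
      refine mem_closure_of_tendsto ht ?_
      filter_upwards [Ioc_mem_nhdsGT hs] with t ht
      have hzt := hcyl (insertCoord i (t, removeCoord i z)) (by
        simpa using ⟨⟨ht.1.le, ht.2⟩, hzB⟩)
      refine (hside _ (hsymm _ hzt)).2 ?_
      rw [hright _ hzt]
      simpa using ht.1)
    hf
  have hfc : Continuous fun y => ‖f y‖ₑ ^ 2 := (ENNReal.continuous_pow 2).comp hf.continuous.enorm
  have hcoord : Measurable fun z : EuclideanSpace ℝ (Fin (m + 1)) => z i :=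
    (by fun_prop : Continuous fun z : EuclideanSpace ℝ (Fin (m + 1)) => z i).measurable
  have hCm : MeasurableSet {z : EuclideanSpace ℝ (Fin (m + 1)) |
      z i ∈ Ioo 0 s ∧ removeCoord i z ∈ B} :=
    (hcoord measurableSet_Ioo).inter
      ((lipschitzWith_removeCoord i).continuous.measurable Metric.isOpen_ball.measurableSet)
  set S := boundaryStrip Ω ε ∩ Metric.ball x (min (r / 2) (ρ / (2 * L)))
  have hSr : S ⊆ Metric.ball x r := fun y hy =>
    Metric.ball_subset_ball ((min_le_left _ _).trans (by linarith)) hy.2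
  have hflat : ∫⁻ y in S, ‖f y‖ₑ ^ 2 ≤ (L : ℝ≥0∞) ^ (m + 1) *
      ∫⁻ z in {z | z i ∈ Ioo 0 s ∧ removeCoord i z ∈ B}, ‖f (e.symm z)‖ₑ ^ 2 := by
    have hSm : MeasurableSet S :=
      (measurableSet_boundaryStrip hΩ ε).inter Metric.isOpen_ball.measurableSet
    have h1 : ∫⁻ y in S, ‖f y‖ₑ ^ 2 = ∫⁻ y in S, ‖f (e.symm (e y))‖ₑ ^ 2 :=
      setLIntegral_congr_fun hSm fun y hy => by
        rw [e.left_inv (hrs (hSr hy))]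
    have hmapsS : MapsTo e S {z | z i ∈ Ioo 0 s ∧ removeCoord i z ∈ B} := by
      intro y hy
      have hyΩ : 0 < e y i := (hside y (hrs (hSr hy))).1 hy.1.1
      refine ⟨⟨hyΩ, ?_⟩, ?_⟩
      · obtain ⟨q, hq, hyq⟩ := (Metric.infDist_lt_iff hne).1 hy.1.2
        have hyx : dist y x < r / 2 := (Metric.mem_ball.1 hy.2).trans_le (min_le_left _ _)
        have hqr : q ∈ Metric.ball x r := by
          rw [Metric.mem_ball]
          have := dist_triangle q y x
          rw [dist_comm q y] at this
          linarith
        have hq0 : e q i ≤ 0 := by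
          by_contra! h
          exact hq ((hside q (hrs hqr)).2 h)
        have h2 : ‖(e y - e q) i‖ ≤ ‖e y - e q‖ := PiLp.norm_apply_le _ i
        have h3 := hLe.dist_le_mul y (hSr hy) q hqr
        rw [dist_eq_norm] at h3
        have h4 := le_abs_self ((e y - e q) i)
        rw [← Real.norm_eq_abs] at h4
        have h5 : (e y - e q) i = e y i - e q i := rfl
        have h6 : L * dist y q < L * ε := by gcongr
        rw [hsdef]
        linarith
      · rw [hB, Metric.mem_ball, dist_eq_norm, removeCoord_sub]
        refine (norm_removeCoord_le i _).trans_lt ?_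
        rw [← dist_eq_norm]
        refine (hLe.dist_le_mul y (hSr hy) x (Metric.mem_ball_self hr)).trans_lt ?_
        have : dist y x < ρ / (2 * L) := (Metric.mem_ball.1 hy.2).trans_le (min_le_right _ _)
        rw [lt_div_iff₀ (by positivity)] at this
        linarith
    rw [h1, ← EuclideanSpace.euclideanHausdorffMeasure_eq_volume (m + 1)]
    refine setLIntegral_comp_le_of_lipschitzOnWith_leftInverse (d := m + 1) (ψ := e)
      (κ := e.symm) (F := fun z => ‖f (e.symm z)‖ₑ ^ 2) hSm (hLe.continuousOn.mono hSr) hmapsS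
      ?_ ?_ ?_
    · refine hLs.mono ?_
      rintro _ ⟨y, hy, rfl⟩
      have := hmapsS hy
      exact hcyl _ ⟨Ioo_subset_Icc_self this.1, this.2⟩
    · exact fun y hy => e.left_inv (hrs (hSr hy))
    · refine ContinuousOn.aemeasurable ?_ hCm
      exact hfc.comp_continuousOn
        (hLs.continuousOn.mono fun z hz => hcyl z ⟨Ioo_subset_Icc_self hz.1, hz.2⟩)
  refine hflat.trans ((mul_le_mul_right key _).trans ?_)
  have hsu : (∫⁻ y in frontier Ω, ‖f y‖ₑ ^ 2
      ∂(μHE[m] : Measure (EuclideanSpace ℝ (Fin (m + 1)))))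
      = ∫⁻ y, ‖f y‖ₑ ^ 2 ∂surfaceMeasure Ω := rfl
  rw [hsu]
  set P := ∫⁻ y, ‖f y‖ₑ ^ 2 ∂surfaceMeasure Ω
  set Q := ∫⁻ y in boundaryStrip Ω ((2 * L ^ (2 * m + 6) : ℝ≥0) * ε), ‖fderiv ℝ f y‖ₑ ^ 2
  have hLE : (1 : ℝ≥0∞) ≤ L := by exact_mod_cast hL
  have hse : ENNReal.ofReal s = L * ENNReal.ofReal ε := by
    rw [hsdef, ENNReal.ofReal_mul hL0.le, ENNReal.ofReal_coe_nnreal]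
  rw [hse]
  push_cast
  set l : ℝ≥0∞ := (L : ℝ≥0∞)
  set η := ENNReal.ofReal ε
  calc l ^ (m + 1) * (l * η * (2 * (l ^ m * P)) + l * η * (2 * l ^ 2 * (l * η) * (l ^ (m + 1) * Q)))
      = 2 * l ^ (2 * m + 2) * (η * P) + 2 * l ^ (2 * m + 6) * (η ^ 2 * Q) := by ring
    _ ≤ 2 * l ^ (2 * m + 6) * (η * P) + 2 * l ^ (2 * m + 6) * (η ^ 2 * Q) := by
        gcongr
        omega
    _ = _ := by ring

/-- For `C¹` functions, the `L²`-norm on a strip of width `ε` along the boundary is controlled by the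
boundary values and the gradient. -/
theorem exists_strip_estimate {m : ℕ} {Ω : Set (EuclideanSpace ℝ (Fin (m + 1)))}
    (hΩ : IsOpen Ω) (hne : Ωᶜ.Nonempty) (hbdd : Bornology.IsBounded Ω)
    (hb : HasPiecewiseC1Boundary Ω) :
    ∃ K : ℝ≥0, ∃ ε₀ > 0, ∀ ε > 0, ε < ε₀ →
      ∀ f : EuclideanSpace ℝ (Fin (m + 1)) → ℝ, ContDiff ℝ 1 f →
        ∫⁻ y in boundaryStrip Ω ε, ‖f y‖ₑ ^ 2
          ≤ K * (ENNReal.ofReal ε * (∫⁻ y, ‖f y‖ₑ ^ 2 ∂surfaceMeasure Ω)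
            + ENNReal.ofReal ε ^ 2 * ∫⁻ y in boundaryStrip Ω (K * ε), ‖fderiv ℝ f y‖ₑ ^ 2) := by
  choose! r hr K ε₀ hε₀ hest using
    fun (x : EuclideanSpace ℝ (Fin (m + 1))) (hx : x ∈ frontier Ω) =>
      exists_local_strip_estimate hΩ hne hb hx
  have hcomp : IsCompact (frontier Ω) :=
    Metric.isCompact_of_isClosed_isBounded isClosed_frontier
      (hbdd.closure.subset frontier_subset_closure)
  obtain ⟨t, htf, hcov⟩ := hcomp.elim_nhds_subcover (fun x => Metric.ball x (r x))
    fun x hx => Metric.ball_mem_nhds x (hr x hx)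
  set U := ⋃ x ∈ t, Metric.ball x (r x) with hU
  have hUo : IsOpen U := isOpen_biUnion fun _ _ => Metric.isOpen_ball
  -- What the finitely many balls leave uncovered is a compact subset of `Ω`, hence at least some
  -- `δ` away from the complement. A strip narrower than `δ` therefore lies in the balls.
  have hinner : IsCompact (closure Ω \ U) :=
    (Metric.isCompact_of_isClosed_isBounded isClosed_closure hbdd.closure).diff hUo
  have hsub : closure Ω \ U ⊆ Ω := by
    intro y hy
    by_contra h
    exact hy.2 (hcov (hΩ.frontier_eq ▸ ⟨hy.1, h⟩))
  obtain ⟨δ, hδ, hthick⟩ := hinner.exists_thickening_subset_open hΩ hsub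
  obtain ⟨ε₁, hε₁, hε₁t⟩ : ∃ ε₁ > 0, ∀ x ∈ t, ε₁ ≤ ε₀ x := by
    rcases t.eq_empty_or_nonempty with rfl | hnt
    · exact ⟨1, one_pos, by simp⟩
    · refine ⟨t.inf' hnt ε₀, ?_, fun x hx => Finset.inf'_le _ hx⟩
      rw [gt_iff_lt, Finset.lt_inf'_iff]
      exact fun x hx => hε₀ x (htf x hx)
  refine ⟨∑ x ∈ t, K x, min δ ε₁, lt_min hδ hε₁, fun ε hε hεlt f hf => ?_⟩
  have hKle : ∀ x ∈ t, K x ≤ ∑ x ∈ t, K x := fun x hx =>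
    Finset.single_le_sum (f := K) (fun _ _ => zero_le) hx
  have hcover : boundaryStrip Ω ε ⊆ ⋃ x ∈ t, (boundaryStrip Ω ε ∩ Metric.ball x (r x)) := by
    intro y hy
    rw [← inter_iUnion₂]
    refine ⟨hy, ?_⟩
    by_contra h
    obtain ⟨q, hq, hyq⟩ := (Metric.infDist_lt_iff hne).1 hy.2
    refine hq (hthick (Metric.mem_thickening_iff.2 ⟨y, ⟨subset_closure hy.1, h⟩, ?_⟩))
    rw [dist_comm]
    exact hyq.trans (hεlt.trans_le (min_le_left _ _))
  calc ∫⁻ y in boundaryStrip Ω ε, ‖f y‖ₑ ^ 2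
      ≤ ∫⁻ y in ⋃ x ∈ t, (boundaryStrip Ω ε ∩ Metric.ball x (r x)), ‖f y‖ₑ ^ 2 :=
        lintegral_mono_set hcover
    _ ≤ ∑ x ∈ t, ∫⁻ y in boundaryStrip Ω ε ∩ Metric.ball x (r x), ‖f y‖ₑ ^ 2 := by
        rw [← Finset.sum_coe_sort t, ← tsum_fintype (L := .unconditional _)]
        simp_rw [← Finset.mem_coe]
        rw [biUnion_eq_iUnion]
        exact lintegral_iUnion_le _ _
    _ ≤ ∑ x ∈ t, (K x : ℝ≥0∞) * (ENNReal.ofReal ε * (∫⁻ y, ‖f y‖ₑ ^ 2 ∂surfaceMeasure Ω)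
            + ENNReal.ofReal ε ^ 2 *
              ∫⁻ y in boundaryStrip Ω ((∑ x ∈ t, K x : ℝ≥0) * ε), ‖fderiv ℝ f y‖ₑ ^ 2) := by
        refine Finset.sum_le_sum fun x hx => ?_
        refine (hest x (htf x hx) ε hε
          (hεlt.trans_le ((min_le_right _ _).trans (hε₁t x hx))) f hf).trans ?_
        gcongr
        rintro y ⟨hy, hyd⟩
        refine ⟨hy, mem_ofPred.2 (lt_of_lt_of_le (mem_ofPred.1 hyd) ?_)⟩
        exact mul_le_mul_of_nonneg_right (NNReal.coe_le_coe.2 (hKle x hx)) hε.le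
    _ = _ := by
        rw [← Finset.sum_mul]
        push_cast
        rfl

/-! ### Gradients, jets and the closed subspace `H¹(Ω)` -/

theorem eLpNorm_two_sq {X F : Type*} [MeasurableSpace X] [NormedAddCommGroup F] (f : X → F)
    (μ : Measure X) : eLpNorm f 2 μ ^ 2 = ∫⁻ x, ‖f x‖ₑ ^ 2 ∂μ := by
  simpa using eLpNorm_nnreal_pow_eq_lintegral (f := f) (μ := μ) (p := 2) two_ne_zero

section Gradient

variable {n : ℕ}

theorem norm_gradient (f : EuclideanSpace ℝ (Fin n) → ℝ) (x : EuclideanSpace ℝ (Fin n)) :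
    ‖gradient f x‖ = ‖fderiv ℝ f x‖ := by
  simp [gradient]

theorem enorm_gradient (f : EuclideanSpace ℝ (Fin n) → ℝ) (x : EuclideanSpace ℝ (Fin n)) :
    ‖gradient f x‖ₑ = ‖fderiv ℝ f x‖ₑ := by
  rw [← ofReal_norm, ← ofReal_norm, norm_gradient]

theorem continuous_gradient {f : EuclideanSpace ℝ (Fin n) → ℝ} (hf : ContDiff ℝ 1 f) :
    Continuous (gradient f) :=
  (InnerProductSpace.toDual ℝ (EuclideanSpace ℝ (Fin n))).symm.continuous.comp
    (hf.continuous_fderiv one_ne_zero)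

theorem gradient_add {f g : EuclideanSpace ℝ (Fin n) → ℝ} (hf : ContDiff ℝ 1 f)
    (hg : ContDiff ℝ 1 g) (x : EuclideanSpace ℝ (Fin n)) :
    gradient (f + g) x = gradient f x + gradient g x := by
  rw [gradient, fderiv_add (hf.differentiable one_ne_zero x) (hg.differentiable one_ne_zero x),
    map_add]
  rfl

theorem gradient_sub {f g : EuclideanSpace ℝ (Fin n) → ℝ} (hf : ContDiff ℝ 1 f)
    (hg : ContDiff ℝ 1 g) (x : EuclideanSpace ℝ (Fin n)) :
    gradient (f - g) x = gradient f x - gradient g x := by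
  rw [gradient, fderiv_sub (hf.differentiable one_ne_zero x) (hg.differentiable one_ne_zero x),
    map_sub]
  rfl

theorem gradient_const_smul {f : EuclideanSpace ℝ (Fin n) → ℝ} (hf : ContDiff ℝ 1 f) (c : ℝ)
    (x : EuclideanSpace ℝ (Fin n)) : gradient (c • f) x = c • gradient f x := by
  rw [gradient, fderiv_const_smul (hf.differentiable one_ne_zero x), map_smul]
  rfl

theorem gradient_comp {A A' : ℝ → ℝ} (hA : ∀ t, HasDerivAt A (A' t) t)
    {f : EuclideanSpace ℝ (Fin n) → ℝ} (hf : ContDiff ℝ 1 f) (x : EuclideanSpace ℝ (Fin n)) :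
    gradient (A ∘ f) x = A' (f x) • gradient f x := by
  have h := (hA (f x)).comp_hasFDerivAt x (hf.differentiable one_ne_zero x).hasFDerivAt
  rw [gradient, h.fderiv, map_smul]
  rfl

end Gradient

/-- The space of pairs of a square integrable function and a square integrable vector field. -/
abbrev L2Pair {n : ℕ} (Ω : Set (EuclideanSpace ℝ (Fin n))) : Type :=
  WithLp 2 (Lp ℝ 2 (volume.restrict Ω) × Lp (EuclideanSpace ℝ (Fin n)) 2 (volume.restrict Ω))

open Classical in
/-- The pair `(f, ∇f)`, for `f` square integrable together with its gradient. -/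
noncomputable def jet {n : ℕ} (Ω : Set (EuclideanSpace ℝ (Fin n)))
    (f : EuclideanSpace ℝ (Fin n) → ℝ) : L2Pair Ω :=
  if h : MemLp f 2 (volume.restrict Ω) ∧ MemLp (gradient f) 2 (volume.restrict Ω) then
    WithLp.toLp 2 (h.1.toLp f, h.2.toLp (gradient f)) else 0

section Jet

variable {n : ℕ} {Ω : Set (EuclideanSpace ℝ (Fin n))}

theorem isFiniteMeasure_restrict (hΩ : Bornology.IsBounded Ω) :
    IsFiniteMeasure (volume.restrict Ω) :=
  ⟨by rw [Measure.restrict_apply_univ]; exact hΩ.measure_lt_top⟩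

theorem memLp_of_continuous (hΩ : Bornology.IsBounded Ω) {F : Type*} [NormedAddCommGroup F]
    [SecondCountableTopology F]
    {f : EuclideanSpace ℝ (Fin n) → F} (hf : Continuous f) (p : ℝ≥0∞) :
    MemLp f p (volume.restrict Ω) := by
  have := isFiniteMeasure_restrict hΩ
  obtain ⟨C, hC⟩ := (Metric.isCompact_of_isClosed_isBounded isClosed_closure
    hΩ.closure).exists_bound_of_continuousOn hf.continuousOn
  borelize F
  have h : MemLp f p (volume.restrict (closure Ω)) := by
    have := isFiniteMeasure_restrict hΩ.closure
    exact MemLp.of_bound hf.aestronglyMeasurable C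
      ((ae_restrict_iff' isClosed_closure.measurableSet).2 (Eventually.of_forall hC))
  exact h.mono_measure (Measure.restrict_mono subset_closure le_rfl)

theorem jet_eq (hΩ : Bornology.IsBounded Ω) {f : EuclideanSpace ℝ (Fin n) → ℝ}
    (hf : ContDiff ℝ 1 f) :
    jet Ω f = WithLp.toLp 2 ((memLp_of_continuous hΩ hf.continuous 2).toLp f,
      (memLp_of_continuous hΩ (continuous_gradient hf) 2).toLp (gradient f)) := by
  rw [jet, dif_pos ⟨memLp_of_continuous hΩ hf.continuous 2,
    memLp_of_continuous hΩ (continuous_gradient hf) 2⟩]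

theorem coeFn_jet_fst (hΩ : Bornology.IsBounded Ω) {f : EuclideanSpace ℝ (Fin n) → ℝ}
    (hf : ContDiff ℝ 1 f) : (jet Ω f).fst =ᵐ[volume.restrict Ω] f := by
  rw [jet_eq hΩ hf]
  exact (memLp_of_continuous hΩ hf.continuous 2).coeFn_toLp

theorem coeFn_jet_snd (hΩ : Bornology.IsBounded Ω) {f : EuclideanSpace ℝ (Fin n) → ℝ}
    (hf : ContDiff ℝ 1 f) : (jet Ω f).snd =ᵐ[volume.restrict Ω] gradient f := by
  rw [jet_eq hΩ hf]
  exact (memLp_of_continuous hΩ (continuous_gradient hf) 2).coeFn_toLp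

theorem L2Pair.ext_ae {p q : L2Pair Ω} (h1 : p.fst =ᵐ[volume.restrict Ω] q.fst)
    (h2 : p.snd =ᵐ[volume.restrict Ω] q.snd) : p = q := by
  have h1' := Lp.ext h1
  have h2' := Lp.ext h2
  rw [← WithLp.toLp_ofLp 2 p, ← WithLp.toLp_ofLp 2 q]
  congr 1
  exact Prod.ext h1' h2'

theorem jet_add (hΩ : Bornology.IsBounded Ω) {f g : EuclideanSpace ℝ (Fin n) → ℝ}
    (hf : ContDiff ℝ 1 f) (hg : ContDiff ℝ 1 g) : jet Ω (f + g) = jet Ω f + jet Ω g := by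
  refine L2Pair.ext_ae ?_ ?_
  · rw [WithLp.add_fst]
    filter_upwards [coeFn_jet_fst hΩ (hf.add hg), coeFn_jet_fst hΩ hf, coeFn_jet_fst hΩ hg,
      Lp.coeFn_add (jet Ω f).fst (jet Ω g).fst] with x h1 h2 h3 h4
    rw [h4, Pi.add_apply, h2, h3]
    exact h1
  · rw [WithLp.add_snd]
    filter_upwards [coeFn_jet_snd hΩ (hf.add hg), coeFn_jet_snd hΩ hf, coeFn_jet_snd hΩ hg,
      Lp.coeFn_add (jet Ω f).snd (jet Ω g).snd] with x h1 h2 h3 h4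
    rw [h4, Pi.add_apply, h2, h3, ← gradient_add hf hg]
    exact h1

theorem jet_const_smul (hΩ : Bornology.IsBounded Ω) {f : EuclideanSpace ℝ (Fin n) → ℝ}
    (hf : ContDiff ℝ 1 f) (c : ℝ) : jet Ω (c • f) = c • jet Ω f := by
  refine L2Pair.ext_ae ?_ ?_
  · rw [WithLp.smul_fst]
    filter_upwards [coeFn_jet_fst hΩ (hf.const_smul c), coeFn_jet_fst hΩ hf,
      Lp.coeFn_smul c (jet Ω f).fst] with x h1 h2 h3
    rw [h3, Pi.smul_apply, h2]
    exact h1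
  · rw [WithLp.smul_snd]
    filter_upwards [coeFn_jet_snd hΩ (hf.const_smul c), coeFn_jet_snd hΩ hf,
      Lp.coeFn_smul c (jet Ω f).snd] with x h1 h2 h3
    rw [h3, Pi.smul_apply, h2, ← gradient_const_smul hf]
    exact h1

theorem jet_sub (hΩ : Bornology.IsBounded Ω) {f g : EuclideanSpace ℝ (Fin n) → ℝ}
    (hf : ContDiff ℝ 1 f) (hg : ContDiff ℝ 1 g) : jet Ω (f - g) = jet Ω f - jet Ω g := by
  have h := jet_add hΩ (hf.sub hg) hg
  have h2 : f - g + g = f := sub_add_cancel f g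
  exact eq_sub_of_add_eq (h.symm.trans (by congr 1))

theorem jet_zero (hΩ : Bornology.IsBounded Ω) : jet Ω 0 = 0 := by
  have h := jet_const_smul hΩ
    (contDiff_zero_fun : ContDiff ℝ 1 fun _ : EuclideanSpace ℝ (Fin n) => (0 : ℝ)) 0
  rw [zero_smul, zero_smul] at h
  exact h

theorem L2Pair.enorm_sq (p : L2Pair Ω) :
    ‖p‖ₑ ^ 2 = (∫⁻ x in Ω, ‖p.fst x‖ₑ ^ 2) + ∫⁻ x in Ω, ‖p.snd x‖ₑ ^ 2 := by
  have h : ∀ {F : Type} [NormedAddCommGroup F] (f : Lp F 2 (volume.restrict Ω)),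
      ENNReal.ofReal (‖f‖ ^ 2) = ∫⁻ x in Ω, ‖f x‖ₑ ^ 2 := by
    intro F _ f
    rw [ENNReal.ofReal_pow (norm_nonneg _), ofReal_norm, Lp.enorm_def, eLpNorm_two_sq]
  rw [← ofReal_norm, ← ENNReal.ofReal_pow (norm_nonneg _), WithLp.prod_norm_sq_eq_of_L2,
    ENNReal.ofReal_add (by positivity) (by positivity), h, h]

theorem enorm_jet_sq (hΩ : Bornology.IsBounded Ω) {f : EuclideanSpace ℝ (Fin n) → ℝ}
    (hf : ContDiff ℝ 1 f) :
    ‖jet Ω f‖ₑ ^ 2 = (∫⁻ x in Ω, ‖f x‖ₑ ^ 2) + ∫⁻ x in Ω, ‖fderiv ℝ f x‖ₑ ^ 2 := by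
  rw [L2Pair.enorm_sq]
  congr 1
  · refine lintegral_congr_ae ?_
    filter_upwards [coeFn_jet_fst hΩ hf] with x hx
    rw [hx]
  · refine lintegral_congr_ae ?_
    filter_upwards [coeFn_jet_snd hΩ hf] with x hx
    rw [hx, enorm_gradient]

theorem L2Pair.tendsto_iff {ι : Type*} {l : Filter ι} {q : ι → L2Pair Ω} {p : L2Pair Ω} :
    Tendsto q l (𝓝 p) ↔ Tendsto (fun k => (q k).fst) l (𝓝 p.fst) ∧
      Tendsto (fun k => (q k).snd) l (𝓝 p.snd) := by
  constructor
  · intro h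
    exact ⟨((WithLp.continuous_fst _ _ _).tendsto _).comp h,
      ((WithLp.continuous_snd _ _ _).tendsto _).comp h⟩
  · rintro ⟨h1, h2⟩
    exact ((WithLp.prod_continuous_toLp 2 _ _).tendsto (p.fst, p.snd)).comp (h1.prodMk_nhds h2)

/-- This turns the two interior conditions in `IsTrace` into convergence in a single Hilbert space.
-/
theorem tendsto_jet_iff (hΩ : Bornology.IsBounded Ω) {φ : ℕ → EuclideanSpace ℝ (Fin n) → ℝ}
    (hφ : ∀ k, ContDiff ℝ 1 (φ k)) {p : L2Pair Ω} :
    Tendsto (fun k => jet Ω (φ k)) atTop (𝓝 p) ↔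
      Tendsto (fun k => eLpNorm (fun x => φ k x - p.fst x) 2 (volume.restrict Ω)) atTop (𝓝 0) ∧
      Tendsto (fun k => eLpNorm (fun x => gradient (φ k) x - p.snd x) 2 (volume.restrict Ω))
        atTop (𝓝 0) := by
  rw [L2Pair.tendsto_iff, Lp.tendsto_Lp_iff_tendsto_eLpNorm', Lp.tendsto_Lp_iff_tendsto_eLpNorm']
  have h1 : ∀ k, eLpNorm (⇑(jet Ω (φ k)).fst - ⇑p.fst) 2 (volume.restrict Ω)
      = eLpNorm (fun x => φ k x - p.fst x) 2 (volume.restrict Ω) := fun k => by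
    refine eLpNorm_congr_ae ?_
    filter_upwards [coeFn_jet_fst hΩ (hφ k)] with x hx
    rw [Pi.sub_apply, hx]
  have h2 : ∀ k, eLpNorm (⇑(jet Ω (φ k)).snd - ⇑p.snd) 2 (volume.restrict Ω)
      = eLpNorm (fun x => gradient (φ k) x - p.snd x) 2 (volume.restrict Ω) := fun k => by
    refine eLpNorm_congr_ae ?_
    filter_upwards [coeFn_jet_snd hΩ (hφ k)] with x hx
    rw [Pi.sub_apply, hx]
  rw [funext h1, funext h2]

theorem IsTestFunction.contDiff_one {φ : EuclideanSpace ℝ (Fin n) → ℝ}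
    (h : IsTestFunction Ω φ) : ContDiff ℝ 1 φ :=
  h.1.of_le (by exact_mod_cast le_top)

theorem IsTestFunction.zero : IsTestFunction Ω (0 : EuclideanSpace ℝ (Fin n) → ℝ) :=
  ⟨contDiff_zero_fun, HasCompactSupport.zero, by simp [tsupport]⟩

theorem IsTestFunction.add {φ ψ : EuclideanSpace ℝ (Fin n) → ℝ}
    (h : IsTestFunction Ω φ) (h' : IsTestFunction Ω ψ) : IsTestFunction Ω (φ + ψ) :=
  ⟨h.1.add h'.1, h.2.1.add h'.2.1, (tsupport_add φ ψ).trans (union_subset h.2.2 h'.2.2)⟩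

theorem IsTestFunction.const_smul {φ : EuclideanSpace ℝ (Fin n) → ℝ}
    (h : IsTestFunction Ω φ) (c : ℝ) : IsTestFunction Ω (c • φ) :=
  ⟨h.1.const_smul c, h.2.1.smul_left (f := fun _ => c),
    (tsupport_smul_subset_right (fun _ => c) φ).trans h.2.2⟩

theorem setIntegral_eq_integral_of_tsupport_subset {F : Type*} [NormedAddCommGroup F]
    [NormedSpace ℝ F] {f : EuclideanSpace ℝ (Fin n) → F} (h : tsupport f ⊆ Ω) :
    ∫ x in Ω, f x = ∫ x, f x :=
  setIntegral_eq_integral_of_forall_compl_eq_zero fun _ hx =>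
    image_eq_zero_of_notMem_tsupport fun hx' => hx (h hx')

/-- Pairing with fixed vectors gives scalar conditions, suited to integration by parts and to the
proof that `H1 Ω` is closed. -/
theorem isWeakGradient_iff_inner {u : Lp ℝ 2 (volume.restrict Ω)}
    {G : Lp (EuclideanSpace ℝ (Fin n)) 2 (volume.restrict Ω)} :
    IsWeakGradient u G ↔ ∀ φ : EuclideanSpace ℝ (Fin n) → ℝ, IsTestFunction Ω φ → ∀ v,
      ∫ x in Ω, u x * fderiv ℝ φ x v = -∫ x in Ω, φ x * inner ℝ v (G x) := by
  refine forall₂_congr fun φ hφ => ?_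
  have i1 : Integrable (fun x => u x • gradient φ x) (volume.restrict Ω) :=
    memLp_one_iff_integrable.1 (hφ.memLp_gradient.smul (Lp.memLp u))
  have i2 : Integrable (fun x => φ x • G x) (volume.restrict Ω) :=
    memLp_one_iff_integrable.1 ((Lp.memLp G).smul hφ.memLp)
  have j1 : ∀ v, ∫ x in Ω, u x * fderiv ℝ φ x v = inner ℝ v (∫ x in Ω, u x • gradient φ x) := by
    intro v
    rw [← integral_inner i1]
    refine integral_congr_ae (Eventually.of_forall fun x => ?_)
    simp only
    rw [inner_smul_right, inner_gradient_right]
    rfl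
  have j2 : ∀ v, ∫ x in Ω, φ x * inner ℝ v (G x) = inner ℝ v (∫ x in Ω, φ x • G x) := by
    intro v
    rw [← integral_inner i2]
    refine integral_congr_ae (Eventually.of_forall fun x => ?_)
    simp only
    rw [inner_smul_right]
  simp_rw [j1, j2, ← inner_neg_right]
  exact ⟨fun h v => by rw [h], fun h => ext_inner_left ℝ h⟩

theorem L2Pair.inner_eq (p q : L2Pair Ω) :
    inner ℝ p q = (∫ x in Ω, p.fst x * q.fst x) + ∫ x in Ω, inner ℝ (p.snd x) (q.snd x) := by
  rw [WithLp.prod_inner_apply, L2.inner_def, L2.inner_def]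
  congr 1
  refine integral_congr_ae (Eventually.of_forall fun x => ?_)
  exact mul_comm _ _

/-- For fixed `φ` and `v` the condition is orthogonality to the pair `(∂ᵥφ, φ v)`, so the space is
an intersection of closed hyperplanes or whole spaces. -/
theorem isClosed_H1 : IsClosed (H1 Ω : Set (L2Pair Ω)) := by
  have h : (H1 Ω : Set (L2Pair Ω)) = ⋂ (φ : EuclideanSpace ℝ (Fin n) → ℝ)
      (_ : IsTestFunction Ω φ) (v : EuclideanSpace ℝ (Fin n)),
      {p : L2Pair Ω | ∫ x in Ω, p.fst x * fderiv ℝ φ x v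
        = -∫ x in Ω, φ x * inner ℝ v (p.snd x)} := by
    ext p
    simp only [mem_iInter]
    exact isWeakGradient_iff_inner
  rw [h]
  refine isClosed_iInter fun φ => isClosed_iInter fun hφ => isClosed_iInter fun v => ?_
  have m1 : MemLp (fun x => fderiv ℝ φ x v) 2 (volume.restrict Ω) := by
    refine (Continuous.memLp_of_hasCompactSupport ?_ ?_).restrict Ω
    · exact (hφ.contDiff_one.continuous_fderiv one_ne_zero).clm_apply continuous_const
    · exact (hφ.2.1.fderiv (𝕜 := ℝ)).comp_left (g := fun L : _ →L[ℝ] ℝ => L v) (by simp)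
  have m2 : MemLp (fun x => φ x • v) 2 (volume.restrict Ω) := by
    refine (Continuous.memLp_of_hasCompactSupport ?_ ?_).restrict Ω
    · exact hφ.1.continuous.smul continuous_const
    · exact hφ.2.1.smul_right
  have key : ∀ p : L2Pair Ω, (∫ x in Ω, p.fst x * fderiv ℝ φ x v
      = -∫ x in Ω, φ x * inner ℝ v (p.snd x)) ↔
      inner ℝ (WithLp.toLp 2 (m1.toLp _, m2.toLp _) : L2Pair Ω) p = 0 := by
    intro p
    rw [L2Pair.inner_eq, eq_neg_iff_add_eq_zero]
    have e1 : ∫ x in Ω, (WithLp.toLp 2 (m1.toLp _, m2.toLp _) : L2Pair Ω).fst x * p.fst x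
        = ∫ x in Ω, p.fst x * fderiv ℝ φ x v := by
      refine integral_congr_ae ?_
      filter_upwards [m1.coeFn_toLp] with x hx
      rw [WithLp.toLp_fst, hx, mul_comm]
    have e2 : ∫ x in Ω, inner ℝ ((WithLp.toLp 2 (m1.toLp _, m2.toLp _) : L2Pair Ω).snd x) (p.snd x)
        = ∫ x in Ω, φ x * inner ℝ v (p.snd x) := by
      refine integral_congr_ae ?_
      filter_upwards [m2.coeFn_toLp] with x hx
      rw [WithLp.toLp_snd, hx, real_inner_smul_left]
    rw [e1, e2]
  simp_rw [key]
  exact isClosed_eq (continuous_const.inner continuous_id) continuous_const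

/-- The test function is supported in `Ω`, so the integrals extend to the whole space, where
integration by parts has no boundary term. -/
theorem jet_mem_H1 (hΩ : Bornology.IsBounded Ω) {f : EuclideanSpace ℝ (Fin n) → ℝ}
    (hf : ContDiff ℝ 1 f) : jet Ω f ∈ H1 Ω := by
  refine isWeakGradient_iff_inner.2 fun φ hφ v => ?_
  have cφ := hφ.contDiff_one.continuous_fderiv one_ne_zero
  have cf := hf.continuous_fderiv one_ne_zero
  have e1 : ∫ x in Ω, (jet Ω f).fst x * fderiv ℝ φ x v = ∫ x, f x * fderiv ℝ φ x v := by
    rw [← setIntegral_eq_integral_of_tsupport_subset (Ω := Ω)]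
    · refine integral_congr_ae ?_
      filter_upwards [coeFn_jet_fst hΩ hf] with x hx
      rw [hx]
    · refine (closure_mono fun x hx => ?_).trans ((tsupport_fderiv_subset ℝ (f := φ)).trans hφ.2.2)
      rw [Function.mem_support] at hx ⊢
      intro h
      exact hx (by simp [h])
  have e2 : ∫ x in Ω, φ x * inner ℝ v ((jet Ω f).snd x) = ∫ x, fderiv ℝ f x v * φ x := by
    rw [← setIntegral_eq_integral_of_tsupport_subset (Ω := Ω)]
    · refine integral_congr_ae ?_
      filter_upwards [coeFn_jet_snd hΩ hf] with x hx
      rw [hx, inner_gradient_right, mul_comm]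
      rfl
    · refine (closure_mono fun x hx => ?_).trans hφ.2.2
      rw [Function.mem_support] at hx ⊢
      intro h
      exact hx (by simp [h])
  rw [e1, e2]
  refine integral_mul_fderiv_eq_neg_fderiv_mul_of_integrable ?_ ?_ ?_
    (fun x _ => hf.differentiable one_ne_zero x)
    (fun x _ => hφ.contDiff_one.differentiable one_ne_zero x)
  · exact ((cf.clm_apply continuous_const).mul hφ.1.continuous).integrable_of_hasCompactSupport
      hφ.2.1.mul_left
  · refine (hf.continuous.mul (cφ.clm_apply continuous_const)).integrable_of_hasCompactSupport
      (HasCompactSupport.mul_left ?_)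
    exact (hφ.2.1.fderiv (𝕜 := ℝ)).comp_left (g := fun L : _ →L[ℝ] ℝ => L v) (by simp)
  · exact (hf.continuous.mul hφ.1.continuous).integrable_of_hasCompactSupport hφ.2.1.mul_left

end Jet

/-! ### The space `H¹₀(Ω)` -/

/-- The jets of test functions. -/
noncomputable def testJets {n : ℕ} (Ω : Set (EuclideanSpace ℝ (Fin n)))
    (hΩ : Bornology.IsBounded Ω) : Submodule ℝ (L2Pair Ω) where
  carrier := {p | ∃ φ, IsTestFunction Ω φ ∧ jet Ω φ = p}
  zero_mem' := ⟨0, IsTestFunction.zero, jet_zero hΩ⟩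
  add_mem' := by
    rintro _ _ ⟨φ, hφ, rfl⟩ ⟨ψ, hψ, rfl⟩
    exact ⟨φ + ψ, hφ.add hψ, jet_add hΩ hφ.contDiff_one hψ.contDiff_one⟩
  smul_mem' := by
    rintro c _ ⟨φ, hφ, rfl⟩
    exact ⟨c • φ, hφ.const_smul c, jet_const_smul hΩ hφ.contDiff_one c⟩

/-- The space `H¹₀(Ω)`, the closure of the test functions. -/
noncomputable def H10 {n : ℕ} (Ω : Set (EuclideanSpace ℝ (Fin n)))
    (hΩ : Bornology.IsBounded Ω) : Submodule ℝ (L2Pair Ω) :=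
  (testJets Ω hΩ).topologicalClosure

section H10

variable {n : ℕ} {Ω : Set (EuclideanSpace ℝ (Fin n))}

theorem IsTestFunction.jet_mem_H10 (hΩ : Bornology.IsBounded Ω)
    {φ : EuclideanSpace ℝ (Fin n) → ℝ} (hφ : IsTestFunction Ω φ) : jet Ω φ ∈ H10 Ω hΩ :=
  Submodule.le_topologicalClosure _ ⟨φ, hφ, rfl⟩

theorem isClosed_H10 (hΩ : Bornology.IsBounded Ω) : IsClosed (H10 Ω hΩ : Set (L2Pair Ω)) :=
  Submodule.isClosed_topologicalClosure _

theorem exists_tendsto_of_mem_H10 {hΩ : Bornology.IsBounded Ω} {p : L2Pair Ω}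
    (hp : p ∈ H10 Ω hΩ) : ∃ φ : ℕ → EuclideanSpace ℝ (Fin n) → ℝ,
      (∀ k, IsTestFunction Ω (φ k)) ∧ Tendsto (fun k => jet Ω (φ k)) atTop (𝓝 p) := by
  obtain ⟨q, hq, hlim⟩ := mem_closure_iff_seq_limit.1 hp
  choose φ hφ hφq using hq
  exact ⟨φ, hφ, by simpa only [hφq] using hlim⟩

/-- A closed condition that holds for test functions holds on `H¹₀(Ω)`. -/
theorem H10_induction {hΩ : Bornology.IsBounded Ω} {P : L2Pair Ω → Prop}
    (hP : IsClosed {p | P p}) (h : ∀ φ, IsTestFunction Ω φ → P (jet Ω φ)) {p : L2Pair Ω}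
    (hp : p ∈ H10 Ω hΩ) : P p := by
  obtain ⟨φ, hφ, hlim⟩ := exists_tendsto_of_mem_H10 hp
  exact hP.mem_of_tendsto hlim (Eventually.of_forall fun k => h _ (hφ k))

end H10

/-! ### Mollification and cutoff functions -/

section Mollification

variable {n : ℕ} {Ω : Set (EuclideanSpace ℝ (Fin n))}

/-- A compactly supported `C¹` function in `Ω` is a `C¹`-limit of test functions. -/
theorem exists_testFunction_near {f : EuclideanSpace ℝ (Fin n) → ℝ}
    (hΩ : IsOpen Ω) (hf : ContDiff ℝ 1 f) (hfc : HasCompactSupport f) (hfΩ : tsupport f ⊆ Ω)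
    {ε : ℝ} (hε : 0 < ε) :
    ∃ φ, IsTestFunction Ω φ ∧ ∀ x, ‖φ x - f x‖ ≤ ε ∧ ‖fderiv ℝ φ x - fderiv ℝ f x‖ ≤ ε := by
  have hc' : Continuous (fderiv ℝ f) := hf.continuous_fderiv one_ne_zero
  obtain ⟨δ₁, hδ₁, h₁⟩ := Metric.uniformContinuous_iff.1
    (hfc.uniformContinuous_of_continuous hf.continuous) ε hε
  obtain ⟨δ₂, hδ₂, h₂⟩ := Metric.uniformContinuous_iff.1
    ((hfc.fderiv (𝕜 := ℝ)).uniformContinuous_of_continuous hc') ε hε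
  obtain ⟨δ₃, hδ₃, h₃⟩ := hfc.isCompact.exists_cthickening_subset_open hΩ hfΩ
  -- The three radii serve the uniform continuity of `f`, that of its derivative, and the room left
  -- for the support inside `Ω`.
  set δ := min δ₁ (min δ₂ δ₃) with hδdef
  have hδ : 0 < δ := lt_min hδ₁ (lt_min hδ₂ hδ₃)
  let ρ : ContDiffBump (0 : EuclideanSpace ℝ (Fin n)) := ⟨δ / 2, δ, by positivity, by linarith⟩
  set φ : EuclideanSpace ℝ (Fin n) → ℝ := ρ.normed volume ⋆[lsmul ℝ ℝ, volume] f with hφdef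
  have hloc : LocallyIntegrable (ρ.normed volume) volume :=
    (ρ.continuous_normed).locallyIntegrable
  have hsm : ContDiff ℝ ∞ φ :=
    ρ.hasCompactSupport_normed.contDiff_convolution_left _ ρ.contDiff_normed
      hf.continuous.locallyIntegrable
  have hsupp : tsupport φ ⊆ Metric.cthickening δ (tsupport f) := by
    refine closure_minimal ?_ Metric.isClosed_cthickening
    refine (support_convolution_subset _).trans ?_
    rintro _ ⟨a, ha, b, hb, rfl⟩
    rw [ρ.support_normed_eq, Metric.mem_ball, dist_zero_right] at ha
    refine Metric.mem_cthickening_of_dist_le _ b δ _ (subset_tsupport f hb) ?_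
    simpa using ha.le
  refine ⟨φ, ⟨hsm, ?_, (hsupp.trans (Metric.cthickening_mono
    ((min_le_right _ _).trans (min_le_right _ _)) _)).trans h₃⟩, fun x => ⟨?_, ?_⟩⟩
  · exact ρ.hasCompactSupport_normed.convolution _ hfc
  · rw [← dist_eq_norm]
    refine ρ.dist_normed_convolution_le hf.continuous.aestronglyMeasurable fun y hy => ?_
    exact (h₁ ((Metric.mem_ball.1 hy).trans_le (min_le_left _ _))).le
  · have hder := hfc.hasFDerivAt_convolution_right (lsmul ℝ ℝ) hloc hf x
    rw [hder.fderiv]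
    refine ContinuousLinearMap.opNorm_le_bound _ hε.le fun v => ?_
    rw [sub_apply,
      convolution_precompR_apply _ hloc (hfc.fderiv (𝕜 := ℝ)) hc', ← dist_eq_norm]
    refine ρ.dist_normed_convolution_le (hc'.clm_apply continuous_const).aestronglyMeasurable
      fun y hy => ?_
    rw [dist_eq_norm, ← sub_apply]
    refine (ContinuousLinearMap.le_opNorm _ _).trans ?_
    gcongr
    rw [← dist_eq_norm]
    exact (h₂ ((Metric.mem_ball.1 hy).trans_le ((min_le_right _ _).trans (min_le_left _ _)))).le

/-- Mollifications are test functions that converge uniformly with their gradients, and on a set of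
finite measure uniform convergence implies convergence in `L²`. -/
theorem jet_mem_H10 (hΩ : IsOpen Ω) (hb : Bornology.IsBounded Ω)
    {f : EuclideanSpace ℝ (Fin n) → ℝ} (hf : ContDiff ℝ 1 f) (hfc : HasCompactSupport f)
    (hfΩ : tsupport f ⊆ Ω) : jet Ω f ∈ H10 Ω hb := by
  have hpos : ∀ k : ℕ, (0 : ℝ) < 1 / ((k : ℝ) + 1) := fun k => by positivity
  choose φ hφ hφf using fun k : ℕ => exists_testFunction_near hΩ hf hfc hfΩ (hpos k)
  have := isFiniteMeasure_restrict hb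
  have hzero : ∀ {F : Type} [NormedAddCommGroup F]
      (g : ℕ → EuclideanSpace ℝ (Fin n) → F),
      (∀ k, ∀ᵐ x ∂volume.restrict Ω, ‖g k x‖ ≤ 1 / ((k : ℝ) + 1)) →
      Tendsto (fun k => eLpNorm (g k) 2 (volume.restrict Ω)) atTop (𝓝 0) := by
    intro F _ g hg
    have hlim : Tendsto (fun k : ℕ => (volume.restrict Ω) univ ^ (2 : ℝ≥0∞).toReal⁻¹ *
        ENNReal.ofReal (1 / ((k : ℝ) + 1))) atTop (𝓝 0) := by
      have h0 := ENNReal.tendsto_ofReal (tendsto_one_div_add_atTop_nhds_zero_nat (𝕜 := ℝ))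
      rw [ENNReal.ofReal_zero] at h0
      have := ENNReal.Tendsto.const_mul (a := (volume.restrict Ω) univ ^ (2 : ℝ≥0∞).toReal⁻¹) h0
        (Or.inr (ENNReal.rpow_ne_top_of_nonneg (by positivity) (measure_ne_top _ _)))
      rwa [mul_zero] at this
    exact tendsto_of_tendsto_of_tendsto_of_le_of_le tendsto_const_nhds hlim
      (fun _ => zero_le) fun k => eLpNorm_le_of_ae_bound (hg k)
  refine (isClosed_H10 hb).mem_of_tendsto ((tendsto_jet_iff hb
    fun k => (hφ k).contDiff_one).2 ⟨hzero _ fun k => ?_, hzero _ fun k => ?_⟩)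
    (Eventually.of_forall fun k => (hφ k).jet_mem_H10 hb)
  · filter_upwards [coeFn_jet_fst hb hf] with x hx
    rw [hx]
    exact (hφf k x).1
  · filter_upwards [coeFn_jet_snd hb hf] with x hx
    rw [hx, ← gradient_sub (hφ k).contDiff_one hf, norm_gradient,
      fderiv_sub ((hφ k).contDiff_one.differentiable one_ne_zero x)
        (hf.differentiable one_ne_zero x)]
    exact (hφf k x).2

/-- Smooth cutoff functions that vanish near the complement of `Ω` and are `1` off a strip of
width `ε`. -/
theorem exists_cutoff (hb : Bornology.IsBounded Ω)
    {ε : ℝ} (hε : 0 < ε) :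
    ∃ η : EuclideanSpace ℝ (Fin n) → ℝ, IsTestFunction Ω η ∧ (∀ x, ‖1 - η x‖ ≤ 1) ∧
      (∀ x, ‖fderiv ℝ η x‖ ≤ 3 / ε) ∧ ∀ x ∈ Ω, x ∉ boundaryStrip Ω ε → η =ᶠ[𝓝 x] 1 := by
  let d : EuclideanSpace ℝ (Fin n) → ℝ := fun x => Metric.infDist x Ωᶜ
  have hd : LipschitzWith 1 d := Metric.lipschitz_infDist_pt _
  -- This profile is `0` where `d ≤ ε / 3`, `1` where `d ≥ 2ε / 3`, and has slope at most `3 / ε`.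
  -- Mollifying at radius `ε / 6` keeps the slope bound, the value `0` where `d < ε / 6` and the
  -- value `1` where `d ≥ 5ε / 6`.
  let h : EuclideanSpace ℝ (Fin n) → ℝ := fun x => max 0 (min 1 (3 / ε * d x - 1))
  have hL : ∀ x y, ‖h x - h y‖ ≤ 3 / ε * ‖x - y‖ := by
    intro x y
    have h1 : |h x - h y| ≤ |min 1 (3 / ε * d x - 1) - min 1 (3 / ε * d y - 1)| :=
      abs_max_sub_max_le_max _ _ _ _ |>.trans (by simp)
    have h2 : |min 1 (3 / ε * d x - 1) - min 1 (3 / ε * d y - 1)|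
        ≤ |(3 / ε * d x - 1) - (3 / ε * d y - 1)| :=
      abs_min_sub_min_le_max _ _ _ _ |>.trans (by simp)
    have h3 : |(3 / ε * d x - 1) - (3 / ε * d y - 1)| = 3 / ε * |d x - d y| := by
      rw [sub_sub_sub_cancel_right, ← mul_sub, abs_mul, abs_of_pos (by positivity : 0 < 3 / ε)]
    have h4 := hd.dist_le_mul x y
    rw [Real.dist_eq, NNReal.coe_one, one_mul, dist_eq_norm] at h4
    rw [Real.norm_eq_abs]
    refine (h1.trans h2).trans (h3.trans_le ?_)
    gcongr
  have hcont : Continuous h := by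
    have := hd.continuous
    fun_prop
  have h0 : ∀ x, 0 ≤ h x := fun x => le_max_left _ _
  have h1 : ∀ x, h x ≤ 1 := fun x => max_le zero_le_one (min_le_left _ _)
  let ρ : ContDiffBump (0 : EuclideanSpace ℝ (Fin n)) :=
    ⟨ε / 12, ε / 6, by positivity, by linarith⟩
  set η : EuclideanSpace ℝ (Fin n) → ℝ := ρ.normed volume ⋆[lsmul ℝ ℝ, volume] h with hη
  have hsm : ContDiff ℝ ∞ η :=
    ρ.hasCompactSupport_normed.contDiff_convolution_left _ ρ.contDiff_normed
      hcont.locallyIntegrable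
  have hint : ∀ x, Integrable (fun t => ρ.normed volume t * h (x - t)) volume := fun x =>
    (ρ.continuous_normed.mul (hcont.comp (by fun_prop))).integrable_of_hasCompactSupport
      ρ.hasCompactSupport_normed.mul_right
  have hηx : ∀ x, η x = ∫ t, ρ.normed volume t * h (x - t) := fun x => rfl
  have hρint : Integrable (fun t => ρ.normed (volume : Measure (EuclideanSpace ℝ (Fin n))) t) :=
    ρ.continuous_normed.integrable_of_hasCompactSupport ρ.hasCompactSupport_normed
  have hη0 : ∀ x, 0 ≤ η x := fun x => by
    rw [hηx]
    exact integral_nonneg fun t => mul_nonneg (ρ.nonneg_normed t) (h0 _)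
  have hη1 : ∀ x, η x ≤ 1 := fun x => by
    rw [hηx, ← ρ.integral_normed (μ := volume)]
    exact integral_mono (hint x) hρint
      fun t => mul_le_of_le_one_right (ρ.nonneg_normed t) (h1 _)
  have hηL : LipschitzWith (Real.toNNReal (3 / ε)) η := by
    refine LipschitzWith.of_dist_le_mul fun x y => ?_
    rw [Real.coe_toNNReal _ (by positivity), dist_eq_norm, dist_eq_norm, hηx, hηx,
      ← integral_sub (hint x) (hint y)]
    calc ‖∫ t, (ρ.normed volume t * h (x - t) - ρ.normed volume t * h (y - t))‖
        ≤ ∫ t, ρ.normed volume t * (3 / ε * ‖x - y‖) := by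
          refine norm_integral_le_of_norm_le (hρint.mul_const _) (Eventually.of_forall fun t => ?_)
          rw [← mul_sub, norm_mul, Real.norm_of_nonneg (ρ.nonneg_normed t)]
          gcongr
          · exact ρ.nonneg_normed t
          · simpa using hL (x - t) (y - t)
      _ = 3 / ε * ‖x - y‖ := by
          rw [integral_mul_const, ρ.integral_normed, one_mul]
  have hdball : ∀ x, ∀ y ∈ Metric.ball x (ε / 6), |d y - d x| ≤ ε / 6 := by
    intro x y hy
    have := hd.dist_le_mul y x
    rw [Real.dist_eq, NNReal.coe_one, one_mul] at this
    exact this.trans (Metric.mem_ball.1 hy).le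
  have hconst : ∀ x c, (∀ y ∈ Metric.ball x (ε / 6), h y = c) → η x = c := by
    intro x c hc
    have hcx : h x = c := hc x (Metric.mem_ball_self (by positivity))
    have := ρ.dist_normed_convolution_le (μ := volume) (x₀ := x) (ε := 0)
      hcont.aestronglyMeasurable (fun y hy => by rw [hc y hy, hcx, dist_self])
    exact (dist_le_zero.1 this).trans hcx
  have hone : ∀ x, 5 / 6 * ε ≤ d x → η x = 1 := by
    intro x hx
    refine hconst x 1 fun y hy => ?_
    have h5 := (abs_le.1 (hdball x y hy)).1
    have h6 : 2 ≤ 3 / ε * d y := by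
      rw [div_mul_eq_mul_div, le_div_iff₀ hε]
      linarith
    simp only [h]
    rw [min_eq_left (by linarith), max_eq_right zero_le_one]
  have hzero : ∀ x, d x < ε / 6 → η x = 0 := by
    intro x hx
    refine hconst x 0 fun y hy => ?_
    have h5 := (abs_le.1 (hdball x y hy)).2
    have h6 : 3 / ε * d y ≤ 1 := by
      rw [div_mul_eq_mul_div, div_le_one hε]
      linarith
    simp only [h]
    rw [max_eq_left]
    exact (min_le_right _ _).trans (by linarith)
  have hsupp : tsupport η ⊆ Ω := by
    have hsub : tsupport η ⊆ {x | ε / 6 ≤ d x} := by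
      refine closure_minimal (fun x hx => ?_) (isClosed_le continuous_const hd.continuous)
      by_contra hlt
      exact hx (hzero x (not_le.1 hlt))
    intro x hx
    by_contra hxΩ
    have h7 : d x = 0 := Metric.infDist_zero_of_mem hxΩ
    have h8 : ε / 6 ≤ d x := hsub hx
    linarith
  refine ⟨η, ⟨hsm, ?_, hsupp⟩, fun x => ?_, fun x => ?_, fun x hx hxs => ?_⟩
  · exact Metric.isCompact_of_isClosed_isBounded (isClosed_tsupport η) (hb.subset hsupp)
  · rw [Real.norm_eq_abs, abs_le]
    exact ⟨by linarith [hη1 x], by linarith [hη0 x]⟩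
  · refine (norm_fderiv_le_of_lipschitz ℝ hηL).trans_eq ?_
    exact Real.coe_toNNReal _ (by positivity)
  · have hdx : ε ≤ d x := by
      by_contra! hlt
      exact hxs ⟨hx, hlt⟩
    have hlt : 5 / 6 * ε < d x := by linarith
    filter_upwards [hd.continuous.continuousAt.eventually_const_lt hlt] with y hy
    exact hone y hy.le

end Mollification

/-! ### Vanishing boundary values imply membership in `H¹₀(Ω)` -/

theorem _root_.ENNReal.add_sq_le_two_mul (a b : ℝ≥0∞) : (a + b) ^ 2 ≤ 2 * a ^ 2 + 2 * b ^ 2 := by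
  wlog h : a ≤ b generalizing a b
  · rw [add_comm a, add_comm (2 * a ^ 2)]
    exact this b a (le_of_not_ge h)
  obtain ⟨c, rfl⟩ := exists_add_of_le h
  calc (a + (a + c)) ^ 2 = 4 * a ^ 2 + 4 * (a * c) + c ^ 2 := by ring
    _ ≤ 4 * a ^ 2 + 4 * (a * c) + c ^ 2 + c ^ 2 := le_self_add
    _ = _ := by ring

section ZeroTrace

variable {n : ℕ} {Ω : Set (EuclideanSpace ℝ (Fin n))}

theorem boundaryStrip_mono {ε δ : ℝ} (h : ε ≤ δ) : boundaryStrip Ω ε ⊆ boundaryStrip Ω δ :=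
  fun _ hy => ⟨hy.1, mem_ofPred.2 (lt_of_lt_of_le (mem_ofPred.1 hy.2) h)⟩

/-- The strips decrease to the empty set, because each point of an open set has positive distance
from the complement. The complement must be nonempty, since `Metric.infDist` to the empty set is
`0`. -/
theorem tendsto_volume_boundaryStrip (hΩ : IsOpen Ω) (hne : Ωᶜ.Nonempty)
    (hb : Bornology.IsBounded Ω) :
    Tendsto (fun j : ℕ => volume (boundaryStrip Ω (1 / ((j : ℝ) + 1)))) atTop (𝓝 0) := by
  have hempty : ⋂ j : ℕ, boundaryStrip Ω (1 / ((j : ℝ) + 1)) = ∅ := by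
    refine eq_empty_of_forall_notMem fun x hx => ?_
    rw [mem_iInter] at hx
    have h0 : Metric.infDist x Ωᶜ ≤ 0 :=
      ge_of_tendsto' (tendsto_one_div_add_atTop_nhds_zero_nat (𝕜 := ℝ)) fun j => (hx j).2.le
    have h1 := (hΩ.isClosed_compl.mem_iff_infDist_zero hne).2
      (le_antisymm h0 Metric.infDist_nonneg)
    exact h1 (hx 0).1
  have h := tendsto_measure_iInter_atTop (μ := volume)
    (s := fun j : ℕ => boundaryStrip Ω (1 / ((j : ℝ) + 1)))
    (fun j => (measurableSet_boundaryStrip hΩ _).nullMeasurableSet)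
    (fun i j hij => boundaryStrip_mono (by gcongr))
    ⟨0, ((measure_mono inter_subset_left).trans_lt hb.measure_lt_top).ne⟩
  rwa [hempty, measure_empty] at h

/-- The difference `(1 - η) w` vanishes in `Ω` off the strip, and its gradient is `(1 - η)∇w - w∇η`.
The dangerous term is `w∇η`, of size `|w| / ε`; the strip estimate is meant for it. -/
theorem enorm_jet_sub_jet_mul_sq_le (hΩ : IsOpen Ω) (hb : Bornology.IsBounded Ω) {ε : ℝ}
    {η w : EuclideanSpace ℝ (Fin n) → ℝ} (hη : ContDiff ℝ 1 η) (hη1 : ∀ x, ‖1 - η x‖ ≤ 1)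
    (hηd : ∀ x, ‖fderiv ℝ η x‖ ≤ 3 / ε)
    (hηs : ∀ x ∈ Ω, x ∉ boundaryStrip Ω ε → η =ᶠ[𝓝 x] 1) (hw : ContDiff ℝ 1 w) :
    ‖jet Ω w - jet Ω (η * w)‖ₑ ^ 2
      ≤ (1 + 2 * ENNReal.ofReal (3 / ε) ^ 2) * (∫⁻ x in boundaryStrip Ω ε, ‖w x‖ₑ ^ 2)
        + 2 * ∫⁻ x in boundaryStrip Ω ε, ‖fderiv ℝ w x‖ₑ ^ 2 := by
  have hS := measurableSet_boundaryStrip hΩ ε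
  have hstrip : ∀ F G : EuclideanSpace ℝ (Fin n) → ℝ≥0∞, (∀ x ∈ boundaryStrip Ω ε, F x ≤ G x) →
      (∀ x ∈ Ω, x ∉ boundaryStrip Ω ε → F x = 0) →
      ∫⁻ x in Ω, F x ≤ ∫⁻ x in boundaryStrip Ω ε, G x := by
    intro F G h1 h2
    calc ∫⁻ x in Ω, F x ≤ ∫⁻ x in Ω, (boundaryStrip Ω ε).indicator G x := by
          refine lintegral_mono_ae ((ae_restrict_iff' hΩ.measurableSet).2
            (Eventually.of_forall fun x hx => ?_))
          by_cases hxs : x ∈ boundaryStrip Ω ε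
          · rw [indicator_of_mem hxs]
            exact h1 x hxs
          · rw [h2 x hx hxs]
            exact zero_le
      _ = ∫⁻ x in boundaryStrip Ω ε, G x := by
          have hsub : boundaryStrip Ω ε ⊆ Ω := inter_subset_left
          rw [lintegral_indicator hS, Measure.restrict_restrict hS, inter_eq_left.2 hsub]
  have hηw : ContDiff ℝ 1 (η * w) := hη.mul hw
  have hg : ContDiff ℝ 1 (w - η * w) := hw.sub hηw
  rw [← jet_sub hb hw hηw, enorm_jet_sq hb hg, add_mul, one_mul, add_assoc]
  have hoff : ∀ x ∈ Ω, x ∉ boundaryStrip Ω ε → w - η * w =ᶠ[𝓝 x] 0 := by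
    intro x hx hxs
    filter_upwards [hηs x hx hxs] with y hy
    simp [hy]
  have hwm : Measurable fun x => ‖w x‖ₑ ^ 2 :=
    ((ENNReal.continuous_pow 2).comp hw.continuous.enorm).measurable
  refine add_le_add (hstrip _ _ (fun x _ => ?_) fun x hx hxs => ?_) ?_
  · gcongr
    rw [← ofReal_norm, ← ofReal_norm]
    refine ENNReal.ofReal_le_ofReal ?_
    have : (w - η * w) x = (1 - η x) * w x := by simp only [Pi.sub_apply, Pi.mul_apply]; ring
    rw [this, norm_mul]
    exact mul_le_of_le_one_left (norm_nonneg _) (hη1 x)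
  · simp [(hoff x hx hxs).self_of_nhds]
  · calc ∫⁻ x in Ω, ‖fderiv ℝ (w - η * w) x‖ₑ ^ 2
        ≤ ∫⁻ x in boundaryStrip Ω ε, (2 * ENNReal.ofReal (3 / ε) ^ 2 * ‖w x‖ₑ ^ 2
            + 2 * ‖fderiv ℝ w x‖ₑ ^ 2) := by
          refine hstrip _ _ (fun x _ => ?_) fun x hx hxs => ?_
          · have hd : fderiv ℝ (w - η * w) x = (1 - η x) • fderiv ℝ w x - w x • fderiv ℝ η x := by
              rw [fderiv_sub (hw.differentiable one_ne_zero x)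
                (hηw.differentiable one_ne_zero x),
                fderiv_mul (hη.differentiable one_ne_zero x) (hw.differentiable one_ne_zero x)]
              module
            have hn : ‖fderiv ℝ (w - η * w) x‖ₑ
                ≤ ENNReal.ofReal (3 / ε) * ‖w x‖ₑ + ‖fderiv ℝ w x‖ₑ := by
              have h3 : 0 ≤ 3 / ε := (norm_nonneg _).trans (hηd x)
              rw [← ofReal_norm, ← ofReal_norm, ← ofReal_norm, ← ENNReal.ofReal_mul h3,
                ← ENNReal.ofReal_add (by positivity) (norm_nonneg _)]
              refine ENNReal.ofReal_le_ofReal ?_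
              rw [hd]
              refine (norm_sub_le _ _).trans ?_
              rw [norm_smul, norm_smul, add_comm, mul_comm ‖w x‖]
              exact add_le_add (mul_le_mul_of_nonneg_right (hηd x) (norm_nonneg _))
                (mul_le_of_le_one_left (norm_nonneg _) (hη1 x))
            calc _ ≤ (ENNReal.ofReal (3 / ε) * ‖w x‖ₑ + ‖fderiv ℝ w x‖ₑ) ^ 2 := by gcongr
              _ ≤ _ := ENNReal.add_sq_le_two_mul _ _
              _ = _ := by ring
          · have hd : fderiv ℝ (w - η * w) x = 0 :=
              (hoff x hx hxs).fderiv_eq.trans (fderiv_const_apply 0)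
            rw [← ofReal_norm, hd, norm_zero, ENNReal.ofReal_zero, zero_pow two_ne_zero]
      _ = _ := by
          rw [lintegral_add_left (hwm.const_mul _), lintegral_const_mul' _ _ (by finiteness),
            lintegral_const_mul' _ _ (by finiteness)]

/-- Along a sequence with `jet Ω w → p`, this replaces the varying gradients by the fixed field
`p.snd`, whose integral over thin strips is small. -/
theorem lintegral_boundaryStrip_fderiv_le (hb : Bornology.IsBounded Ω)
    {w : EuclideanSpace ℝ (Fin n) → ℝ} (hw : ContDiff ℝ 1 w) (p : L2Pair Ω) (ε : ℝ) :
    ∫⁻ x in boundaryStrip Ω ε, ‖fderiv ℝ w x‖ₑ ^ 2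
      ≤ 2 * ‖jet Ω w - p‖ₑ ^ 2 + 2 * ∫⁻ x in boundaryStrip Ω ε, ‖p.snd x‖ₑ ^ 2 := by
  have hle : volume.restrict (boundaryStrip Ω ε) ≤ volume.restrict Ω :=
    Measure.restrict_mono inter_subset_left le_rfl
  have hm : AEMeasurable (fun x => 2 * ‖(jet Ω w - p).snd x‖ₑ ^ 2)
      (volume.restrict (boundaryStrip Ω ε)) :=
    (((Lp.aestronglyMeasurable _).mono_measure hle).enorm.pow_const 2).const_mul 2
  calc ∫⁻ x in boundaryStrip Ω ε, ‖fderiv ℝ w x‖ₑ ^ 2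
      ≤ ∫⁻ x in boundaryStrip Ω ε, (2 * ‖(jet Ω w - p).snd x‖ₑ ^ 2 + 2 * ‖p.snd x‖ₑ ^ 2) := by
        refine lintegral_mono_ae (ae_mono hle ?_)
        filter_upwards [coeFn_jet_snd hb hw, Lp.coeFn_sub (jet Ω w).snd p.snd] with x h1 h2
        have h3 : ‖fderiv ℝ w x‖ₑ ≤ ‖(jet Ω w - p).snd x‖ₑ + ‖p.snd x‖ₑ := by
          rw [WithLp.sub_snd, h2, Pi.sub_apply, h1, ← enorm_gradient]
          calc ‖gradient w x‖ₑ = ‖(gradient w x - p.snd x) + p.snd x‖ₑ := by rw [sub_add_cancel]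
            _ ≤ _ := enorm_add_le _ _
        calc _ ≤ (‖(jet Ω w - p).snd x‖ₑ + ‖p.snd x‖ₑ) ^ 2 := by gcongr
          _ ≤ _ := ENNReal.add_sq_le_two_mul _ _
    _ = 2 * (∫⁻ x in boundaryStrip Ω ε, ‖(jet Ω w - p).snd x‖ₑ ^ 2)
        + 2 * ∫⁻ x in boundaryStrip Ω ε, ‖p.snd x‖ₑ ^ 2 := by
        rw [lintegral_add_left' hm, lintegral_const_mul' _ _ (by finiteness),
          lintegral_const_mul' _ _ (by finiteness)]
    _ ≤ _ := by
        gcongr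
        rw [L2Pair.enorm_sq]
        exact (lintegral_mono' hle le_rfl).trans le_add_self

end ZeroTrace

/-- A limit of `C¹` functions whose boundary values tend to zero belongs to `H¹₀(Ω)`. -/
theorem mem_H10_of_tendsto_jet {m : ℕ} {Ω : Set (EuclideanSpace ℝ (Fin (m + 1)))}
    (hΩ : IsOpen Ω) (hne : Ωᶜ.Nonempty) (hb : Bornology.IsBounded Ω)
    (hbdry : HasPiecewiseC1Boundary Ω) {w : ℕ → EuclideanSpace ℝ (Fin (m + 1)) → ℝ}
    (hw : ∀ k, ContDiff ℝ 1 (w k)) {p : L2Pair Ω}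
    (hp : Tendsto (fun k => jet Ω (w k)) atTop (𝓝 p))
    (h0 : Tendsto (fun k => eLpNorm (w k) 2 (surfaceMeasure Ω)) atTop (𝓝 0)) :
    p ∈ H10 Ω hb := by
  obtain ⟨K, ε₀, hε₀, hest⟩ := exists_strip_estimate hΩ hne hb hbdry
  -- A strip of width `M * ε` contains both the strip of width `ε` and the one of width `K * ε`.
  set M : ℝ := max K 1 with hM
  have hM1 : 1 ≤ M := le_max_right _ _
  set g : ℝ → ℝ≥0∞ := fun ε => ∫⁻ x in boundaryStrip Ω (M * ε), ‖p.snd x‖ₑ ^ 2 with hg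
  set b : ℕ → ℝ≥0∞ := fun k => ∫⁻ y, ‖w k y‖ₑ ^ 2 ∂surfaceMeasure Ω with hbk
  have hb0 : Tendsto b atTop (𝓝 0) := by
    have h1 : ∀ k, b k = eLpNorm (w k) 2 (surfaceMeasure Ω) ^ 2 := fun k =>
      (eLpNorm_two_sq _ _).symm
    have := ((ENNReal.continuous_pow 2).tendsto _).comp h0
    rw [zero_pow two_ne_zero] at this
    exact (funext h1 : b = _) ▸ this
  have he0 : Tendsto (fun k => ‖jet Ω (w k) - p‖ₑ ^ 2) atTop (𝓝 0) := by
    have := ((ENNReal.continuous_pow 2).tendsto _).comp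
      (continuous_enorm.tendsto _ |>.comp (tendsto_sub_nhds_zero_iff.2 hp))
    rw [enorm_zero, zero_pow two_ne_zero] at this
    exact this
  have hmain : ∀ ε, 0 < ε → ε < ε₀ → ε ≤ 1 →
      Metric.infEDist p (H10 Ω hb : Set (L2Pair Ω)) ^ 2 ≤ 2 * ((19 * K + 2) * (2 * g ε)) := by
    intro ε hε hεε₀ hε1
    obtain ⟨η, hη, hη1, hηd, hηs⟩ := exists_cutoff hb hε
    set A : ℝ≥0∞ := (1 + 2 * ENNReal.ofReal (3 / ε) ^ 2) * (K * ENNReal.ofReal ε) with hA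
    have hk : ∀ k, Metric.infEDist p (H10 Ω hb : Set (L2Pair Ω)) ^ 2
        ≤ 2 * ‖jet Ω (w k) - p‖ₑ ^ 2
          + 2 * (A * b k + (19 * K + 2) * (2 * ‖jet Ω (w k) - p‖ₑ ^ 2 + 2 * g ε)) := by
      intro k
      have hmem : jet Ω (η * w k) ∈ H10 Ω hb :=
        jet_mem_H10 hΩ hb (hη.contDiff_one.mul (hw k)) hη.2.1.mul_right
          ((tsupport_mul_subset_left).trans hη.2.2)
      set G := ∫⁻ x in boundaryStrip Ω (M * ε), ‖fderiv ℝ (w k) x‖ₑ ^ 2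
      have hG : G ≤ 2 * ‖jet Ω (w k) - p‖ₑ ^ 2 + 2 * g ε :=
        lintegral_boundaryStrip_fderiv_le hb (hw k) p _
      have h1 : ∫⁻ x in boundaryStrip Ω ε, ‖fderiv ℝ (w k) x‖ₑ ^ 2 ≤ G :=
        lintegral_mono_set (boundaryStrip_mono (le_mul_of_one_le_left hε.le hM1))
      have h2 : ∫⁻ x in boundaryStrip Ω ε, ‖w k x‖ₑ ^ 2
          ≤ K * (ENNReal.ofReal ε * b k + ENNReal.ofReal ε ^ 2 * G) := by
        refine (hest ε hε hεε₀ (w k) (hw k)).trans ?_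
        gcongr
        exact lintegral_mono_set
          (boundaryStrip_mono (mul_le_mul_of_nonneg_right (le_max_left _ _) hε.le))
      -- The squared slope of the cutoff cancels against the factor `ε²` of the strip estimate. This
      -- is where `19 * K = K + 2 * 9 * K` comes from.
      have h3 : ENNReal.ofReal (3 / ε) ^ 2 * ENNReal.ofReal ε ^ 2 = 9 := by
        rw [← mul_pow, ← ENNReal.ofReal_mul (by positivity), div_mul_cancel₀ _ hε.ne',
          ENNReal.ofReal_ofNat]
        norm_num
      have h4 : ENNReal.ofReal ε ^ 2 ≤ 1 := by
        refine pow_le_one₀ zero_le ?_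
        rw [← ENNReal.ofReal_one]
        exact ENNReal.ofReal_le_ofReal hε1
      have h5 : ‖jet Ω (w k) - jet Ω (η * w k)‖ₑ ^ 2 ≤ A * b k + (19 * K + 2) * G := by
        calc ‖jet Ω (w k) - jet Ω (η * w k)‖ₑ ^ 2
            ≤ (1 + 2 * ENNReal.ofReal (3 / ε) ^ 2)
                * (K * (ENNReal.ofReal ε * b k + ENNReal.ofReal ε ^ 2 * G)) + 2 * G :=
              (enorm_jet_sub_jet_mul_sq_le hΩ hb hη.contDiff_one hη1 hηd hηs (hw k)).trans
                (by gcongr)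
          _ = A * b k + (K * G * ENNReal.ofReal ε ^ 2
                + 2 * (K * G) * (ENNReal.ofReal (3 / ε) ^ 2 * ENNReal.ofReal ε ^ 2))
                + 2 * G := by
              rw [hA]; ring
          _ ≤ A * b k + (K * G * 1 + 2 * (K * G) * 9) + 2 * G := by
              rw [h3]
              gcongr
          _ = _ := by ring
      calc Metric.infEDist p (H10 Ω hb : Set (L2Pair Ω)) ^ 2
          ≤ edist p (jet Ω (η * w k)) ^ 2 := by
            gcongr
            exact Metric.infEDist_le_edist_of_mem hmem
        _ ≤ (‖jet Ω (w k) - p‖ₑ + ‖jet Ω (w k) - jet Ω (η * w k)‖ₑ) ^ 2 := by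
            gcongr
            rw [← edist_eq_enorm_sub, ← edist_eq_enorm_sub, edist_comm _ p]
            exact edist_triangle _ _ _
        _ ≤ 2 * ‖jet Ω (w k) - p‖ₑ ^ 2 + 2 * ‖jet Ω (w k) - jet Ω (η * w k)‖ₑ ^ 2 :=
            ENNReal.add_sq_le_two_mul _ _
        _ ≤ _ := by
            gcongr
            refine h5.trans ?_
            gcongr
    have hAtop : A ≠ ⊤ := by
      rw [hA]
      finiteness
    have hKtop : (19 * K + 2 : ℝ≥0∞) ≠ ⊤ := by finiteness
    -- The order of limits matters: for fixed `ε` the boundary term `A * b k` tends to zero,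
    -- although `A` carries a factor `ε⁻²`. Only then is `ε` sent to zero.
    have hlim : Tendsto (fun k => 2 * ‖jet Ω (w k) - p‖ₑ ^ 2
          + 2 * (A * b k + (19 * K + 2) * (2 * ‖jet Ω (w k) - p‖ₑ ^ 2 + 2 * g ε))) atTop
        (𝓝 (2 * 0 + 2 * (A * 0 + (19 * K + 2) * (2 * 0 + 2 * g ε)))) := by
      have t1 := ENNReal.Tendsto.const_mul (a := 2) he0 (Or.inr (by finiteness))
      have t2 := ENNReal.Tendsto.const_mul (a := A) hb0 (Or.inr hAtop)
      have t3 := ENNReal.Tendsto.const_mul (t1.add (tendsto_const_nhds (x := 2 * g ε)))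
        (Or.inr hKtop)
      exact t1.add (ENNReal.Tendsto.const_mul (t2.add t3) (Or.inr (by finiteness)))
    simpa using ge_of_tendsto' hlim hk
  -- The remaining term is the integral of a fixed integrable function over strips whose measure
  -- tends to zero.
  have hglim : Tendsto (fun j : ℕ => g (1 / ((j : ℝ) + 1) / M)) atTop (𝓝 0) := by
    have hfin : ∫⁻ x in Ω, ‖p.snd x‖ₑ ^ 2 ≠ ⊤ := by
      have h1 : ‖p‖ₑ ^ 2 ≠ ⊤ := by finiteness
      rw [L2Pair.enorm_sq] at h1
      exact (ENNReal.add_ne_top.1 h1).2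
    have hvol : Tendsto (fun j : ℕ => (volume.restrict Ω)
        (boundaryStrip Ω (1 / ((j : ℝ) + 1)))) atTop (𝓝 0) :=
      tendsto_of_tendsto_of_tendsto_of_le_of_le tendsto_const_nhds
        (tendsto_volume_boundaryStrip hΩ hne hb) (fun _ => zero_le)
        fun j => Measure.restrict_apply_le _ _
    have := tendsto_setLIntegral_zero hfin hvol
    refine this.congr fun j => ?_
    simp only [hg]
    have hsub : boundaryStrip Ω (1 / ((j : ℝ) + 1)) ⊆ Ω := inter_subset_left
    rw [mul_div_cancel₀ _ (by positivity : M ≠ 0),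
      Measure.restrict_restrict (measurableSet_boundaryStrip hΩ _), inter_eq_left.2 hsub]
  have hεlim : Tendsto (fun j : ℕ => 1 / ((j : ℝ) + 1) / M) atTop (𝓝 0) := by
    simpa using (tendsto_one_div_add_atTop_nhds_zero_nat (𝕜 := ℝ)).div_const M
  have hzero : Metric.infEDist p (H10 Ω hb : Set (L2Pair Ω)) ^ 2 ≤ 0 := by
    have hKtop : (19 * K + 2 : ℝ≥0∞) ≠ ⊤ := by finiteness
    have hlim := ENNReal.Tendsto.const_mul (a := 2) (ENNReal.Tendsto.const_mul
      (a := 19 * (K : ℝ≥0∞) + 2)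
      (ENNReal.Tendsto.const_mul (a := 2) hglim (Or.inr (by finiteness)))
      (Or.inr hKtop)) (Or.inr (by finiteness))
    rw [mul_zero, mul_zero, mul_zero] at hlim
    refine ge_of_tendsto hlim ?_
    filter_upwards [hεlim.eventually_lt_const hε₀, hεlim.eventually_lt_const one_pos]
      with j h1 h2
    exact hmain _ (by positivity) h1 h2.le
  refine (Metric.mem_iff_infEDist_zero_of_closed (isClosed_H10 hb)).2 ?_
  exact pow_eq_zero_iff two_ne_zero |>.1 (le_antisymm hzero zero_le)

/-! ### The chain rule -/

theorem tendsto_eLpNorm_two_zero_of_dominated {X F G : Type*} [MeasurableSpace X] {μ : Measure X}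
    [NormedAddCommGroup F] [NormedAddCommGroup G] {h : ℕ → X → F} {g : X → G}
    (hh : ∀ k, AEStronglyMeasurable (h k) μ) (hg : MemLp g 2 μ) {C : ℝ}
    (hb : ∀ k, ∀ᵐ x ∂μ, ‖h k x‖ ≤ C * ‖g x‖)
    (hlim : ∀ᵐ x ∂μ, Tendsto (fun k => h k x) atTop (𝓝 0)) :
    Tendsto (fun k => eLpNorm (h k) 2 μ) atTop (𝓝 0) := by
  have hmul : MemLp (fun x => C * ‖g x‖) 2 μ := hg.norm.const_mul C
  have h1 : Tendsto (fun k => ∫⁻ x, ‖h k x‖ₑ ^ 2 ∂μ) atTop (𝓝 (∫⁻ _, 0 ∂μ)) := by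
    refine tendsto_lintegral_of_dominated_convergence' (fun x => ‖C * ‖g x‖‖ₑ ^ 2)
      (fun k => (hh k).enorm.pow_const 2) (fun k => ?_) ?_ ?_
    · filter_upwards [hb k] with x hx
      gcongr
      rw [← ofReal_norm, ← ofReal_norm]
      exact ENNReal.ofReal_le_ofReal (hx.trans (Real.le_norm_self _))
    · rw [← eLpNorm_two_sq]
      exact ENNReal.pow_ne_top hmul.eLpNorm_ne_top
    · filter_upwards [hlim] with x hx
      have := ((ENNReal.continuous_pow 2).tendsto _).comp ((continuous_enorm.tendsto _).comp hx)
      rw [enorm_zero, zero_pow two_ne_zero] at this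
      exact this
  rw [lintegral_zero] at h1
  have h2 := ((ENNReal.continuous_rpow_const (y := (1 / 2 : ℝ))).tendsto 0).comp h1
  rw [ENNReal.zero_rpow_of_pos (by norm_num)] at h2
  refine h2.congr fun k => ?_
  rw [Function.comp_apply, ← eLpNorm_two_sq, ← ENNReal.rpow_natCast, ← ENNReal.rpow_mul]
  norm_num

section ChainRule

variable {n : ℕ} {Ω : Set (EuclideanSpace ℝ (Fin n))}

theorem contDiff_one_of_hasDerivAt {A A' : ℝ → ℝ} (hA : ∀ t, HasDerivAt A (A' t) t)
    (hc : Continuous A') : ContDiff ℝ 1 A := by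
  rw [contDiff_one_iff_deriv]
  refine ⟨fun t => (hA t).differentiableAt, ?_⟩
  rwa [(funext fun t => (hA t).deriv : deriv A = A')]

theorem norm_sub_le_of_hasDerivAt {A A' : ℝ → ℝ} (hA : ∀ t, HasDerivAt A (A' t) t) {M : ℝ}
    (hM : ∀ t, ‖A' t‖ ≤ M) (s t : ℝ) : ‖A s - A t‖ ≤ M * ‖s - t‖ :=
  convex_univ.norm_image_sub_le_of_norm_hasDerivWithin_le
    (fun t _ => (hA t).hasDerivWithinAt) (fun t _ => hM t) (mem_univ t) (mem_univ s)

/-- The chain rule for limits of `C¹` functions. -/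
theorem exists_jet_comp_tendsto (hb : Bornology.IsBounded Ω) {A A' : ℝ → ℝ}
    (hA : ∀ t, HasDerivAt A (A' t) t) (hc : Continuous A') {M : ℝ} (hM : ∀ t, ‖A' t‖ ≤ M)
    (hA0 : A 0 = 0) {f : ℕ → EuclideanSpace ℝ (Fin n) → ℝ} (hf : ∀ k, ContDiff ℝ 1 (f k))
    {p : L2Pair Ω} (hp : Tendsto (fun k => jet Ω (f k)) atTop (𝓝 p)) :
    ∃ q : L2Pair Ω, (∀ᵐ x ∂volume.restrict Ω, q.fst x = A (p.fst x)) ∧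
      (∀ᵐ x ∂volume.restrict Ω, q.snd x = A' (p.fst x) • p.snd x) ∧
      ∃ s : ℕ → ℕ, StrictMono s ∧ Tendsto (fun k => jet Ω (A ∘ f (s k))) atTop (𝓝 q) := by
  have hAC := contDiff_one_of_hasDerivAt hA hc
  obtain ⟨h1, h2⟩ := (tendsto_jet_iff hb hf).1 hp
  have hM0 : 0 ≤ M := (norm_nonneg _).trans (hM 0)
  -- Since `A'` is merely continuous, `A' ∘ f k` is controlled only through pointwise convergence,
  -- which `L²` convergence provides along a subsequence.
  have hmeas := tendstoInMeasure_of_tendsto_eLpNorm (p := 2) two_ne_zero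
    (fun k => (memLp_of_continuous hb (hf k).continuous 2).aestronglyMeasurable)
    (Lp.aestronglyMeasurable p.fst) h1
  obtain ⟨s, hs, hae⟩ := hmeas.exists_seq_tendsto_ae
  have m1 : MemLp (fun x => A (p.fst x)) 2 (volume.restrict Ω) := by
    refine (Lp.memLp p.fst).of_le_mul (c := M)
      (hAC.continuous.comp_aestronglyMeasurable (Lp.aestronglyMeasurable p.fst))
      (Eventually.of_forall fun x => ?_)
    simpa [hA0] using norm_sub_le_of_hasDerivAt hA hM (p.fst x) 0
  have m2 : MemLp (fun x => A' (p.fst x) • p.snd x) 2 (volume.restrict Ω) := by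
    refine (Lp.memLp p.snd).of_le_mul (c := M)
      ((hc.comp_aestronglyMeasurable (Lp.aestronglyMeasurable p.fst)).smul
        (Lp.aestronglyMeasurable p.snd)) (Eventually.of_forall fun x => ?_)
    rw [norm_smul]
    exact mul_le_mul_of_nonneg_right (hM _) (norm_nonneg _)
  have hbound : ∀ {F F' : Type} [NormedAddCommGroup F] [NormedAddCommGroup F']
      {g : ℕ → EuclideanSpace ℝ (Fin n) → F} {g' : ℕ → EuclideanSpace ℝ (Fin n) → F'},
      (∀ k, ∀ᵐ x ∂volume.restrict Ω, ‖g k x‖ ≤ M * ‖g' k x‖) →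
      Tendsto (fun k => eLpNorm (g' k) 2 (volume.restrict Ω)) atTop (𝓝 0) →
      Tendsto (fun k => eLpNorm (g k) 2 (volume.restrict Ω)) atTop (𝓝 0) := by
    intro F F' _ _ g g' hle hlim
    have h0 := ENNReal.Tendsto.const_mul (a := ENNReal.ofReal M) hlim
      (Or.inr ENNReal.ofReal_ne_top)
    rw [mul_zero] at h0
    exact tendsto_of_tendsto_of_tendsto_of_le_of_le tendsto_const_nhds h0 (fun _ => zero_le)
      fun k => eLpNorm_le_mul_eLpNorm_of_ae_le_mul (hle k) 2
  refine ⟨WithLp.toLp 2 (m1.toLp _, m2.toLp _), m1.coeFn_toLp, m2.coeFn_toLp, s, hs, ?_⟩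
  refine (tendsto_jet_iff hb fun k => hAC.comp (hf (s k))).2 ⟨?_, ?_⟩
  · refine hbound (g' := fun k x => f (s k) x - p.fst x) (fun k => ?_)
      (h1.comp hs.tendsto_atTop)
    filter_upwards [m1.coeFn_toLp] with x hx
    rw [WithLp.toLp_fst, hx]
    exact norm_sub_le_of_hasDerivAt hA hM _ _
  -- The error splits as `A'(f)(∇f - p.snd) + (A'(f) - A'(p.fst)) p.snd`. The first term is small
  -- because `A'` is bounded, the second by dominated convergence.
  · have t1 : Tendsto (fun k => eLpNorm
        (fun x => A' (f (s k) x) • (gradient (f (s k)) x - p.snd x)) 2 (volume.restrict Ω))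
        atTop (𝓝 0) := by
      refine hbound (g' := fun k x => gradient (f (s k)) x - p.snd x)
        (fun k => Eventually.of_forall fun x => ?_) (h2.comp hs.tendsto_atTop)
      rw [norm_smul]
      exact mul_le_mul_of_nonneg_right (hM _) (norm_nonneg _)
    have hfm : ∀ k, AEStronglyMeasurable (fun x => A' (f (s k) x)) (volume.restrict Ω) := fun k =>
      (hc.comp (hf (s k)).continuous).aestronglyMeasurable
    have hum : AEStronglyMeasurable (fun x => A' (p.fst x)) (volume.restrict Ω) :=
      hc.comp_aestronglyMeasurable (Lp.aestronglyMeasurable p.fst)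
    have t2 : Tendsto (fun k => eLpNorm
        (fun x => (A' (f (s k) x) - A' (p.fst x)) • p.snd x) 2 (volume.restrict Ω))
        atTop (𝓝 0) := by
      refine tendsto_eLpNorm_two_zero_of_dominated
        (fun k => ((hfm k).sub hum).smul (Lp.aestronglyMeasurable p.snd)) (Lp.memLp p.snd)
        (C := 2 * M) (fun k => Eventually.of_forall fun x => ?_) ?_
      · rw [norm_smul]
        refine mul_le_mul_of_nonneg_right ((norm_sub_le _ _).trans ?_) (norm_nonneg _)
        linarith [hM (f (s k) x), hM (p.fst x)]
      · filter_upwards [hae] with x hx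
        have := ((hc.tendsto _).comp hx).sub_const (A' (p.fst x))
        rw [sub_self] at this
        simpa using this.smul_const (p.snd x)
    have t12 := t1.add t2
    rw [add_zero] at t12
    refine tendsto_of_tendsto_of_tendsto_of_le_of_le tendsto_const_nhds t12 (fun _ => zero_le)
      fun k => ?_
    refine (le_of_eq (eLpNorm_congr_ae ?_)).trans (eLpNorm_add_le
      ((hfm k).smul ((continuous_gradient (hf (s k))).aestronglyMeasurable.sub
        (Lp.aestronglyMeasurable p.snd)))
      (((hfm k).sub hum).smul (Lp.aestronglyMeasurable p.snd)) one_le_two)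
    filter_upwards [m2.coeFn_toLp] with x hx
    rw [WithLp.toLp_snd, hx, gradient_comp hA (hf (s k))]
    simp only [Pi.add_apply, smul_sub, sub_smul]
    abel

end ChainRule

/-! ### The Poincaré inequality -/

/-- For a unit vector `v` the linear function `L = ⟨v, ·⟩` has `∂ᵥL = 1` and is bounded by `R` on
the support. Integration by parts gives `∫ φ² = -∫ 2 L φ ∂ᵥφ`, and Young's inequality absorbs half
of `∫ φ²`. -/
theorem integral_sq_le_mul_integral_fderiv_sq {m : ℕ}
    {φ : EuclideanSpace ℝ (Fin (m + 1)) → ℝ} (hφ : ContDiff ℝ 1 φ) (hc : HasCompactSupport φ)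
    {R : ℝ} (hR : ∀ x ∈ Function.support φ, ‖x‖ ≤ R) :
    ∫ x, φ x ^ 2 ≤ 4 * R ^ 2 * ∫ x, ‖fderiv ℝ φ x‖ ^ 2 := by
  obtain ⟨v, hv⟩ : ∃ v : EuclideanSpace ℝ (Fin (m + 1)), ‖v‖ = 1 :=
    ⟨EuclideanSpace.single 0 1, by simp⟩
  obtain ⟨L, hLv, hLx⟩ : ∃ L : EuclideanSpace ℝ (Fin (m + 1)) →L[ℝ] ℝ,
      L v = 1 ∧ ∀ x, |L x| ≤ ‖x‖ := by
    refine ⟨innerSL ℝ v, ?_, fun x => ?_⟩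
    · rw [innerSL_apply_apply, real_inner_self_eq_norm_sq, hv, one_pow]
    · have := abs_real_inner_le_norm v x
      rwa [hv, one_mul] at this
  have hcont := hφ.continuous
  have hc' : Continuous (fderiv ℝ φ) := hφ.continuous_fderiv one_ne_zero
  have hcv : Continuous fun x => fderiv ℝ φ x v := hc'.clm_apply continuous_const
  have hsqd : ∀ x, HasFDerivAt (fun x => φ x ^ 2) ((2 * φ x) • fderiv ℝ φ x) x := fun x => by
    have := (hφ.differentiable one_ne_zero x).hasFDerivAt.pow 2
    simpa using this
  have hsqv : ∀ x, fderiv ℝ (fun x => φ x ^ 2) x v = 2 * φ x * fderiv ℝ φ x v := fun x => by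
    rw [(hsqd x).fderiv]
    rfl
  have hLd : ∀ x, fderiv ℝ L x v = 1 := fun x => by rw [L.fderiv, hLv]
  have hcs : HasCompactSupport fun x => φ x ^ 2 :=
    hc.comp_left (g := fun t : ℝ => t ^ 2) (by simp)
  have i1 : Integrable fun x => φ x ^ 2 :=
    (hcont.pow 2).integrable_of_hasCompactSupport hcs
  have hcs2 : HasCompactSupport fun x => ‖fderiv ℝ φ x‖ ^ 2 :=
    (hc.fderiv (𝕜 := ℝ)).mono fun x hx h =>
      hx (by simp only; rw [h, norm_zero, zero_pow two_ne_zero])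
  have hcs3 : HasCompactSupport fun x => L x * (2 * φ x * fderiv ℝ φ x v) :=
    hc.mono fun x hx h => hx (by simp only; rw [h, mul_zero, zero_mul, mul_zero])
  have i2 : Integrable fun x => ‖fderiv ℝ φ x‖ ^ 2 :=
    (hc'.norm.pow 2).integrable_of_hasCompactSupport hcs2
  have i3 : Integrable fun x => L x * (2 * φ x * fderiv ℝ φ x v) :=
    (L.continuous.mul ((continuous_const.mul hcont).mul
      hcv)).integrable_of_hasCompactSupport hcs3
  have hibp := integral_mul_fderiv_eq_neg_fderiv_mul_of_integrable (μ := volume)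
    (f := fun x => L x) (g := fun x => φ x ^ 2) (v := v)
    (by
      simp only [hLd, one_mul]
      exact i1)
    (by
      simp only [hsqv]
      exact i3)
    ((L.continuous.mul (hcont.pow 2)).integrable_of_hasCompactSupport hcs.mul_left)
    (fun x _ => L.differentiableAt) (fun x _ => (hsqd x).differentiableAt)
  simp only [hLd, one_mul, hsqv] at hibp
  have hle : ∫ x, φ x ^ 2 ≤ ∫ x, (1 / 2 * φ x ^ 2 + 2 * R ^ 2 * ‖fderiv ℝ φ x‖ ^ 2) := by
    calc ∫ x, φ x ^ 2 = ∫ x, -(L x * (2 * φ x * fderiv ℝ φ x v)) := by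
          rw [integral_neg, hibp, neg_neg]
      _ ≤ ∫ x, (1 / 2 * φ x ^ 2 + 2 * R ^ 2 * ‖fderiv ℝ φ x‖ ^ 2) := by
          refine integral_mono i3.neg ((i1.const_mul _).add (i2.const_mul _)) fun x => ?_
          by_cases hx : φ x = 0
          · simp only [hx, mul_zero, zero_mul, neg_zero, ne_eq, OfNat.ofNat_ne_zero,
              not_false_eq_true, zero_pow, zero_add]
            positivity
          have h1 : |L x| ≤ R := (hLx x).trans (hR x hx)
          have h2 : |fderiv ℝ φ x v| ≤ ‖fderiv ℝ φ x‖ := by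
            have := (fderiv ℝ φ x).le_opNorm v
            rwa [hv, mul_one] at this
          have h3 : -(L x * (2 * φ x * fderiv ℝ φ x v)) ≤ R * (2 * |φ x| * ‖fderiv ℝ φ x‖) := by
            refine (neg_le_abs _).trans ?_
            rw [abs_mul, abs_mul, abs_mul, abs_two]
            have hR0 : 0 ≤ R := (abs_nonneg _).trans h1
            gcongr
          have h4 : |φ x| ^ 2 = φ x ^ 2 := sq_abs _
          simp only
          nlinarith [sq_nonneg (|φ x| - 2 * R * ‖fderiv ℝ φ x‖)]
  rw [integral_add (i1.const_mul _) (i2.const_mul _), integral_const_mul,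
    integral_const_mul] at hle
  linarith

/-- The Poincaré inequality on `H¹₀(Ω)`. -/
theorem exists_poincare {m : ℕ} {Ω : Set (EuclideanSpace ℝ (Fin (m + 1)))}
    (hb : Bornology.IsBounded Ω) :
    ∃ κ > 0, ∀ p ∈ H10 Ω hb, κ * ‖p‖ ^ 2 ≤ ‖p.snd‖ ^ 2 := by
  obtain ⟨R, hR⟩ := hb.exists_norm_le
  have hnorm : ∀ {F : Type} [NormedAddCommGroup F] [InnerProductSpace ℝ F]
      (f : Lp F 2 (volume.restrict Ω)), ‖f‖ ^ 2 = ∫ x in Ω, ‖f x‖ ^ 2 := by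
    intro F _ _ f
    rw [← real_inner_self_eq_norm_sq, L2.inner_def]
    simp_rw [real_inner_self_eq_norm_sq]
  have hκ : ∀ p ∈ H10 Ω hb, ‖p.fst‖ ^ 2 ≤ 4 * R ^ 2 * ‖p.snd‖ ^ 2 := by
    intro p hp
    refine H10_induction (P := fun p => ‖p.fst‖ ^ 2 ≤ 4 * R ^ 2 * ‖p.snd‖ ^ 2) ?_ ?_ hp
    · refine isClosed_le ((WithLp.continuous_fst _ _ _).norm.pow 2)
        (continuous_const.mul ((WithLp.continuous_snd _ _ _).norm.pow 2))
    intro φ hφ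
    have hφ1 := hφ.contDiff_one
    have e1 : ‖(jet Ω φ).fst‖ ^ 2 = ∫ x, φ x ^ 2 := by
      rw [hnorm, ← setIntegral_eq_integral_of_tsupport_subset (Ω := Ω)]
      · refine integral_congr_ae ?_
        filter_upwards [coeFn_jet_fst hb hφ1] with x hx
        rw [hx, Real.norm_eq_abs, sq_abs]
      · refine (closure_mono fun x hx => ?_).trans hφ.2.2
        rw [Function.mem_support] at hx ⊢
        intro h
        exact hx (by simp [h])
    have e2 : ‖(jet Ω φ).snd‖ ^ 2 = ∫ x, ‖fderiv ℝ φ x‖ ^ 2 := by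
      rw [hnorm, ← setIntegral_eq_integral_of_tsupport_subset (Ω := Ω)]
      · refine integral_congr_ae ?_
        filter_upwards [coeFn_jet_snd hb hφ1] with x hx
        rw [hx, norm_gradient]
      · refine (closure_mono fun x hx => ?_).trans
          ((tsupport_fderiv_subset ℝ (f := φ)).trans hφ.2.2)
        rw [Function.mem_support] at hx ⊢
        intro h
        exact hx (by simp [h])
    rw [e1, e2]
    exact integral_sq_le_mul_integral_fderiv_sq hφ1 hφ.2.1 fun x hx =>
      hR x (hφ.2.2 (subset_tsupport φ hx))
  refine ⟨1 / (1 + 4 * R ^ 2), by positivity, fun p hp => ?_⟩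
  rw [WithLp.prod_norm_sq_eq_of_L2, div_mul_eq_mul_div, one_mul, div_le_iff₀ (by positivity)]
  linarith [hκ p hp]

/-! ### Monotone equations and the Kirchhoff transform -/

/-- Zarantonello's theorem: a strongly monotone Lipschitz equation is solvable on a closed
subspace of a Hilbert space. -/
theorem exists_forall_inner_eq_zero {H : Type*} [NormedAddCommGroup H] [InnerProductSpace ℝ H]
    (S : Submodule ℝ H) [CompleteSpace S] (T : S → H) {κ L : ℝ} (hκ : 0 < κ)
    (hL : ∀ x y, ‖T x - T y‖ ≤ L * ‖x - y‖)
    (hT : ∀ x y, κ * ‖x - y‖ ^ 2 ≤ inner ℝ (T x - T y) ((x - y : S) : H)) :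
    ∃ z : S, ∀ q ∈ S, inner ℝ (T z) q = 0 := by
  -- Taking `B ≥ κ` keeps the contraction factor `ρ` nonnegative. The step `τ = κ / B ^ 2` minimizes
  -- `1 - 2τκ + τ²B²`, with minimum `ρ = 1 - κ² / B²`.
  set B := max L κ with hB
  have hB0 : 0 < B := hκ.trans_le (le_max_right _ _)
  set τ := κ / B ^ 2 with hτ
  have hτ0 : 0 < τ := by positivity
  set ρ := 1 - κ ^ 2 / B ^ 2 with hρ
  have hρ0 : 0 ≤ ρ := by
    have : κ ^ 2 / B ^ 2 ≤ 1 := by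
      rw [div_le_one (by positivity)]
      gcongr
      exact le_max_right _ _
    linarith
  have hρ1 : ρ < 1 := by
    have : 0 < κ ^ 2 / B ^ 2 := by positivity
    linarith
  let G : S → S := fun x => x - τ • S.orthogonalProjectionOnto (T x)
  have hG : ∀ x y, ‖G x - G y‖ ^ 2 ≤ ρ * ‖x - y‖ ^ 2 := by
    intro x y
    have e : G x - G y = (x - y) - τ • S.orthogonalProjectionOnto (T x - T y) := by
      simp only [G, map_sub]
      module
    have h1 : ‖S.orthogonalProjectionOnto (T x - T y)‖ ≤ B * ‖x - y‖ :=
      (S.norm_orthogonalProjectionOnto_apply_le _).trans ((hL x y).trans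
        (mul_le_mul_of_nonneg_right (le_max_left _ _) (norm_nonneg _)))
    have h2 : inner ℝ (x - y) (τ • S.orthogonalProjectionOnto (T x - T y))
        = τ * inner ℝ (T x - T y) ((x - y : S) : H) := by
      rw [inner_smul_right, real_inner_comm]
      congr 1
      exact S.inner_orthogonalProjectionOnto_eq_of_mem_right _ _
    rw [e, norm_sub_sq_real, h2, norm_smul, Real.norm_of_nonneg hτ0.le, mul_pow]
    have h3 : ‖S.orthogonalProjectionOnto (T x - T y)‖ ^ 2 ≤ B ^ 2 * ‖x - y‖ ^ 2 := by
      rw [← mul_pow]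
      gcongr
    have h4 : τ * (κ * ‖x - y‖ ^ 2) ≤ τ * inner ℝ (T x - T y) ((x - y : S) : H) :=
      mul_le_mul_of_nonneg_left (hT x y) hτ0.le
    have h5 : τ ^ 2 * ‖S.orthogonalProjectionOnto (T x - T y)‖ ^ 2
        ≤ τ ^ 2 * (B ^ 2 * ‖x - y‖ ^ 2) := by gcongr
    have h6 : τ ^ 2 * (B ^ 2 * ‖x - y‖ ^ 2) = κ ^ 2 / B ^ 2 * ‖x - y‖ ^ 2 := by
      rw [hτ]; field_simp
    have h7 : τ * (κ * ‖x - y‖ ^ 2) = κ ^ 2 / B ^ 2 * ‖x - y‖ ^ 2 := by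
      rw [hτ]; field_simp
    rw [hρ]
    linarith
  have hcontr : ContractingWith (Real.toNNReal (Real.sqrt ρ)) G := by
    refine ⟨?_, LipschitzWith.of_dist_le_mul fun x y => ?_⟩
    · rw [Real.toNNReal_lt_one, Real.sqrt_lt' one_pos]
      simpa using hρ1
    · rw [Real.coe_toNNReal _ (Real.sqrt_nonneg _), dist_eq_norm, dist_eq_norm]
      refine abs_le_of_sq_le_sq' ?_ (by positivity) |>.2
      rw [mul_pow, Real.sq_sqrt hρ0]
      exact hG x y
  refine ⟨hcontr.fixedPoint G, fun q hq => ?_⟩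
  set z := hcontr.fixedPoint G
  have hz : z - τ • S.orthogonalProjectionOnto (T z) = z := hcontr.fixedPoint_isFixedPt
  have hz2 : S.orthogonalProjectionOnto (T z) = 0 := by
    rw [sub_eq_self] at hz
    exact (smul_eq_zero.1 hz).resolve_left hτ0.ne'
  have := S.inner_orthogonalProjectionOnto_eq_of_mem_right ⟨q, hq⟩ (T z)
  rw [hz2, inner_zero_left] at this
  exact this.symm

/-- The Kirchhoff transform `A = ∫ a` together with its inverse `b`. -/
theorem exists_kirchhoff_transform {a : ℝ → ℝ} (ha : Continuous a) {α : ℝ} (hα : 0 < α)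
    (hlow : ∀ t, α ≤ a t) :
    ∃ A b : ℝ → ℝ, (∀ t, HasDerivAt A (a t) t) ∧ (∀ t, HasDerivAt b (a (b t))⁻¹ t) ∧
      Continuous b ∧ A 0 = 0 ∧ b 0 = 0 ∧ (∀ t, b (A t) = t) ∧ ∀ t, A (b t) = t := by
  set A : ℝ → ℝ := fun t => ∫ s in (0 : ℝ)..t, a s with hA
  have hpos : ∀ t, 0 < a t := fun t => hα.trans_le (hlow t)
  have hd : ∀ t, HasDerivAt A (a t) t := fun t => (ha.integral_hasStrictDerivAt 0 t).hasDerivAt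
  have hcont : Continuous A := continuous_iff_continuousAt.2 fun t => (hd t).continuousAt
  have hmono : StrictMono A := strictMono_of_deriv_pos fun t => by rw [(hd t).deriv]; exact hpos t
  -- The lower bound `a ≥ α` makes `A` grow at least linearly in both directions, hence surjective.
  have htop : Tendsto A atTop atTop := by
    refine tendsto_atTop_mono' _ ?_ (tendsto_id.const_mul_atTop hα)
    filter_upwards [eventually_ge_atTop 0] with t ht
    calc α * t = ∫ _ in (0 : ℝ)..t, α := by simp [mul_comm]
      _ ≤ A t := intervalIntegral.integral_mono_on ht (by simp) (ha.intervalIntegrable _ _)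
          fun s _ => hlow s
  have hbot : Tendsto A atBot atBot := by
    refine tendsto_atBot_mono' _ ?_ (tendsto_id.const_mul_atBot hα)
    filter_upwards [eventually_le_atBot 0] with t ht
    have h : ∫ _ in t..(0 : ℝ), α ≤ ∫ s in t..(0 : ℝ), a s :=
      intervalIntegral.integral_mono_on ht (by simp) (ha.intervalIntegrable _ _) fun s _ => hlow s
    rw [intervalIntegral.integral_const, zero_sub, smul_eq_mul] at h
    simp only [hA]
    rw [intervalIntegral.integral_symm]
    simp only [id]
    linarith
  have hsurj : Function.Surjective A := hcont.surjective htop hbot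
  set e := hmono.orderIsoOfSurjective A hsurj with he
  have hAe : ∀ t, A (e.symm t) = t := fun t => e.apply_symm_apply t
  have heA : ∀ t, e.symm (A t) = t := fun t => e.symm_apply_apply t
  have hA0 : A 0 = 0 := by simp [hA]
  refine ⟨A, e.symm, hd, fun t => ?_, e.symm.continuous, hA0, ?_, heA, hAe⟩
  · exact HasDerivAt.of_local_left_inverse e.symm.continuous.continuousAt (hd _) (hpos _).ne'
      (Eventually.of_forall hAe)
  · exact (congrArg e.symm hA0.symm).trans (heA 0)

section Dimension

variable {n : ℕ} [NeZero n] {Ω : Set (EuclideanSpace ℝ (Fin n))}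

theorem exists_poincare_of_neZero (hb : Bornology.IsBounded Ω) :
    ∃ κ > 0, ∀ p ∈ H10 Ω hb, κ * ‖p‖ ^ 2 ≤ ‖p.snd‖ ^ 2 := by
  obtain ⟨m, rfl⟩ := Nat.exists_eq_succ_of_ne_zero (NeZero.ne n)
  exact exists_poincare hb

theorem mem_H10_of_tendsto_jet_of_neZero (hΩ : IsOpen Ω) (hne : Ωᶜ.Nonempty)
    (hb : Bornology.IsBounded Ω) (hbdry : HasPiecewiseC1Boundary Ω)
    {w : ℕ → EuclideanSpace ℝ (Fin n) → ℝ} (hw : ∀ k, ContDiff ℝ 1 (w k)) {p : L2Pair Ω}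
    (hp : Tendsto (fun k => jet Ω (w k)) atTop (𝓝 p))
    (h0 : Tendsto (fun k => eLpNorm (w k) 2 (surfaceMeasure Ω)) atTop (𝓝 0)) :
    p ∈ H10 Ω hb := by
  obtain ⟨m, rfl⟩ := Nat.exists_eq_succ_of_ne_zero (NeZero.ne n)
  exact mem_H10_of_tendsto_jet hΩ hne hb hbdry hw hp h0

end Dimension

/-! ### The weak formulation as an orthogonality relation -/

section Multiplier

variable {n : ℕ} {Ω : Set (EuclideanSpace ℝ (Fin n))}

theorem L2Pair.norm_le_mul_norm {p q : L2Pair Ω} {M : ℝ} (hM : 0 ≤ M)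
    (h1 : ∀ᵐ x ∂volume.restrict Ω, ‖p.fst x‖ ≤ M * ‖q.fst x‖)
    (h2 : ∀ᵐ x ∂volume.restrict Ω, ‖p.snd x‖ ≤ M * ‖q.snd x‖) : ‖p‖ ≤ M * ‖q‖ := by
  have e1 := Lp.norm_le_mul_norm_of_ae_le_mul h1
  have e2 := Lp.norm_le_mul_norm_of_ae_le_mul h2
  refine abs_le_of_sq_le_sq' ?_ (by positivity) |>.2
  rw [mul_pow, WithLp.prod_norm_sq_eq_of_L2, WithLp.prod_norm_sq_eq_of_L2, mul_add, ← mul_pow,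
    ← mul_pow]
  gcongr

/-- With `σ = a(u)` this supplies the pair `(c u, a(u)∇u)`, whose inner products express the weak
equation. -/
theorem exists_multiplier {c σ : EuclideanSpace ℝ (Fin n) → ℝ}
    (hc : AEStronglyMeasurable c (volume.restrict Ω))
    (hσ : AEStronglyMeasurable σ (volume.restrict Ω)) {M : ℝ}
    (hcM : ∀ᵐ x ∂volume.restrict Ω, ‖c x‖ ≤ M) (hσM : ∀ᵐ x ∂volume.restrict Ω, ‖σ x‖ ≤ M)
    (p : L2Pair Ω) :
    ∃ P : L2Pair Ω, (∀ᵐ x ∂volume.restrict Ω, P.fst x = c x * p.fst x) ∧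
      ∀ᵐ x ∂volume.restrict Ω, P.snd x = σ x • p.snd x := by
  have m1 : MemLp (fun x => c x * p.fst x) 2 (volume.restrict Ω) := by
    refine (Lp.memLp p.fst).of_le_mul (c := M) (hc.mul (Lp.aestronglyMeasurable _)) ?_
    filter_upwards [hcM] with x hx
    rw [norm_mul]
    exact mul_le_mul_of_nonneg_right hx (norm_nonneg _)
  have m2 : MemLp (fun x => σ x • p.snd x) 2 (volume.restrict Ω) := by
    refine (Lp.memLp p.snd).of_le_mul (c := M) (hσ.smul (Lp.aestronglyMeasurable _)) ?_
    filter_upwards [hσM] with x hx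
    rw [norm_smul]
    exact mul_le_mul_of_nonneg_right hx (norm_nonneg _)
  exact ⟨WithLp.toLp 2 (m1.toLp _, m2.toLp _), m1.coeFn_toLp, m2.coeFn_toLp⟩

theorem coeFn_sub_fst (p q : L2Pair Ω) :
    ∀ᵐ x ∂volume.restrict Ω, (p - q).fst x = p.fst x - q.fst x := by
  rw [WithLp.sub_fst]
  exact Lp.coeFn_sub _ _

theorem coeFn_sub_snd (p q : L2Pair Ω) :
    ∀ᵐ x ∂volume.restrict Ω, (p - q).snd x = p.snd x - q.snd x := by
  rw [WithLp.sub_snd]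
  exact Lp.coeFn_sub _ _

/-- Lower bound for the inner product from a pointwise lower bound. -/
theorem mul_norm_snd_sq_le_inner {P p : L2Pair Ω} {α : ℝ}
    (h1 : ∀ᵐ x ∂volume.restrict Ω, 0 ≤ P.fst x * p.fst x)
    (h2 : ∀ᵐ x ∂volume.restrict Ω, α * ‖p.snd x‖ ^ 2 ≤ inner ℝ (P.snd x) (p.snd x)) :
    α * ‖p.snd‖ ^ 2 ≤ inner ℝ P p := by
  rw [L2Pair.inner_eq]
  have e1 : 0 ≤ ∫ x in Ω, P.fst x * p.fst x := integral_nonneg_of_ae h1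
  have e2 : α * ‖p.snd‖ ^ 2 ≤ ∫ x in Ω, inner ℝ (P.snd x) (p.snd x) := by
    rw [← real_inner_self_eq_norm_sq, L2.inner_def, ← integral_const_mul]
    refine integral_mono_ae ((L2.integrable_inner _ _).const_mul _) (L2.integrable_inner _ _) ?_
    filter_upwards [h2] with x hx
    rwa [real_inner_self_eq_norm_sq]
  linarith

/-- The integral is the inner product of `P` with the jet of `φ`, and the jets of test functions are
dense in `H10 Ω hb`. This permits test functions such as `A(u) - A(w)`, which are not smooth. -/
theorem forall_testFunction_integral_eq_zero_iff {hb : Bornology.IsBounded Ω}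
    {a : ℝ → ℝ} {c : EuclideanSpace ℝ (Fin n) → ℝ} {u P : L2Pair Ω}
    (h1 : ∀ᵐ x ∂volume.restrict Ω, P.fst x = c x * u.fst x)
    (h2 : ∀ᵐ x ∂volume.restrict Ω, P.snd x = a (u.fst x) • u.snd x) :
    (∀ φ : EuclideanSpace ℝ (Fin n) → ℝ, IsTestFunction Ω φ →
      ∫ x in Ω, (a (u.fst x) * inner ℝ (u.snd x) (gradient φ x) + c x * u.fst x * φ x) = 0) ↔
      ∀ q ∈ H10 Ω hb, inner ℝ P q = 0 := by
  have key : ∀ φ, IsTestFunction Ω φ →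
      ∫ x in Ω, (a (u.fst x) * inner ℝ (u.snd x) (gradient φ x) + c x * u.fst x * φ x)
        = inner ℝ P (jet Ω φ) := by
    intro φ hφ
    have i1 : Integrable (fun x => P.fst x * (jet Ω φ).fst x) (volume.restrict Ω) := by
      refine (L2.integrable_inner (𝕜 := ℝ) P.fst (jet Ω φ).fst).congr
        (Eventually.of_forall fun x => ?_)
      exact mul_comm _ _
    rw [L2Pair.inner_eq, ← integral_add i1 (L2.integrable_inner _ _)]
    refine integral_congr_ae ?_
    filter_upwards [h1, h2, coeFn_jet_fst hb hφ.contDiff_one, coeFn_jet_snd hb hφ.contDiff_one]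
      with x e1 e2 e3 e4
    rw [e1, e2, e3, e4, real_inner_smul_left]
    ring
  constructor
  · intro h q hq
    refine H10_induction (P := fun q => inner ℝ P q = 0)
      (isClosed_eq (continuous_const.inner continuous_id) continuous_const) (fun φ hφ => ?_) hq
    rw [← key φ hφ]
    exact h φ hφ
  · intro h φ hφ
    rw [key φ hφ]
    exact h _ (hφ.jet_mem_H10 hb)

end Multiplier

/-! ### Traces -/

section Trace

variable {n : ℕ} {Ω : Set (EuclideanSpace ℝ (Fin n))}

theorem isTrace_iff (hb : Bornology.IsBounded Ω) {u : H1 Ω} {g : Lp ℝ 2 (surfaceMeasure Ω)} :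
    IsTrace u g ↔ ∃ φ : ℕ → EuclideanSpace ℝ (Fin n) → ℝ, (∀ k, ContDiff ℝ ∞ (φ k)) ∧
      Tendsto (fun k => jet Ω (φ k)) atTop (𝓝 u.1) ∧
      Tendsto (fun k => eLpNorm (fun x => φ k x - g x) 2 (surfaceMeasure Ω)) atTop (𝓝 0) := by
  refine exists_congr fun φ => and_congr_right fun hφ => ?_
  rw [tendsto_jet_iff hb fun k => (hφ k).of_le (by exact_mod_cast le_top), and_assoc]
  rfl

/-- Test functions vanish on the frontier of the open set `Ω`, so adding them to an approximating
sequence leaves its boundary values unchanged. No boundary regularity is needed in this direction.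
-/
theorem IsTrace.add_mem_H10 (hΩ : IsOpen Ω) (hb : Bornology.IsBounded Ω) {w u : H1 Ω}
    {g : Lp ℝ 2 (surfaceMeasure Ω)} (hw : IsTrace w g) (h : u.1 - w.1 ∈ H10 Ω hb) :
    IsTrace u g := by
  obtain ⟨φ, hφ, hφw, hφg⟩ := (isTrace_iff hb).1 hw
  obtain ⟨ζ, hζ, hlim⟩ := exists_tendsto_of_mem_H10 h
  have hφ1 : ∀ k, ContDiff ℝ 1 (φ k) := fun k => (hφ k).of_le (by exact_mod_cast le_top)
  refine (isTrace_iff hb).2 ⟨fun k => φ k + ζ k, fun k => (hφ k).add (hζ k).1, ?_, ?_⟩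
  · have := hφw.add hlim
    rw [add_sub_cancel] at this
    exact this.congr fun k => (jet_add hb (hφ1 k) (hζ k).contDiff_one).symm
  · refine hφg.congr fun k => eLpNorm_congr_ae ?_
    refine (ae_restrict_iff' isClosed_frontier.measurableSet).2
      (Eventually.of_forall fun x hx => ?_)
    have : ζ k x = 0 := image_eq_zero_of_notMem_tsupport fun hx' =>
      (hΩ.frontier_eq ▸ hx).2 ((hζ k).2.2 hx')
    simp only [Pi.add_apply, this, add_zero]

theorem tendsto_eLpNorm_sub_of_tendsto {X : Type*} [MeasurableSpace X] {μ : Measure X}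
    {φ ψ : ℕ → X → ℝ} {g : X → ℝ} (hφ : ∀ k, AEStronglyMeasurable (φ k) μ)
    (hψ : ∀ k, AEStronglyMeasurable (ψ k) μ) (hg : AEStronglyMeasurable g μ)
    (h1 : Tendsto (fun k => eLpNorm (fun x => φ k x - g x) 2 μ) atTop (𝓝 0))
    (h2 : Tendsto (fun k => eLpNorm (fun x => ψ k x - g x) 2 μ) atTop (𝓝 0)) :
    Tendsto (fun k => eLpNorm (fun x => φ k x - ψ k x) 2 μ) atTop (𝓝 0) := by
  have h := h1.add h2
  rw [add_zero] at h
  refine tendsto_of_tendsto_of_tendsto_of_le_of_le tendsto_const_nhds h (fun _ => zero_le)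
    fun k => ?_
  have := eLpNorm_sub_le (p := 2) ((hφ k).sub hg) ((hψ k).sub hg) one_le_two
  refine le_trans (le_of_eq ?_) this
  congr 1
  ext x
  simp

/-- Two functions with the same trace have, after composition with a `C¹` function with bounded
derivative, a difference in `H¹₀(Ω)`. -/
theorem exists_comp_sub_mem_H10 [NeZero n] (hΩ : IsOpen Ω) (hne : Ωᶜ.Nonempty)
    (hb : Bornology.IsBounded Ω) (hbdry : HasPiecewiseC1Boundary Ω) {A A' : ℝ → ℝ}
    (hA : ∀ t, HasDerivAt A (A' t) t) (hc : Continuous A') {M : ℝ} (hM : ∀ t, ‖A' t‖ ≤ M)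
    (hA0 : A 0 = 0) {u w : H1 Ω} {g : Lp ℝ 2 (surfaceMeasure Ω)} (hu : IsTrace u g)
    (hw : IsTrace w g) :
    ∃ p q : L2Pair Ω,
      (∀ᵐ x ∂volume.restrict Ω, p.fst x = A (u.1.fst x)) ∧
      (∀ᵐ x ∂volume.restrict Ω, p.snd x = A' (u.1.fst x) • u.1.snd x) ∧
      (∀ᵐ x ∂volume.restrict Ω, q.fst x = A (w.1.fst x)) ∧
      (∀ᵐ x ∂volume.restrict Ω, q.snd x = A' (w.1.fst x) • w.1.snd x) ∧ p - q ∈ H10 Ω hb := by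
  obtain ⟨φ, hφ, hφu, hφg⟩ := (isTrace_iff hb).1 hu
  obtain ⟨ψ, hψ, hψw, hψg⟩ := (isTrace_iff hb).1 hw
  have hφ1 : ∀ k, ContDiff ℝ 1 (φ k) := fun k => (hφ k).of_le (by exact_mod_cast le_top)
  have hψ1 : ∀ k, ContDiff ℝ 1 (ψ k) := fun k => (hψ k).of_le (by exact_mod_cast le_top)
  have hAC := contDiff_one_of_hasDerivAt hA hc
  obtain ⟨p, hp1, hp2, s, hs, hsp⟩ := exists_jet_comp_tendsto hb hA hc hM hA0 hφ1 hφu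
  -- The second subsequence is extracted from the first, so that both compositions converge along
  -- the common indices `s (t k)`.
  obtain ⟨q, hq1, hq2, t, ht, htq⟩ := exists_jet_comp_tendsto hb hA hc hM hA0
    (fun k => hψ1 (s k)) (hψw.comp hs.tendsto_atTop)
  have hst : Tendsto (fun k => s (t k)) atTop atTop := hs.tendsto_atTop.comp ht.tendsto_atTop
  refine ⟨p, q, hp1, hp2, hq1, hq2, ?_⟩
  have hdiff : ∀ k, ContDiff ℝ 1 (A ∘ φ (s (t k)) - A ∘ ψ (s (t k))) := fun k =>
    (hAC.comp (hφ1 _)).sub (hAC.comp (hψ1 _))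
  refine mem_H10_of_tendsto_jet_of_neZero hΩ hne hb hbdry hdiff ?_ ?_
  · refine ((hsp.comp ht.tendsto_atTop).sub htq).congr fun k => ?_
    exact (jet_sub hb (hAC.comp (hφ1 _)) (hAC.comp (hψ1 _))).symm
  · have h := (tendsto_eLpNorm_sub_of_tendsto (fun k => (hφ k).continuous.aestronglyMeasurable)
      (fun k => (hψ k).continuous.aestronglyMeasurable) (Lp.aestronglyMeasurable g)
      hφg hψg).comp hst
    have h0 := ENNReal.Tendsto.const_mul (a := ENNReal.ofReal M) h (Or.inr ENNReal.ofReal_ne_top)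
    rw [mul_zero] at h0
    refine tendsto_of_tendsto_of_tendsto_of_le_of_le tendsto_const_nhds h0 (fun _ => zero_le)
      fun k => eLpNorm_le_mul_eLpNorm_of_ae_le_mul (Eventually.of_forall fun x => ?_) 2
    exact norm_sub_le_of_hasDerivAt hA hM _ _

theorem IsTrace.sub_mem_H10 [NeZero n] (hΩ : IsOpen Ω) (hne : Ωᶜ.Nonempty)
    (hb : Bornology.IsBounded Ω) (hbdry : HasPiecewiseC1Boundary Ω) {u w : H1 Ω}
    {g : Lp ℝ 2 (surfaceMeasure Ω)} (hu : IsTrace u g) (hw : IsTrace w g) :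
    u.1 - w.1 ∈ H10 Ω hb := by
  obtain ⟨p, q, hp1, hp2, hq1, hq2, h⟩ := exists_comp_sub_mem_H10 hΩ hne hb hbdry
    (A := id) (A' := fun _ => 1) (M := 1) hasDerivAt_id continuous_const (by simp) rfl hu hw
  have hpu : p = u.1 := L2Pair.ext_ae hp1 (hp2.mono fun x hx => by rw [hx, one_smul])
  have hqw : q = w.1 := L2Pair.ext_ae hq1 (hq2.mono fun x hx => by rw [hx, one_smul])
  rwa [hpu, hqw] at h

end Trace

/-! ### Existence, uniqueness and the a priori bound -/

section Main

variable {n : ℕ} [NeZero n] {Ω : Set (EuclideanSpace ℝ (Fin n))}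

/-- Solvability of the semilinear equation `-Δv + c b(v) = 0` with `v - v₀ ∈ H¹₀(Ω)`. -/
theorem exists_semilinear_solution (hb : Bornology.IsBounded Ω)
    {c : EuclideanSpace ℝ (Fin n) → ℝ} (hc : AEStronglyMeasurable c (volume.restrict Ω))
    {M : ℝ} (hcM : ∀ᵐ x ∂volume.restrict Ω, 0 ≤ c x ∧ c x ≤ M) {b : ℝ → ℝ} {B : ℝ}
    (hbB : ∀ s t, ‖b s - b t‖ ≤ B * ‖s - t‖) (hb0 : b 0 = 0) (hmono : Monotone b)
    (v₀ : L2Pair Ω) :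
    ∃ v P : L2Pair Ω, v - v₀ ∈ H10 Ω hb ∧
      (∀ᵐ x ∂volume.restrict Ω, P.fst x = c x * b (v.fst x)) ∧ P.snd = v.snd ∧
      ∀ q ∈ H10 Ω hb, inner ℝ P q = 0 := by
  have hbc : Continuous b :=
    (LipschitzWith.of_dist_le_mul (K := B.toNNReal) fun s t => by
      rw [dist_eq_norm, dist_eq_norm]
      exact (hbB s t).trans (mul_le_mul_of_nonneg_right (Real.le_coe_toNNReal B)
        (norm_nonneg _))).continuous
  have hex : ∀ y : L2Pair Ω, ∃ P : L2Pair Ω,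
      (∀ᵐ x ∂volume.restrict Ω, P.fst x = c x * b (y.fst x)) ∧ P.snd = y.snd := by
    intro y
    have m1 : MemLp (fun x => c x * b (y.fst x)) 2 (volume.restrict Ω) := by
      refine (Lp.memLp y.fst).of_le_mul (c := M * B)
        (hc.mul (hbc.comp_aestronglyMeasurable (Lp.aestronglyMeasurable _))) ?_
      filter_upwards [hcM] with x hx
      have := hbB (y.fst x) 0
      rw [hb0, sub_zero, sub_zero] at this
      rw [norm_mul, Real.norm_of_nonneg hx.1, mul_assoc]
      exact mul_le_mul hx.2 this (norm_nonneg _) (hx.1.trans hx.2)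
    exact ⟨WithLp.toLp 2 (m1.toLp _, y.snd), m1.coeFn_toLp, rfl⟩
  choose T hT1 hT2 using hex
  obtain ⟨κ, hκ, hpoin⟩ := exists_poincare_of_neZero hb
  have : CompleteSpace (H10 Ω hb) := (isClosed_H10 hb).completeSpace_coe
  have hB0 : 0 ≤ B := by
    have := (norm_nonneg _).trans (hbB 1 0)
    simpa using this
  have hLip : ∀ x y : H10 Ω hb, ‖T (v₀ + x) - T (v₀ + y)‖ ≤ max (M * B) 1 * ‖x - y‖ := by
    intro x y
    have e : ‖x - y‖ = ‖(v₀ + (x : L2Pair Ω)) - (v₀ + y)‖ := by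
      rw [add_sub_add_left_eq_sub]
      rfl
    rw [e]
    set p := v₀ + (x : L2Pair Ω)
    set q := v₀ + (y : L2Pair Ω)
    refine L2Pair.norm_le_mul_norm (zero_le_one.trans (le_max_right _ _)) ?_ ?_
    · filter_upwards [coeFn_sub_fst (T p) (T q), coeFn_sub_fst p q, hT1 p, hT1 q, hcM]
        with t h1 h2 h3 h4 h5
      rw [h1, h2, h3, h4, ← mul_sub, norm_mul, Real.norm_of_nonneg h5.1]
      calc c t * ‖b (p.fst t) - b (q.fst t)‖ ≤ M * (B * ‖p.fst t - q.fst t‖) :=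
            mul_le_mul h5.2 (hbB _ _) (norm_nonneg _) (h5.1.trans h5.2)
        _ = M * B * ‖p.fst t - q.fst t‖ := by ring
        _ ≤ _ := mul_le_mul_of_nonneg_right (le_max_left _ _) (norm_nonneg _)
    · refine Eventually.of_forall fun t => ?_
      rw [WithLp.sub_snd, WithLp.sub_snd, hT2, hT2]
      exact le_mul_of_one_le_left (norm_nonneg _) (le_max_right _ _)
  -- The gradient part contributes exactly `‖∇(x - y)‖²`, which the Poincaré inequality bounds
  -- below; the zero order part is nonnegative since `b` is monotone and `c ≥ 0`.
  have hMon : ∀ x y : H10 Ω hb, κ * ‖x - y‖ ^ 2 ≤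
      inner ℝ (T (v₀ + x) - T (v₀ + y)) ((x - y : H10 Ω hb) : L2Pair Ω) := by
    intro x y
    refine (hpoin _ (x - y).2).trans ?_
    have e : ((x - y : H10 Ω hb) : L2Pair Ω) = (v₀ + (x : L2Pair Ω)) - (v₀ + y) := by
      rw [add_sub_add_left_eq_sub]
      rfl
    rw [e]
    set p := v₀ + (x : L2Pair Ω)
    set q := v₀ + (y : L2Pair Ω)
    rw [← one_mul (‖(p - q).snd‖ ^ 2)]
    refine mul_norm_snd_sq_le_inner ?_ ?_
    · filter_upwards [coeFn_sub_fst (T p) (T q), coeFn_sub_fst p q, hT1 p, hT1 q, hcM]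
        with t h1 h2 h3 h4 h5
      rw [h1, h2, h3, h4, ← mul_sub, mul_assoc]
      refine mul_nonneg h5.1 ?_
      rcases le_total (p.fst t) (q.fst t) with h | h
      · exact mul_nonneg_of_nonpos_of_nonpos (sub_nonpos.2 (hmono h)) (sub_nonpos.2 h)
      · exact mul_nonneg (sub_nonneg.2 (hmono h)) (sub_nonneg.2 h)
    · refine Eventually.of_forall fun t => ?_
      rw [WithLp.sub_snd (T p), hT2, hT2, ← WithLp.sub_snd, one_mul, real_inner_self_eq_norm_sq]
  obtain ⟨z, hz⟩ := exists_forall_inner_eq_zero (H10 Ω hb) (fun z => T (v₀ + z)) hκ hLip hMon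
  exact ⟨v₀ + z, T (v₀ + z), by simp, hT1 _, hT2 _, hz⟩

variable {α : ℝ} {a : ℝ → ℝ} {c : EuclideanSpace ℝ (Fin n) → ℝ}

/-- The semilinear problem is solved for `v` with `v - A(w)` in `H¹₀(Ω)`, and `u = b(v)` solves the
original one. Both substitutions are made on smooth approximants, since the chain rule is available
for limits of `C¹` functions. -/
theorem exists_isWeakSolution (hΩ : IsOpen Ω) (hb : Bornology.IsBounded Ω) (hα : 0 < α)
    (ha : Continuous a) (haα : ∀ t, α ≤ a t ∧ a t ≤ 1 / α)
    (hc : AEStronglyMeasurable c (volume.restrict Ω))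
    (hcα : ∀ᵐ x ∂volume.restrict Ω, 0 ≤ c x ∧ c x ≤ 1 / α) {g : Lp ℝ 2 (surfaceMeasure Ω)}
    (hg : g ∈ HHalf Ω) : ∃ u : H1 Ω, IsWeakSolution a c g u := by
  obtain ⟨w, hw⟩ := hg
  have hpos : ∀ t, 0 < a t := fun t => hα.trans_le (haα t).1
  obtain ⟨A, b, hA, hbd, hbc, hA0, hb0, hbA, hAb⟩ :=
    exists_kirchhoff_transform ha hα fun t => (haα t).1
  have haM : ∀ t, ‖a t‖ ≤ 1 / α := fun t => by
    rw [Real.norm_of_nonneg (hpos t).le]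
    exact (haα t).2
  have hbM : ∀ t, ‖(a (b t))⁻¹‖ ≤ 1 / α := fun t => by
    rw [norm_inv, Real.norm_of_nonneg (hpos _).le, ← one_div]
    exact one_div_le_one_div_of_le hα (haα _).1
  have hbd' : Continuous fun t => (a (b t))⁻¹ :=
    (ha.comp hbc).inv₀ fun t => (hpos _).ne'
  have hAC := contDiff_one_of_hasDerivAt hA ha
  have hbC := contDiff_one_of_hasDerivAt hbd hbd'
  obtain ⟨ψ, hψ, hψw, -⟩ := (isTrace_iff hb).1 hw
  have hψ1 : ∀ k, ContDiff ℝ 1 (ψ k) := fun k => (hψ k).of_le (by exact_mod_cast le_top)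
  obtain ⟨v₀, -, -, s, hs, hsv₀⟩ := exists_jet_comp_tendsto hb hA ha haM hA0 hψ1 hψw
  have hmono : Monotone b := monotone_of_deriv_nonneg (fun t => (hbd t).differentiableAt)
    fun t => by rw [(hbd t).deriv]; exact (inv_pos.2 (hpos _)).le
  obtain ⟨v, P, hv, hP1, hP2, hP⟩ := exists_semilinear_solution hb hc hcα
    (norm_sub_le_of_hasDerivAt hbd hbM) hb0 hmono v₀
  obtain ⟨ζ, hζ, hζv⟩ := exists_tendsto_of_mem_H10 hv
  have hf : ∀ k, ContDiff ℝ 1 (A ∘ ψ (s k) + ζ k) := fun k =>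
    (hAC.comp (hψ1 _)).add (hζ k).contDiff_one
  have hfv : Tendsto (fun k => jet Ω (A ∘ ψ (s k) + ζ k)) atTop (𝓝 v) := by
    have := hsv₀.add hζv
    rw [add_sub_cancel] at this
    exact this.congr fun k => (jet_add hb (hAC.comp (hψ1 _)) (hζ k).contDiff_one).symm
  obtain ⟨u, hu1, hu2, t, ht, htu⟩ := exists_jet_comp_tendsto hb hbd hbd' hbM hb0 hf hfv
  have huH : u ∈ H1 Ω := isClosed_H1.mem_of_tendsto htu
    (Eventually.of_forall fun k => jet_mem_H1 hb (hbC.comp (hf _)))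
  have huw : u - w.1 ∈ H10 Ω hb := by
    have hlim : Tendsto (fun k => jet Ω (b ∘ (A ∘ ψ (s (t k)) + ζ (t k)) - ψ (s (t k)))) atTop
        (𝓝 (u - w.1)) := by
      refine (htu.sub (hψw.comp (hs.tendsto_atTop.comp ht.tendsto_atTop))).congr fun k => ?_
      exact (jet_sub hb (hbC.comp (hf _)) (hψ1 _)).symm
    refine (isClosed_H10 hb).mem_of_tendsto hlim (Eventually.of_forall fun k => ?_)
    -- Where `ζ` vanishes, `b (A ψ) = ψ`. The difference is thus a `C¹` function with compact
    -- support in `Ω`, although it need not be smooth.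
    have hsupp : Function.support (b ∘ (A ∘ ψ (s (t k)) + ζ (t k)) - ψ (s (t k)))
        ⊆ Function.support (ζ (t k)) := by
      intro x hx hx0
      refine hx ?_
      simp only [Pi.sub_apply, Function.comp_apply, Pi.add_apply]
      rw [hx0, add_zero, hbA, sub_self]
    exact jet_mem_H10 hΩ hb ((hbC.comp (hf _)).sub (hψ1 _)) ((hζ (t k)).2.1.mono hsupp)
      ((closure_mono hsupp).trans (hζ (t k)).2.2)
  refine ⟨⟨u, huH⟩, ?_, hw.add_mem_H10 hΩ hb huw⟩
  refine (forall_testFunction_integral_eq_zero_iff (hb := hb) (u := u) (P := P) ?_ ?_).2 hP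
  · filter_upwards [hP1, hu1] with x h1 h2
    rw [h1, h2]
  · filter_upwards [hu1, hu2] with x h1 h2
    -- Since `∇u = a(b(v))⁻¹ ∇v`, the flux `a(u)∇u` is `∇v`.
    rw [hP2, h2, h1, smul_smul, mul_inv_cancel₀ (hpos _).ne', one_smul]

set_option maxHeartbeats 1600000 in
-- The fluxes differ by exactly `∇(A(u) - A(w))`, so `A(u) - A(w)` is the natural test function.
-- Testing with `u - w` would leave the term `(a(u) - a(w))∇w`, which mere continuity of `a` does
-- not control.
theorem IsWeakSolution.unique (hΩ : IsOpen Ω) (hne : Ωᶜ.Nonempty) (hb : Bornology.IsBounded Ω)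
    (hbdry : HasPiecewiseC1Boundary Ω) (hα : 0 < α)
    (ha : Continuous a) (haα : ∀ t, α ≤ a t ∧ a t ≤ 1 / α)
    (hc : AEStronglyMeasurable c (volume.restrict Ω))
    (hcα : ∀ᵐ x ∂volume.restrict Ω, 0 ≤ c x ∧ c x ≤ 1 / α) {g : Lp ℝ 2 (surfaceMeasure Ω)}
    {u w : H1 Ω} (hu : IsWeakSolution a c g u) (hw : IsWeakSolution a c g w) : u = w := by
  have hpos : ∀ t, 0 < a t := fun t => hα.trans_le (haα t).1
  obtain ⟨A, b, hA, hbd, hbc, hA0, hb0, hbA, hAb⟩ :=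
    exists_kirchhoff_transform ha hα fun t => (haα t).1
  have haM : ∀ t, ‖a t‖ ≤ 1 / α := fun t => by
    rw [Real.norm_of_nonneg (hpos t).le]
    exact (haα t).2
  have hmono : Monotone A := monotone_of_deriv_nonneg (fun t => (hA t).differentiableAt)
    fun t => by rw [(hA t).deriv]; exact (hpos _).le
  have hcM : ∀ᵐ x ∂volume.restrict Ω, ‖c x‖ ≤ 1 / α := by
    filter_upwards [hcα] with x hx
    rw [Real.norm_of_nonneg hx.1]
    exact hx.2
  obtain ⟨p, q, hp1, hp2, hq1, hq2, hpq⟩ :=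
    exists_comp_sub_mem_H10 hΩ hne hb hbdry hA ha haM hA0 hu.2 hw.2
  obtain ⟨P, hP1, hP2⟩ := exists_multiplier hc
    (ha.comp_aestronglyMeasurable (Lp.aestronglyMeasurable u.1.fst)) hcM
    (Eventually.of_forall fun x => haM _) u.1
  obtain ⟨Q, hQ1, hQ2⟩ := exists_multiplier hc
    (ha.comp_aestronglyMeasurable (Lp.aestronglyMeasurable w.1.fst)) hcM
    (Eventually.of_forall fun x => haM _) w.1
  have hPz := (forall_testFunction_integral_eq_zero_iff (hb := hb) hP1 hP2).1 hu.1 _ hpq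
  have hQz := (forall_testFunction_integral_eq_zero_iff (hb := hb) hQ1 hQ2).1 hw.1 _ hpq
  have hle : 1 * ‖(p - q).snd‖ ^ 2 ≤ inner ℝ (P - Q) (p - q) := by
    refine mul_norm_snd_sq_le_inner ?_ ?_
    · filter_upwards [coeFn_sub_fst P Q, coeFn_sub_fst p q, hP1, hQ1, hp1, hq1, hcα]
        with x h1 h2 h3 h4 h5 h6 h7
      rw [h1, h2, h3, h4, h5, h6, ← mul_sub, mul_assoc]
      refine mul_nonneg h7.1 ?_
      rcases le_total (u.1.fst x) (w.1.fst x) with h | h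
      · exact mul_nonneg_of_nonpos_of_nonpos (sub_nonpos.2 h) (sub_nonpos.2 (hmono h))
      · exact mul_nonneg (sub_nonneg.2 h) (sub_nonneg.2 (hmono h))
    · filter_upwards [coeFn_sub_snd P Q, coeFn_sub_snd p q, hP2, hQ2, hp2, hq2]
        with x h1 h2 h3 h4 h5 h6
      rw [h1, h2, h3, h4, h5, h6, one_mul, real_inner_self_eq_norm_sq]
  rw [inner_sub_left, hPz, hQz, sub_zero, one_mul] at hle
  obtain ⟨κ, hκ, hpoin⟩ := exists_poincare_of_neZero hb
  have hzero : ‖p - q‖ ^ 2 ≤ 0 := by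
    have := (hpoin _ hpq).trans hle
    by_contra! h
    exact absurd this (not_le.2 (mul_pos hκ h))
  have heq : p = q := by
    rw [← sub_eq_zero, ← norm_eq_zero]
    exact pow_eq_zero_iff two_ne_zero |>.1 (le_antisymm hzero (sq_nonneg _))
  subst heq
  have hfst : ∀ᵐ x ∂volume.restrict Ω, u.1.fst x = w.1.fst x := by
    filter_upwards [hp1, hq1] with x h1 h2
    rw [← hbA (u.1.fst x), ← h1, h2, hbA]
  have hsnd : ∀ᵐ x ∂volume.restrict Ω, u.1.snd x = w.1.snd x := by
    filter_upwards [hp2, hq2, hfst] with x h1 h2 h3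
    rw [h1, h3] at h2
    exact smul_right_injective _ (hpos (w.1.fst x)).ne' h2
  exact Subtype.ext (L2Pair.ext_ae hfst hsnd)

set_option maxHeartbeats 1600000 in
-- Once `a(u)` is regarded as a given bounded coefficient, this is the energy estimate for a linear
-- equation, tested with `z = u - w`. Allowing every extension `w` of `g` prepares the passage to
-- the infimum.
theorem exists_norm_le_of_isWeakSolution (hΩ : IsOpen Ω) (hne : Ωᶜ.Nonempty)
    (hb : Bornology.IsBounded Ω) (hbdry : HasPiecewiseC1Boundary Ω) (hα : 0 < α) :
    ∃ C : ℝ, 0 ≤ C ∧ ∀ (a : ℝ → ℝ) (c : EuclideanSpace ℝ (Fin n) → ℝ),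
      Continuous a → (∀ t, α ≤ a t ∧ a t ≤ 1 / α) →
      AEStronglyMeasurable c (volume.restrict Ω) →
      (∀ᵐ x ∂volume.restrict Ω, 0 ≤ c x ∧ c x ≤ 1 / α) →
      ∀ (g : Lp ℝ 2 (surfaceMeasure Ω)) (u w : H1 Ω), IsWeakSolution a c g u → IsTrace w g →
        ‖u.1‖ ≤ C * ‖w.1‖ := by
  obtain ⟨κ, hκ, hpoin⟩ := exists_poincare_of_neZero hb
  -- Coercivity and boundedness give `α κ ‖z‖² ≤ (1 / α) ‖w‖ ‖z‖`, and the summand `1` is for `w` in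
  -- `u = w + z`. Here `κ` was chosen before `a`, `c` and `g`.
  refine ⟨1 + 1 / (α ^ 2 * κ), by positivity, fun a c ha haα hc hcα g u w hu hw => ?_⟩
  have hpos : ∀ t, 0 < a t := fun t => hα.trans_le (haα t).1
  have haM : ∀ t, ‖a t‖ ≤ 1 / α := fun t => by
    rw [Real.norm_of_nonneg (hpos t).le]
    exact (haα t).2
  have hcM : ∀ᵐ x ∂volume.restrict Ω, ‖c x‖ ≤ 1 / α := by
    filter_upwards [hcα] with x hx
    rw [Real.norm_of_nonneg hx.1]
    exact hx.2
  have hz : u.1 - w.1 ∈ H10 Ω hb := hu.2.sub_mem_H10 hΩ hne hb hbdry hw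
  have hσ := ha.comp_aestronglyMeasurable (Lp.aestronglyMeasurable u.1.fst)
  obtain ⟨P, hP1, hP2⟩ := exists_multiplier hc hσ hcM (Eventually.of_forall fun x => haM _) u.1
  -- The coefficient is still `a(u)`, not `a(w)`; hence `P - Q` is the same multiplier applied to `u
  -- - w`.
  obtain ⟨Q, hQ1, hQ2⟩ := exists_multiplier hc hσ hcM (Eventually.of_forall fun x => haM _) w.1
  have hPz := (forall_testFunction_integral_eq_zero_iff (hb := hb) hP1 hP2).1 hu.1 _ hz
  have hQn : ‖Q‖ ≤ 1 / α * ‖w.1‖ := by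
    refine L2Pair.norm_le_mul_norm (by positivity) ?_ ?_
    · filter_upwards [hQ1, hcM] with x h1 h2
      rw [h1, norm_mul]
      exact mul_le_mul_of_nonneg_right h2 (norm_nonneg _)
    · filter_upwards [hQ2] with x h1
      rw [h1, norm_smul]
      exact mul_le_mul_of_nonneg_right (haM _) (norm_nonneg _)
  have hle : α * ‖(u.1 - w.1).snd‖ ^ 2 ≤ inner ℝ (P - Q) (u.1 - w.1) := by
    refine mul_norm_snd_sq_le_inner ?_ ?_
    · filter_upwards [coeFn_sub_fst P Q, coeFn_sub_fst u.1 w.1, hP1, hQ1, hcα]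
        with x h1 h2 h3 h4 h5
      rw [h1, h2, h3, h4, ← mul_sub, mul_assoc]
      exact mul_nonneg h5.1 (mul_self_nonneg _)
    · filter_upwards [coeFn_sub_snd P Q, coeFn_sub_snd u.1 w.1, hP2, hQ2] with x h1 h2 h3 h4
      rw [h1, h2, h3, h4, ← smul_sub, real_inner_smul_left, real_inner_self_eq_norm_sq]
      exact mul_le_mul_of_nonneg_right (haα _).1 (sq_nonneg _)
  rw [inner_sub_left, hPz, zero_sub] at hle
  set z := u.1 - w.1 with hzdef
  have h1 : -inner ℝ Q z ≤ 1 / α * ‖w.1‖ * ‖z‖ := by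
    refine (neg_le_abs _).trans ((abs_real_inner_le_norm _ _).trans ?_)
    gcongr
  have h2 : α * (κ * ‖z‖ ^ 2) ≤ 1 / α * ‖w.1‖ * ‖z‖ :=
    (mul_le_mul_of_nonneg_left (hpoin z hz) hα.le).trans (hle.trans h1)
  have h3 : ‖z‖ ≤ 1 / (α ^ 2 * κ) * ‖w.1‖ := by
    rcases (norm_nonneg z).eq_or_lt with h | h
    · rw [← h]
      positivity
    · have h4 : α * κ * ‖z‖ ≤ 1 / α * ‖w.1‖ := by
        refine le_of_mul_le_mul_right ?_ h
        calc α * κ * ‖z‖ * ‖z‖ = α * (κ * ‖z‖ ^ 2) := by ring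
          _ ≤ _ := h2
      rw [div_mul_eq_mul_div, one_mul, le_div_iff₀ (by positivity)]
      calc ‖z‖ * (α ^ 2 * κ) = α * (α * κ * ‖z‖) := by ring
        _ ≤ α * (1 / α * ‖w.1‖) := by gcongr
        _ = ‖w.1‖ := by field_simp
  calc ‖u.1‖ = ‖w.1 + z‖ := by rw [hzdef, add_sub_cancel]
    _ ≤ ‖w.1‖ + ‖z‖ := norm_add_le _ _
    _ ≤ (1 + 1 / (α ^ 2 * κ)) * ‖w.1‖ := by linarith

end Main

end QuasilinearElliptic

/-! ### The theorem -/

theorem theorem2 (n : ℕ) (hn : n = 2 ∨ n = 3) (Ω : Set (EuclideanSpace ℝ (Fin n)))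
    (hΩ_open : IsOpen Ω) (hΩ_conn : IsConnected Ω) (hΩ_bdd : Bornology.IsBounded Ω)
    (hΩ_bdry : QuasilinearElliptic.HasPiecewiseC1Boundary Ω) (α : ℝ) (hα : 0 < α) :
    ∃ C : ℝ, ∀ (a : ℝ → ℝ) (c : EuclideanSpace ℝ (Fin n) → ℝ),
      Continuous a → (∀ t, α ≤ a t ∧ a t ≤ 1 / α) →
      MemLp c ∞ (volume.restrict Ω) → (∀ᵐ x ∂(volume.restrict Ω), 0 ≤ c x ∧ c x ≤ 1 / α) →
      ∀ g ∈ QuasilinearElliptic.HHalf Ω,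
        (∃! u : QuasilinearElliptic.H1 Ω, QuasilinearElliptic.IsWeakSolution a c g u) ∧
        ∀ u : QuasilinearElliptic.H1 Ω, QuasilinearElliptic.IsWeakSolution a c g u →
          ‖u‖ ≤ C * QuasilinearElliptic.hHalfNorm g := by
  have : NeZero n := ⟨by lia⟩
  have hne : Ωᶜ.Nonempty := by
    rw [nonempty_compl]
    rintro rfl
    exact NormedSpace.unbounded_univ ℝ (EuclideanSpace ℝ (Fin n)) hΩ_bdd
  obtain ⟨C, hC0, hC⟩ := QuasilinearElliptic.exists_norm_le_of_isWeakSolution hΩ_open hne hΩ_bdd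
    hΩ_bdry hα
  refine ⟨C, fun a c ha haα hc hcα g hg => ⟨?_, fun u hu => ?_⟩⟩
  · obtain ⟨u, hu⟩ := QuasilinearElliptic.exists_isWeakSolution hΩ_open hΩ_bdd hα ha haα
      hc.aestronglyMeasurable hcα hg
    exact ⟨u, hu, fun w hw => QuasilinearElliptic.IsWeakSolution.unique hΩ_open hne hΩ_bdd hΩ_bdry
      hα ha haα hc.aestronglyMeasurable hcα hw hu⟩
  · obtain ⟨w₀, hw₀⟩ := hg
    -- A real infimum over an empty family would be `0`. Since `g` has an extension, a bound valid
    -- for every extension passes to the infimum.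
    have : Nonempty {u : QuasilinearElliptic.H1 Ω // QuasilinearElliptic.IsTrace u g} :=
      ⟨⟨w₀, hw₀⟩⟩
    rw [QuasilinearElliptic.hHalfNorm, Real.mul_iInf_of_nonneg hC0]
    exact le_ciInf fun w => hC a c ha haα hc.aestronglyMeasurable hcα g u w.1 hu w.2
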